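/- **Setting.** Let $\Theta\subset\mathbb R^k$ be open and let $\theta\mapsto R(\theta)$ map $\Theta$ one-to-one into the positive definite $p\times p$ correlation matrices, such that the matrices of partial derivatives $\dot R_m(\theta)=\partial R(\theta)/\partial\theta_m$, $m=1,\dots,k$, exist, are continuous in $\theta$ on $\Theta$, and are linearly independent for each $\theta\in\Theta$. Let $\Phi$ be the standard normal distribution function and, for $u\in(0,1)^p$, put $z_j=\Phi^{-1}(u_j)$. Let $P_\theta$ be the Gaussian copula law, i.e. the law of $U=(\Phi(Z_1),\dots,\Phi(Z_p))$ with $Z\sim N_p(0,R(\theta))$; its log density is $\ell(u;\theta)=-\tfrac12\log\det R(\theta)-\tfrac12 z'(R(\theta)^{-1}-I_p)z$. For absolutely continuous distribution functions $F_1,\dots,F_p$ on $\mathbb R$ let $P_{\theta,F}$ be the law on $\mathbb R^p$ with margins $F_j$ and copula law $P_\theta$. Let $X_1,\dots,X_n$ be i.i.d. with law $P_{\theta,F}$, $X_i=(X_{i1},\dots,X_{ip})'$, and write $F(X_i)=(F_1(X_{i1}),\dots,F_p(X_{ip}))$. **Efficiency.** Let $L_2^0[0,1]$ be the space of $h\in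 L_2[0,1]$ with $\int_0^1 h=0$. Let $T_\theta\subset L_2(P_\theta)$ be the set of all functions $\sum_{j=1}^p\{h_j(u_j)+\partial_{u_j}\ell(u;\theta)\int_0^{u_j}h_j(t)\,dt\}$ with $h_1,\dots,h_p\in L_2^0[0,1]$. The efficient score is $\ell^*_{\theta}=(\ell^*_{\theta,1},\dots,\ell^*_{\theta,k})'$, where $\ell^*_{\theta,m}$ is $\partial_{\theta_m}\ell(\cdot;\theta)$ minus its orthogonal projection in $L_2(P_\theta)$ on $T_\theta$, and the efficient information is $I^*(\theta)=E_{P_\theta}[\ell^*_\theta(U)\,\ell^{*}_\theta(U)']$. An estimator sequence $\hat\theta_n$ is *efficient* at $P_{\theta,F}$ if, under $P_{\theta,F}$, $$\sqrt n(\hat\theta_n-\theta)=\frac1{\sqrt n}\sum_{i=1}^n I^*(\theta)^{-1}\ell^*_\theta(F(X_i))+o_P(1).$$ **Regularity.** For $h\in L_2^0[0,1]$ and a distribution function $F_j$ with density $f_j$, let $F_{j,\eta}^{h}$ be the distribution function whose density is proportional to $x\mapsto 2\{1+e^{-2\eta h(F_j(x))}\}^{-1}f_j(x)$. The sequence $\hat\theta_n$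 is *regular* at $P_{\theta,F}$ if there is a probability law $L$ on $\mathbb R^k$ such that for all $\alpha\in\mathbb R^k$ and $h_1,\dots,h_p\in L_2^0[0,1]$, with $\theta_n=\theta+\alpha/\sqrt n$, the law of $\sqrt n(\hat\theta_n-\theta_n)$ under $n$ i.i.d. observations from $P_{\theta_n,F^{h_1}_{1,1/\sqrt n},\dots,F^{h_p}_{p,1/\sqrt n}}$ converges weakly to $L$. It is *rank-based* if $\hat\theta_n$ is a function only of the ranks of the $X_{ij}$ within the marginal samples $X_{1j},\dots,X_{nj}$. **Proposition.** Let $\theta\in\Theta$ and let $F_1,\dots,F_p$ be absolutely continuous (for instance uniform on $[0,1]$, in which case $P_{\theta,F}=P_\theta$). Let $\hat\theta_n$ be a rank-based estimator sequence that is regular at $P_{\theta,F}$, and let $B_1,\dots,B_k$ be real symmetric $p\times p$ matrices. Suppose there are matrices $A_1,\dots,A_k\in\operatorname{span}(B_1,\dots,B_k)$ such that, under $P_{\theta,F}$, for each $m$, $$\sqrt n(\hat\theta_{n,m}-\theta_m)=\frac1{\sqrt n}\sum_{i=1}^n q_{A_m}(F(X_i))+o_P(1),\qquad q_A(u)=\tfrac12\bigl(z'Az-E_{P_\theta}[Z'AZ]\bigr),\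 Z_j=\Phi^{-1}(U_j).$$ Write $B_{m,R}=R(\theta)B_mR(\theta)$ and let $\operatorname{diag}(M)$ denote the diagonal matrix with the same diagonal as $M$. Then $\hat\theta_n$ is efficient at $P_{\theta,F}$ if and only if, for each $m=1,\dots,k$, the matrix $$B_{m,R}-\tfrac12\bigl(\operatorname{diag}(B_{m,R})\,R(\theta)+R(\theta)\,\operatorname{diag}(B_{m,R})\bigr)$$ belongs to the linear span of $\dot R_1(\theta),\dots,\dot R_k(\theta)$. -/

import Mathlib

open MeasureTheory ProbabilityTheory Filter Topology Matrix

noncomputable section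

namespace GaussianCopula

/-! ### Parametrized correlation matrices -/

/-- The matrix of partial derivatives `∂R_{ij}/∂θ_m` at `θ`. -/
def partialR {p k : ℕ} (R : (Fin k → ℝ) → Matrix (Fin p) (Fin p) ℝ) (θ : Fin k → ℝ)
    (m : Fin k) : Matrix (Fin p) (Fin p) ℝ :=
  Matrix.of fun i j => lineDeriv ℝ (fun t => R t i j) θ (Pi.single m 1)

/-- Standing assumptions on the parametrization `θ ↦ R(θ)` of a structured Gaussian copula model:
`Θ` is open in `ℝᵏ`, each `R(θ)` is a positive definite correlation matrix, `R` is one-to-one on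
`Θ`, the partial derivatives exist and are continuous on `Θ`, and at each `θ ∈ Θ` they are
linearly independent. -/
structure IsCopulaParametrization {p k : ℕ} (Θ : Set (Fin k → ℝ))
    (R : (Fin k → ℝ) → Matrix (Fin p) (Fin p) ℝ) : Prop where
  isOpen : IsOpen Θ
  posDef : ∀ θ ∈ Θ, (R θ).PosDef
  diag_eq_one : ∀ θ ∈ Θ, ∀ j, R θ j j = 1
  injOn : Set.InjOn R Θ
  lineDifferentiableAt : ∀ θ ∈ Θ, ∀ (m : Fin k) (i j : Fin p),
    LineDifferentiableAt ℝ (fun t => R t i j) θ (Pi.single m 1)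
  continuousOn_partialR : ∀ (m : Fin k) (i j : Fin p),
    ContinuousOn (fun θ => partialR R θ m i j) Θ
  linearIndependent : ∀ θ ∈ Θ, LinearIndependent ℝ (partialR R θ)

/-! ### The semiparametric model -/

/-- The quantile function of a probability distribution on the line (for `u ∈ (0, 1)`). -/
def quantile (ν : Measure ℝ) (u : ℝ) : ℝ := sInf {x | u ≤ cdf ν x}

/-- Gaussianized coordinates `z_j = Φ⁻¹(u_j)`. -/
def gaussianize {p : ℕ} (u : Fin p → ℝ) : Fin p → ℝ :=
  fun j => quantile (gaussianReal 0 1) (u j)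

/-- The Gaussian copula with correlation matrix `C`, as a law on `(0, 1)ᵖ ⊆ ℝᵖ`: the law of
`(Φ(Z_1), …, Φ(Z_p))` for `Z ∼ N_p(0, C)`. -/
def copulaLaw {p : ℕ} (C : Matrix (Fin p) (Fin p) ℝ) : Measure (Fin p → ℝ) :=
  (multivariateGaussian 0 C).map fun z j => cdf (gaussianReal 0 1) (z j)

/-- The law of a random vector with Gaussian copula with correlation matrix `C` and margins
`F_1, …, F_p`. -/
def modelLaw {p : ℕ} (C : Matrix (Fin p) (Fin p) ℝ) (F : Fin p → Measure ℝ) :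
    Measure (Fin p → ℝ) :=
  (copulaLaw C).map fun u j => quantile (F j) (u j)

/-- The joint law of `n` i.i.d. observations from the model. -/
def sampleLaw {p : ℕ} (n : ℕ) (C : Matrix (Fin p) (Fin p) ℝ) (F : Fin p → Measure ℝ) :
    Measure (Fin n → Fin p → ℝ) :=
  Measure.pi fun _ : Fin n => modelLaw C F

/-- The transformed observation `(F_1(x_1), …, F_p(x_p))`. -/
def toUniform {p : ℕ} (F : Fin p → Measure ℝ) (x : Fin p → ℝ) : Fin p → ℝ :=
  fun j => cdf (F j) (x j)

/-- `Y_n = o_P(1)`, where `Y_n` is defined on a sample space carrying the law `μ n`. -/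
def IsLittleOP {k : ℕ} {Ω : ℕ → Type} [∀ n, MeasurableSpace (Ω n)] (μ : ∀ n, Measure (Ω n))
    (Y : ∀ n, Ω n → Fin k → ℝ) : Prop :=
  ∀ ε : ℝ, 0 < ε → Tendsto (fun n => μ n {x | ε ≤ ‖Y n x‖}) atTop (𝓝 0)

/-! ### Scores and the nonparametric tangent space -/

/-- The log density `ℓ(u)` of the Gaussian copula with correlation matrix `C`. -/
def logDensity {p : ℕ} (C : Matrix (Fin p) (Fin p) ℝ) (u : Fin p → ℝ) : ℝ :=
  -(1 / 2) * Real.log C.det -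
    (1 / 2) * (gaussianize u ⬝ᵥ ((C⁻¹ - 1) *ᵥ gaussianize u))

/-- The parametric score `∂ℓ(u; θ)/∂θ_m`. -/
def score {p k : ℕ} (R : (Fin k → ℝ) → Matrix (Fin p) (Fin p) ℝ) (θ : Fin k → ℝ) (m : Fin k)
    (u : Fin p → ℝ) : ℝ :=
  lineDeriv ℝ (fun t => logDensity (R t) u) θ (Pi.single m 1)

/-- The partial derivative `∂ℓ(u)/∂u_j` of the log density in its argument. -/
def coordScore {p : ℕ} (C : Matrix (Fin p) (Fin p) ℝ) (j : Fin p) (u : Fin p → ℝ) : ℝ :=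
  lineDeriv ℝ (logDensity C) u (Pi.single j 1)

/-- (Representatives of) the elements of `L₂⁰[0, 1]`: square-integrable with integral zero. -/
def L2Zero : Set (ℝ → ℝ) :=
  {h | MemLp h 2 (volume.restrict (Set.Icc 0 1)) ∧ ∫ x in Set.Icc (0 : ℝ) 1, h x = 0}

/-- The score operator: `[O h](u) = ∑_j { h_j(u_j) + ∂ℓ(u)/∂u_j · ∫_0^{u_j} h_j }`. -/
def scoreOperator {p : ℕ} (C : Matrix (Fin p) (Fin p) ℝ) (h : Fin p → ℝ → ℝ)
    (u : Fin p → ℝ) : ℝ :=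
  ∑ j, (h j (u j) + coordScore C j u * ∫ t in (0 : ℝ)..(u j), h j t)

/-- The nonparametric part of the tangent space at uniform margins: the range of the score operator
on `(L₂⁰[0, 1])ᵖ`, as a set of (representatives of) elements of `L₂` of the copula law. -/
def tangentSpace {p : ℕ} (C : Matrix (Fin p) (Fin p) ℝ) : Set ((Fin p → ℝ) → ℝ) :=
  {f | MemLp f 2 (copulaLaw C) ∧
    ∃ h : Fin p → ℝ → ℝ, (∀ j, h j ∈ L2Zero) ∧ f =ᵐ[copulaLaw C] scoreOperator C h}

/-- `e` is (a version of) the efficient score for `θ_m` at `θ`: the parametric score minus its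
orthogonal projection in `L₂` on the nonparametric tangent space. -/
structure IsEfficientScore {p k : ℕ} (R : (Fin k → ℝ) → Matrix (Fin p) (Fin p) ℝ)
    (θ : Fin k → ℝ) (m : Fin k) (e : (Fin p → ℝ) → ℝ) : Prop where
  memLp : MemLp e 2 (copulaLaw (R θ))
  sub_mem : (fun u => score R θ m u - e u) ∈ tangentSpace (R θ)
  orthogonal : ∀ f ∈ tangentSpace (R θ), ∫ u, e u * f u ∂(copulaLaw (R θ)) = 0

/-- The `k × k` matrix `E[e e']`, the efficient information matrix if `e` is the efficient score. -/
def informationMatrix {p k : ℕ} (C : Matrix (Fin p) (Fin p) ℝ)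
    (e : Fin k → (Fin p → ℝ) → ℝ) : Matrix (Fin k) (Fin k) ℝ :=
  Matrix.of fun m m' => ∫ u, e m u * e m' u ∂(copulaLaw C)

/-! ### Estimators -/

/-- `ranks x i j` is the rank of `x i j` in the `j`-th marginal sample `x 1 j, …, x n j`. -/
def ranks {n p : ℕ} (x : Fin n → Fin p → ℝ) : Fin n → Fin p → ℕ :=
  fun i j => (Finset.univ.filter fun l => x l j ≤ x i j).card

/-- An estimator sequence is rank-based if it is a function of the vectors of ranks only. -/
def IsRankBased {p k : ℕ} (est : ∀ n, (Fin n → Fin p → ℝ) → Fin k → ℝ) : Prop :=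
  ∃ t : ∀ n, (Fin n → Fin p → ℕ) → Fin k → ℝ, ∀ n x, est n x = t n (ranks x)

/-- The perturbation of the margin `ν` in the direction `h`: if `ν` has density `f` and distribution
function `F`, it has density `d · g(η h(F(x))) · f(x)`, where `g(z) = 2 / (1 + e^{-2z})` and `d` is
the normalizing constant. -/
def localMargin (ν : Measure ℝ) (h : ℝ → ℝ) (η : ℝ) : Measure ℝ :=
  ν.withDensity fun x => ENNReal.ofReal
    (2 / (1 + Real.exp (-2 * (η * h (cdf ν x)))) /
      ∫ y, 2 / (1 + Real.exp (-2 * (η * h (cdf ν y)))) ∂ν)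

/-- Regularity at `(θ, F)`: along every local path `η ↦ (θ + η α, F_{1,η}, …, F_{p,η})`
with `η = 1/√n`, the law of `√n (θ̂_n - θ_n)`, with `θ_n = θ + α/√n`, converges weakly to a probability
law that does not depend on the path. -/
def IsRegularAt {p k : ℕ} (R : (Fin k → ℝ) → Matrix (Fin p) (Fin p) ℝ)
    (est : ∀ n, (Fin n → Fin p → ℝ) → Fin k → ℝ) (θ : Fin k → ℝ) (F : Fin p → Measure ℝ) : Prop :=
  ∃ L : ProbabilityMeasure (Fin k → ℝ), ∀ (α : Fin k → ℝ) (h : Fin p → ℝ → ℝ),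
    (∀ j, h j ∈ L2Zero) → ∀ f : BoundedContinuousFunction (Fin k → ℝ) ℝ,
      Tendsto (fun n : ℕ => ∫ x, f (√(n : ℝ) • (est n x - (θ + (√(n : ℝ))⁻¹ • α)))
          ∂(sampleLaw n (R (θ + (√(n : ℝ))⁻¹ • α)) fun j => localMargin (F j) (h j) (√(n : ℝ))⁻¹))
        atTop (𝓝 (∫ y, f y ∂(L : Measure (Fin k → ℝ))))

/-- Asymptotic linearity at `(θ, F)` with influence function `x ↦ ψ(F_1(x_1), …, F_p(x_p))`:
`√n (θ̂_n - θ) = n^{-1/2} ∑_i ψ(F_1(X_{i1}), …, F_p(X_{ip})) + o_P(1)`. -/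
def IsAsymptoticallyLinearAt {p k : ℕ} (R : (Fin k → ℝ) → Matrix (Fin p) (Fin p) ℝ)
    (est : ∀ n, (Fin n → Fin p → ℝ) → Fin k → ℝ) (θ : Fin k → ℝ) (F : Fin p → Measure ℝ)
    (ψ : (Fin p → ℝ) → Fin k → ℝ) : Prop :=
  IsLittleOP (fun n => sampleLaw n (R θ) F) fun n x =>
    √(n : ℝ) • (est n x - θ) - (√(n : ℝ))⁻¹ • ∑ i, ψ (toUniform F (x i))

/-- Efficiency at `(θ, F)`: the estimator is asymptotically linear in the efficient influence
function, the inverse efficient information matrix times the efficient score vector. (The efficient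
score is unique up to null sets.) -/
def IsEfficientAt {p k : ℕ} (R : (Fin k → ℝ) → Matrix (Fin p) (Fin p) ℝ)
    (est : ∀ n, (Fin n → Fin p → ℝ) → Fin k → ℝ) (θ : Fin k → ℝ) (F : Fin p → Measure ℝ) : Prop :=
  ∃ e : Fin k → (Fin p → ℝ) → ℝ, (∀ m, IsEfficientScore R θ m (e m)) ∧
    IsAsymptoticallyLinearAt R est θ F fun u =>
      (informationMatrix (R θ) e)⁻¹ *ᵥ fun m => e m u

/-- The quadratic function `q_A(u) = (z'Az - E[z'Az]) / 2`, `z_j = Φ⁻¹(u_j)`, generated by `A`. -/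
def quadInfluence {p : ℕ} (C A : Matrix (Fin p) (Fin p) ℝ) (u : Fin p → ℝ) : ℝ :=
  (1 / 2) * (gaussianize u ⬝ᵥ (A *ᵥ gaussianize u) -
    ∫ v, gaussianize v ⬝ᵥ (A *ᵥ gaussianize v) ∂(copulaLaw C))

/-- The diagonal matrix with the same diagonal as `A`. -/
def diagPart {p : ℕ} (A : Matrix (Fin p) (Fin p) ℝ) : Matrix (Fin p) (Fin p) ℝ :=
  Matrix.diagonal A.diag

end GaussianCopula

end

set_option linter.unusedSectionVars false

noncomputable section

namespace GaussianCopula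

/-! ### Gaussian vectors -/

/-! Ranks do not see the margins, so the problem moves to Gaussian scores `z ∼ N(0, C)` with `C =
R(θ)`. There the given influence functions are centered quadratic forms `q_A`, with `L₂` inner
product `½ tr(A C B C)` (`integral_centeredQuad_mul`), and the proof becomes linear algebra on
symmetric matrices.

The efficient scores are quadratic too. The score for `θ_m` is the form of `C⁻¹ Ṙ_m C⁻¹`
(`score_eq_centeredQuad`). Rescaling the margins yields the tangent vectors with matrices `D C⁻¹ +
C⁻¹ D`, `D` diagonal (`centeredQuad_scaleMatrix`). A form is orthogonal to these exactly when
`diag(A C) = 0`, and it is then orthogonal to the whole nonparametric tangent space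
(`integral_centeredQuad_mul_marginScore`). So subtracting a suitable scale matrix from `C⁻¹ Ṙ_m C⁻¹`
produces `E_m` with `diag(E_m C) = 0`, and `q_{E_m}` is the efficient score.

The linear map `T(X) = CXC - ½ (diag(CXC) C + C diag(CXC))`, `correlationTangent`, undoes this:
`T(E_m) = Ṙ_m`. It is injective on `{X | diag(X C) = 0}`, because its kernel consists of scale
matrices. On that space, membership of `A_m` in `span E` is therefore membership of `T(A_m)` in
`span Ṙ`.

Two identities tie the estimator to this picture: `diag(A_m C) = 0`, because rescaling preserves
ranks, and `½ tr(A_m Ṙ_{m'}) = δ_{mm'}`, from regularity. Both say that a statistic with expansion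
in `q_A` shifts by `½ tr(A Δ)` when `C` moves by `Δ/√n`. In place of a likelihood expansion, this
rests on an explicit coupling of the two Gaussian samples (`exists_coupling`), a chi-square bound
giving contiguity (`gaussSample_apply_le`), and the fact that no probability law is invariant under
a nonzero translation (`shift_eq_zero`).

If the estimator is efficient, uniqueness of the matrix in a linear expansion puts `A_m` in `span
E`. Conversely, if `A = X E`, the second identity reads `X I* = 1`, so `X` is the inverse
information and the estimator is efficient. The same identity makes the `A_m` linearly independent,
so `span A = span B` and the criterion can be tested on `B`. -/

/-- The centered Gaussian law with covariance matrix `C`, on the space of plain vectors. -/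
def gaussVec {ι : Type*} [Fintype ι] [DecidableEq ι] (C : Matrix ι ι ℝ) : Measure (ι → ℝ) :=
  (multivariateGaussian 0 C).map fun z j => z j

/-- The law of a vector of independent standard normal variables. -/
abbrev stdVec (ι : Type*) [Fintype ι] : Measure (ι → ℝ) :=
  Measure.pi fun _ : ι => gaussianReal 0 1

instance {ι : Type*} [Fintype ι] [DecidableEq ι] (C : Matrix ι ι ℝ) :
    IsProbabilityMeasure (gaussVec C) :=
  Measure.isProbabilityMeasure_map (Measurable.aemeasurable (by fun_prop))

lemma measurable_mulVec_left {ι κ : Type*} [Fintype ι] [Fintype κ] (G : Matrix ι κ ℝ) :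
    Measurable fun x : κ → ℝ => G *ᵥ x := by
  have : Continuous fun x : κ → ℝ => G *ᵥ x := by fun_prop
  exact this.measurable

/-- A Gaussian vector with covariance `G Gᵀ` is the image under `G` of a standard one. -/
lemma gaussVec_mul_transpose {ι κ : Type*} [Fintype ι] [DecidableEq ι] [Fintype κ]
    (G : Matrix ι κ ℝ) : gaussVec (G * Gᵀ) = (stdVec κ).map fun x => G *ᵥ x := by
  classical
  have hm := measurable_mulVec_left G
  have hpsd : (G * Gᵀ).PosSemidef := by
    simpa [conjTranspose_eq_transpose_of_trivial] using posSemidef_self_mul_conjTranspose G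
  -- Compare characteristic functions: `⟨Gx, t⟩ = ⟨x, Gᵀt⟩` and `‖Gᵀt‖² = t'GGᵀt`. Rectangular `G`
  -- is allowed because a factor with one extra column is needed for conditioning on a coordinate.
  have key : multivariateGaussian 0 (G * Gᵀ) =
      (stdVec κ).map fun x => WithLp.toLp 2 (G *ᵥ x) := by
    have hm' : Measurable fun x : κ → ℝ => WithLp.toLp 2 (G *ᵥ x) :=
      (WithLp.measurable_toLp 2 _).comp hm
    have : IsProbabilityMeasure ((stdVec κ).map fun x => WithLp.toLp 2 (G *ᵥ x)) :=
      Measure.isProbabilityMeasure_map hm'.aemeasurable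
    apply Measure.ext_of_charFun
    ext t
    rw [charFun_multivariateGaussian hpsd, charFun_apply, integral_map hm'.aemeasurable
      (by fun_prop)]
    have h2 := charFun_stdGaussian (E := EuclideanSpace ℝ κ) (WithLp.toLp 2 (Gᵀ *ᵥ t.ofLp))
    rw [← map_pi_eq_stdGaussian, charFun_apply, integral_map
      (WithLp.measurable_toLp 2 _).aemeasurable (by fun_prop)] at h2
    have e1 : ∀ x : κ → ℝ, inner ℝ (WithLp.toLp 2 (G *ᵥ x)) t =
        inner ℝ (WithLp.toLp 2 x) (WithLp.toLp 2 (Gᵀ *ᵥ t.ofLp)) := by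
      intro x
      rw [EuclideanSpace.inner_eq_star_dotProduct, EuclideanSpace.inner_eq_star_dotProduct]
      simp only [star_trivial]
      rw [dotProduct_mulVec, mulVec_transpose]
    simp_rw [e1]
    rw [h2]
    congr 1
    have e2 : ‖WithLp.toLp 2 (Gᵀ *ᵥ t.ofLp)‖ ^ 2 = t.ofLp ⬝ᵥ (G * Gᵀ) *ᵥ t.ofLp := by
      rw [← real_inner_self_eq_norm_sq, EuclideanSpace.inner_eq_star_dotProduct]
      simp only [star_trivial]
      rw [← mulVec_mulVec, dotProduct_mulVec t.ofLp, mulVec_transpose]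
    rw [← Complex.ofReal_pow, e2]
    simp
    ring
  have hm' : Measurable fun x : κ → ℝ => WithLp.toLp 2 (G *ᵥ x) :=
    (WithLp.measurable_toLp 2 _).comp hm
  rw [gaussVec, key, Measure.map_map (by fun_prop) hm']
  rfl

/-! ### Moments of the standard normal law -/

lemma memLp_pow_gaussianReal (n : ℕ) (p : ENNReal) (hp : p ≠ ⊤) :
    MemLp (fun x : ℝ => x ^ n) p (gaussianReal 0 1) := by
  have h := memLp_id_gaussianReal' (μ := 0) (v := 1) (n * p)
    (ENNReal.mul_ne_top (by simp) hp)
  rcases Nat.eq_zero_or_pos n with rfl | hn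
  · simpa using memLp_const (1 : ℝ)
  have := h.norm_rpow_div (n : ENNReal)
  have hn' : (n : ENNReal) ≠ 0 := by exact_mod_cast hn.ne'
  rw [mul_comm, ENNReal.mul_div_cancel_right hn' (by simp)] at this
  refine this.of_le (by fun_prop) (ae_of_all _ fun x => ?_)
  simp

lemma integrable_pow_gaussianReal (n : ℕ) :
    Integrable (fun x : ℝ => x ^ n) (gaussianReal 0 1) :=
  memLp_one_iff_integrable.1 (memLp_pow_gaussianReal n 1 (by simp))

/-- The standard normal density. -/
abbrev stdPdf : ℝ → ℝ := gaussianPDFReal 0 1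

lemma stdPdf_pos (x : ℝ) : 0 < stdPdf x := gaussianPDFReal_pos 0 1 x one_ne_zero

lemma stdPdf_eq (x : ℝ) : stdPdf x = (√(2 * Real.pi))⁻¹ * Real.exp (-x ^ 2 / 2) := by
  simp [stdPdf, gaussianPDFReal]

lemma hasDerivAt_stdPdf (x : ℝ) : HasDerivAt stdPdf (-x * stdPdf x) x := by
  have h1 : HasDerivAt (fun x : ℝ => -x ^ 2 / 2) (-x) x := by
    have := ((hasDerivAt_pow 2 x).neg).div_const 2
    refine this.congr_deriv ?_
    simp; ring
  have h2 := (h1.exp.const_mul ((√(2 * Real.pi))⁻¹))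
  have h3 : stdPdf = fun x => (√(2 * Real.pi))⁻¹ * Real.exp (-x ^ 2 / 2) := funext stdPdf_eq
  rw [h3]
  refine h2.congr_deriv ?_
  ring

lemma continuous_stdPdf : Continuous stdPdf :=
  continuous_iff_continuousAt.2 fun x => (hasDerivAt_stdPdf x).continuousAt

lemma integral_gaussianReal_eq_integral_mul_stdPdf (f : ℝ → ℝ) :
    ∫ x, f x ∂(gaussianReal 0 1) = ∫ x, f x * stdPdf x := by
  rw [integral_gaussianReal_eq_integral_smul one_ne_zero]
  simp [mul_comm]

lemma integrable_gaussianReal_iff (f : ℝ → ℝ) :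
    Integrable f (gaussianReal 0 1) ↔ Integrable fun x => f x * stdPdf x := by
  rw [gaussianReal_of_var_ne_zero 0 one_ne_zero, integrable_withDensity_iff_integrable_smul'
    (measurable_gaussianPDF 0 1) (ae_of_all _ fun x => gaussianPDF_lt_top)]
  simp [mul_comm]

/-- Integration by parts against `φ' = -xφ`. -/
lemma integral_pow_succ_succ_gaussianReal (n : ℕ) :
    ∫ x, x ^ (n + 2) ∂(gaussianReal 0 1) = (n + 1) * ∫ x, x ^ n ∂(gaussianReal 0 1) := by
  have hint : ∀ n : ℕ, Integrable fun x : ℝ => x ^ n * stdPdf x := fun n =>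
    (integrable_gaussianReal_iff _).1 (integrable_pow_gaussianReal n)
  have h := integral_mul_deriv_eq_deriv_mul_of_integrable (u := fun x : ℝ => x ^ (n + 1))
    (u' := fun x : ℝ => (n + 1 : ℕ) * x ^ n) (v := stdPdf) (v' := fun x => -x * stdPdf x)
    (fun x _ => by simpa using hasDerivAt_pow (n + 1) x) (fun x _ => hasDerivAt_stdPdf x)
    ((hint (n + 2)).neg.congr (ae_of_all _ fun x => by simp; ring))
    (((hint n).const_mul ((n + 1 : ℕ) : ℝ)).congr (ae_of_all _ fun x => by simp; ring))
    (hint (n + 1))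
  rw [integral_gaussianReal_eq_integral_mul_stdPdf, integral_gaussianReal_eq_integral_mul_stdPdf,
    ← integral_const_mul]
  have e1 : ∀ x : ℝ, x ^ (n + 1) * (-x * stdPdf x) = -(x ^ (n + 2) * stdPdf x) := fun x => by ring
  simp_rw [e1, integral_neg, neg_inj] at h
  rw [h]
  congr 1; ext x; push_cast; ring

lemma integral_sq_gaussianReal : ∫ x, x ^ 2 ∂(gaussianReal 0 1) = 1 := by
  have := integral_pow_succ_succ_gaussianReal 0
  simpa using this

lemma integral_pow_four_gaussianReal : ∫ x, x ^ 4 ∂(gaussianReal 0 1) = 3 := by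
  have := integral_pow_succ_succ_gaussianReal 2
  rw [integral_sq_gaussianReal] at this
  norm_num at this ⊢
  exact this

lemma variance_sq_gaussianReal : Var[fun x => x ^ 2; gaussianReal 0 1] = 2 := by
  rw [variance_eq_sub (memLp_pow_gaussianReal 2 2 (by simp))]
  have : ∫ x, ((fun x : ℝ => x ^ 2) ^ 2) x ∂(gaussianReal 0 1) = 3 := by
    rw [← integral_pow_four_gaussianReal]
    congr 1; ext x; simp; ring
  rw [this, integral_sq_gaussianReal]
  norm_num

/-! ### Matrix factorizations -/

lemma exists_orthogonal_diagonalization {ι : Type*} [Fintype ι] [DecidableEq ι]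
    {A : Matrix ι ι ℝ} (hA : A.IsSymm) :
    ∃ (U : Matrix ι ι ℝ) (lam : ι → ℝ), Uᵀ * U = 1 ∧ U * Uᵀ = 1 ∧
      A = U * diagonal lam * Uᵀ := by
  have hH : A.IsHermitian := by
    rw [IsHermitian, conjTranspose_eq_transpose_of_trivial]; exact hA
  have hs := hH.spectral_theorem
  rw [Unitary.conjStarAlgAut_apply] at hs
  refine ⟨hH.eigenvectorUnitary, hH.eigenvalues, ?_, ?_, ?_⟩
  · have := mem_unitaryGroup_iff'.1 hH.eigenvectorUnitary.2
    simpa [star_eq_conjTranspose, conjTranspose_eq_transpose_of_trivial] using this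
  · have := mem_unitaryGroup_iff.1 hH.eigenvectorUnitary.2
    simpa [star_eq_conjTranspose, conjTranspose_eq_transpose_of_trivial] using this
  · conv_lhs => rw [hs]
    simp [star_eq_conjTranspose, conjTranspose_eq_transpose_of_trivial]

lemma PosSemidef.isSymm {ι : Type*} {C : Matrix ι ι ℝ} (hC : C.PosSemidef) : C.IsSymm := by
  have := hC.1
  rwa [IsHermitian, conjTranspose_eq_transpose_of_trivial] at this

lemma exists_orthogonal_diagonalization_nonneg {ι : Type*} [Fintype ι] [DecidableEq ι]
    {A : Matrix ι ι ℝ} (hA : A.PosSemidef) :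
    ∃ (U : Matrix ι ι ℝ) (lam : ι → ℝ), Uᵀ * U = 1 ∧ U * Uᵀ = 1 ∧
      A = U * diagonal lam * Uᵀ ∧ ∀ i, 0 ≤ lam i := by
  obtain ⟨U, lam, h1, h2, h3⟩ := exists_orthogonal_diagonalization (PosSemidef.isSymm hA)
  refine ⟨U, lam, h1, h2, h3, fun i => ?_⟩
  have h4 : diagonal lam = Uᵀ * A * U := by
    rw [h3]
    calc diagonal lam = (Uᵀ * U) * diagonal lam * (Uᵀ * U) := by rw [h1]; simp
      _ = _ := by simp only [Matrix.mul_assoc]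
  have h5 := hA.conjTranspose_mul_mul_same U
  rw [conjTranspose_eq_transpose_of_trivial, ← h4] at h5
  exact (posSemidef_diagonal_iff.1 h5) i

lemma exists_eq_mul_transpose {ι : Type*} [Fintype ι] [DecidableEq ι] {C : Matrix ι ι ℝ}
    (hC : C.PosSemidef) : ∃ G : Matrix ι ι ℝ, C = G * Gᵀ := by
  obtain ⟨U, lam, h1, h2, h3, h4⟩ := exists_orthogonal_diagonalization_nonneg hC
  refine ⟨U * diagonal fun i => √(lam i), ?_⟩
  rw [transpose_mul, diagonal_transpose, Matrix.mul_assoc U, ← Matrix.mul_assoc (diagonal _),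
    diagonal_mul_diagonal]
  simp only [Real.mul_self_sqrt (h4 _)]
  rw [h3, Matrix.mul_assoc]

/-- A positive definite and a positive semidefinite matrix are simultaneously diagonalizable by a
congruence; the squared distance of the eigenvalues from `1` is expressed through the matrices. -/
lemma exists_simultaneous_diagonalization {ι : Type*} [Fintype ι] [DecidableEq ι]
    {C C' : Matrix ι ι ℝ} (hC : C.PosDef) (hC' : C'.PosSemidef) :
    ∃ (G : Matrix ι ι ℝ) (lam : ι → ℝ), C = G * Gᵀ ∧ C' = G * diagonal lam * Gᵀ ∧
      (∀ i, 0 ≤ lam i) ∧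
      ∑ i, (lam i - 1) ^ 2 = (C⁻¹ * (C' - C) * (C⁻¹ * (C' - C))).trace := by
  obtain ⟨G₀, hG₀⟩ := exists_eq_mul_transpose hC.posSemidef
  have hdet : IsUnit G₀.det := by
    have h := hC.det_pos
    rw [hG₀, det_mul, det_transpose] at h
    exact isUnit_iff_ne_zero.2 fun h0 => by simp [h0] at h
  have hdetT : IsUnit G₀ᵀ.det := by rwa [det_transpose]
  -- Whiten by `G₀`, which turns `C` into the identity, then rotate by the eigenvectors `U` of the
  -- whitened `C'`. The common factor is `G₀ U`.
  have hK : (G₀⁻¹ * C' * G₀⁻¹ᵀ).PosSemidef := by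
    have := hC'.mul_mul_conjTranspose_same G₀⁻¹
    rwa [conjTranspose_eq_transpose_of_trivial] at this
  obtain ⟨U, lam, h1, h2, h3, h4⟩ := exists_orthogonal_diagonalization_nonneg hK
  have hCG : C = G₀ * U * (G₀ * U)ᵀ := by
    rw [transpose_mul, Matrix.mul_assoc G₀, ← Matrix.mul_assoc U, h2, Matrix.one_mul, hG₀]
  have hCG' : C' = G₀ * U * diagonal lam * (G₀ * U)ᵀ := by
    calc C' = (G₀ * G₀⁻¹) * C' * (G₀⁻¹ᵀ * G₀ᵀ) := by
          rw [mul_nonsing_inv _ hdet, transpose_nonsing_inv, nonsing_inv_mul _ hdetT]; simp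
      _ = G₀ * (G₀⁻¹ * C' * G₀⁻¹ᵀ) * G₀ᵀ := by simp only [Matrix.mul_assoc]
      _ = _ := by rw [h3, transpose_mul]; simp only [Matrix.mul_assoc]
  refine ⟨G₀ * U, lam, hCG, hCG', h4, ?_⟩
  set G := G₀ * U with hG
  have hGu : IsUnit G.det := by
    rw [hG, det_mul]
    refine hdet.mul ?_
    have := congrArg det h1
    rw [det_mul, det_one] at this
    exact IsUnit.of_mul_eq_one_right _ this
  have hGuT : IsUnit Gᵀ.det := by rwa [det_transpose]
  -- `C⁻¹(C' - C)` is similar to `diag(lam - 1)`, so the trace of its square is the sum of squares.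
  have hE : C⁻¹ * (C' - C) = Gᵀ⁻¹ * diagonal (fun i => lam i - 1) * Gᵀ := by
    have : C' - C = G * diagonal (fun i => lam i - 1) * Gᵀ := by
      rw [hCG', hCG, ← Matrix.sub_mul]
      congr 1
      rw [show (diagonal fun i => lam i - 1) = diagonal lam - 1 by
        rw [← diagonal_one, diagonal_sub], Matrix.mul_sub, Matrix.mul_one]
    rw [this, hCG, Matrix.mul_inv_rev]
    calc Gᵀ⁻¹ * G⁻¹ * (G * diagonal (fun i => lam i - 1) * Gᵀ)
        = Gᵀ⁻¹ * (G⁻¹ * G) * diagonal (fun i => lam i - 1) * Gᵀ := by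
          simp only [Matrix.mul_assoc]
      _ = _ := by rw [nonsing_inv_mul _ hGu, Matrix.mul_one]
  rw [hE]
  have : Gᵀ⁻¹ * diagonal (fun i => lam i - 1) * Gᵀ * (Gᵀ⁻¹ * diagonal (fun i => lam i - 1) * Gᵀ)
      = Gᵀ⁻¹ * (diagonal (fun i => lam i - 1) * (Gᵀ * Gᵀ⁻¹) * diagonal (fun i => lam i - 1) * Gᵀ) := by
    simp only [Matrix.mul_assoc]
  rw [this, mul_nonsing_inv _ hGuT, Matrix.mul_one, diagonal_mul_diagonal, trace_mul_comm,
    Matrix.mul_assoc, mul_nonsing_inv _ hGuT, Matrix.mul_one, trace_diagonal]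
  simp only [sq]

/-! ### Quadratic forms in Gaussian vectors -/

lemma dotProduct_mulVec_mulVec {ι κ : Type*} [Fintype ι] [Fintype κ] (A : Matrix ι ι ℝ)
    (G : Matrix ι κ ℝ) (x : κ → ℝ) :
    (G *ᵥ x) ⬝ᵥ (A *ᵥ (G *ᵥ x)) = x ⬝ᵥ ((Gᵀ * A * G) *ᵥ x) := by
  rw [← mulVec_mulVec, ← mulVec_mulVec, dotProduct_mulVec x, vecMul_transpose]

lemma continuous_quadraticForm {ι : Type*} [Fintype ι] (A : Matrix ι ι ℝ) :
    Continuous fun z : ι → ℝ => z ⬝ᵥ (A *ᵥ z) := by fun_prop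

lemma map_mulVec_stdVec_of_orthogonal {κ : Type*} [Fintype κ] [DecidableEq κ] {U : Matrix κ κ ℝ}
    (hU : U * Uᵀ = 1) : (stdVec κ).map (fun x => U *ᵥ x) = stdVec κ := by
  rw [← gaussVec_mul_transpose, hU]
  have := gaussVec_mul_transpose (1 : Matrix κ κ ℝ)
  simpa using this

/-- The standard normal law is rotation invariant, so the form may be taken diagonal. It is then a
sum of independent `lam i * x i ^ 2`, each with mean `lam i` and variance `2 * lam i ^ 2`. -/
lemma quadraticForm_stdVec {κ : Type*} [Fintype κ] [DecidableEq κ] {H : Matrix κ κ ℝ}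
    (hH : H.IsSymm) :
    MemLp (fun x => x ⬝ᵥ (H *ᵥ x)) 2 (stdVec κ) ∧
    ∫ x, x ⬝ᵥ (H *ᵥ x) ∂(stdVec κ) = H.trace ∧
    Var[fun x => x ⬝ᵥ (H *ᵥ x); stdVec κ] = 2 * (H * H).trace := by
  obtain ⟨U, lam, h1, h2, h3⟩ := exists_orthogonal_diagonalization hH
  have hm : Measurable fun x : κ → ℝ => Uᵀ *ᵥ x := measurable_mulVec_left _
  have hmap := map_mulVec_stdVec_of_orthogonal (U := Uᵀ) (by rwa [transpose_transpose])
  have hmp : MeasurePreserving (fun x : κ → ℝ => Uᵀ *ᵥ x) (stdVec κ) (stdVec κ) := ⟨hm, hmap⟩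
  have hD : ∀ x : κ → ℝ, x ⬝ᵥ (diagonal lam *ᵥ x) = ∑ i, lam i * x i ^ 2 := fun x => by
    simp only [dotProduct, mulVec_diagonal]
    exact Finset.sum_congr rfl fun i _ => by ring
  have hfun : (fun x : κ → ℝ => x ⬝ᵥ (H *ᵥ x)) =
      (fun x => ∑ i, lam i * x i ^ 2) ∘ fun x => Uᵀ *ᵥ x := by
    ext x
    simp only [Function.comp, ← hD]
    rw [dotProduct_mulVec_mulVec, transpose_transpose, ← h3]
  have hL : ∀ i, MemLp (fun x : ℝ => lam i * x ^ 2) 2 (gaussianReal 0 1) := fun i =>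
    (memLp_pow_gaussianReal 2 2 (by simp)).const_mul _
  have hL' : ∀ i, MemLp (fun x : κ → ℝ => lam i * x i ^ 2) 2 (stdVec κ) := fun i =>
    (hL i).comp_measurePreserving (measurePreserving_eval _ i)
  have hS : MemLp (fun x : κ → ℝ => ∑ i, lam i * x i ^ 2) 2 (stdVec κ) :=
    memLp_finsetSum _ fun i _ => hL' i
  have htr : H.trace = ∑ i, lam i := by
    rw [h3, trace_mul_comm, ← Matrix.mul_assoc, h1, Matrix.one_mul, trace_diagonal]
  have htr2 : (H * H).trace = ∑ i, lam i ^ 2 := by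
    have : H * H = U * diagonal (fun i => lam i ^ 2) * Uᵀ := by
      rw [h3]
      calc U * diagonal lam * Uᵀ * (U * diagonal lam * Uᵀ)
          = U * (diagonal lam * (Uᵀ * U) * diagonal lam) * Uᵀ := by simp only [Matrix.mul_assoc]
        _ = _ := by rw [h1, Matrix.mul_one, diagonal_mul_diagonal]; simp only [sq]
    rw [this, trace_mul_comm, ← Matrix.mul_assoc, h1, Matrix.one_mul, trace_diagonal]
  rw [hfun]
  refine ⟨hS.comp_measurePreserving hmp, ?_, ?_⟩
  · rw [htr]
    have := integral_map (μ := stdVec κ) hm.aemeasurable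
      (f := fun x => ∑ i, lam i * x i ^ 2) (by rw [hmap]; exact hS.1)
    rw [hmap] at this
    simp only [Function.comp_def]
    rw [← this, integral_finsetSum _ fun i _ => (hL' i).integrable (by simp)]
    refine Finset.sum_congr rfl fun i _ => ?_
    rw [integral_const_mul, integral_comp_eval (μ := fun _ : κ => gaussianReal 0 1)
      (f := fun x : ℝ => x ^ 2) (by fun_prop), integral_sq_gaussianReal, mul_one]
  · have := variance_map (μ := stdVec κ) (X := fun x => ∑ i, lam i * x i ^ 2)
      (Y := fun x => Uᵀ *ᵥ x) (by rw [hmap]; exact hS.1.aemeasurable) hm.aemeasurable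
    rw [hmap] at this
    rw [← this]
    have h := variance_sum_pi (μ := fun _ : κ => gaussianReal 0 1) hL
    have e : (∑ i, fun ω : κ → ℝ => lam i * ω i ^ 2) = fun x => ∑ i, lam i * x i ^ 2 := by
      ext x; simp
    rw [e] at h
    rw [h, htr2, Finset.mul_sum]
    refine Finset.sum_congr rfl fun i _ => ?_
    rw [variance_const_mul, variance_sq_gaussianReal]
    ring

section

variable {ι : Type*} [Fintype ι] [DecidableEq ι] {C : Matrix ι ι ℝ}

lemma measurePreserving_mulVec_gaussVec {κ : Type*} [Fintype κ] {G : Matrix ι κ ℝ}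
    (hG : C = G * Gᵀ) : MeasurePreserving (fun x => G *ᵥ x) (stdVec κ) (gaussVec C) :=
  ⟨measurable_mulVec_left G, by rw [hG, gaussVec_mul_transpose]⟩

lemma trace_transpose_mul_mul {κ : Type*} [Fintype κ] (A : Matrix ι ι ℝ) (G : Matrix ι κ ℝ) :
    (Gᵀ * A * G).trace = (A * (G * Gᵀ)).trace := by
  rw [Matrix.mul_assoc, trace_mul_comm, Matrix.mul_assoc]

lemma trace_transpose_mul_mul_sq {κ : Type*} [Fintype κ] (A B : Matrix ι ι ℝ) (G : Matrix ι κ ℝ) :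
    (Gᵀ * A * G * (Gᵀ * B * G)).trace = (A * (G * Gᵀ) * (B * (G * Gᵀ))).trace := by
  have : Gᵀ * A * G * (Gᵀ * B * G) = Gᵀ * (A * (G * Gᵀ) * B) * G := by
    simp only [Matrix.mul_assoc]
  rw [this, trace_transpose_mul_mul]
  simp only [Matrix.mul_assoc]

lemma isSymm_transpose_mul_mul {κ : Type*} {A : Matrix ι ι ℝ} (hA : A.IsSymm)
    (G : Matrix ι κ ℝ) : (Gᵀ * A * G).IsSymm := by
  rw [IsSymm, transpose_mul, transpose_mul, transpose_transpose, hA, Matrix.mul_assoc]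

lemma quadraticForm_gaussVec (hC : C.PosSemidef) {A : Matrix ι ι ℝ} (hA : A.IsSymm) :
    MemLp (fun z => z ⬝ᵥ (A *ᵥ z)) 2 (gaussVec C) ∧
    ∫ z, z ⬝ᵥ (A *ᵥ z) ∂(gaussVec C) = (A * C).trace ∧
    Var[fun z => z ⬝ᵥ (A *ᵥ z); gaussVec C] = 2 * (A * C * (A * C)).trace := by
  obtain ⟨G, hG⟩ := exists_eq_mul_transpose hC
  have hmp := measurePreserving_mulVec_gaussVec hG
  obtain ⟨h1, h2, h3⟩ := quadraticForm_stdVec (isSymm_transpose_mul_mul hA G)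
  have hmeas := (continuous_quadraticForm A).aestronglyMeasurable (μ := gaussVec C)
  have hc : (fun z : ι → ℝ => z ⬝ᵥ (A *ᵥ z)) ∘ (fun x => G *ᵥ x) =
      fun x => x ⬝ᵥ ((Gᵀ * A * G) *ᵥ x) := funext fun x => dotProduct_mulVec_mulVec A G x
  refine ⟨?_, ?_, ?_⟩
  · rw [← hmp.map_eq, memLp_map_measure_iff (by rwa [hmp.map_eq]) hmp.measurable.aemeasurable, hc]
    exact h1
  · rw [← hmp.map_eq, integral_map hmp.measurable.aemeasurable (by rwa [hmp.map_eq])]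
    simp_rw [dotProduct_mulVec_mulVec]
    rw [h2, trace_transpose_mul_mul, hG]
  · rw [← hmp.map_eq, variance_map (by rw [hmp.map_eq]; exact hmeas.aemeasurable)
      hmp.measurable.aemeasurable, hc, h3, trace_transpose_mul_mul_sq, hG]

/-- The centered quadratic form `(z'Az - tr(AC)) / 2`. -/
def centeredQuad (C A : Matrix ι ι ℝ) (z : ι → ℝ) : ℝ :=
  1 / 2 * (z ⬝ᵥ (A *ᵥ z) - (A * C).trace)

lemma continuous_centeredQuad (C A : Matrix ι ι ℝ) : Continuous (centeredQuad C A) := by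
  unfold centeredQuad
  have := continuous_quadraticForm A
  fun_prop

lemma memLp_centeredQuad (hC : C.PosSemidef) {A : Matrix ι ι ℝ} (hA : A.IsSymm) :
    MemLp (centeredQuad C A) 2 (gaussVec C) :=
  ((quadraticForm_gaussVec hC hA).1.sub (memLp_const _)).const_mul _

lemma integral_centeredQuad_sq (hC : C.PosSemidef) {A : Matrix ι ι ℝ} (hA : A.IsSymm) :
    ∫ z, centeredQuad C A z ^ 2 ∂(gaussVec C) = 1 / 2 * (A * C * (A * C)).trace := by
  obtain ⟨h1, h2, h3⟩ := quadraticForm_gaussVec hC hA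
  rw [variance_eq_integral h1.1.aemeasurable, h2] at h3
  simp_rw [centeredQuad, mul_pow]
  rw [integral_const_mul, h3]
  ring

lemma centeredQuad_add (A B : Matrix ι ι ℝ) (z : ι → ℝ) :
    centeredQuad C (A + B) z = centeredQuad C A z + centeredQuad C B z := by
  simp only [centeredQuad, add_mulVec, dotProduct_add, Matrix.add_mul, trace_add]
  ring

lemma centeredQuad_smul (a : ℝ) (A : Matrix ι ι ℝ) (z : ι → ℝ) :
    centeredQuad C (a • A) z = a * centeredQuad C A z := by
  simp only [centeredQuad, smul_mulVec, dotProduct_smul, Matrix.smul_mul, trace_smul, smul_eq_mul]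
  ring

/-- Polarization of `integral_centeredQuad_sq`. This is the inner product that reduces projections
of scores to trace computations. -/
lemma integral_centeredQuad_mul (hC : C.PosSemidef) {A B : Matrix ι ι ℝ} (hA : A.IsSymm)
    (hB : B.IsSymm) :
    ∫ z, centeredQuad C A z * centeredQuad C B z ∂(gaussVec C) =
      1 / 2 * (A * C * (B * C)).trace := by
  have hLA := memLp_centeredQuad hC hA
  have hLB := memLp_centeredQuad hC hB
  have h1 := integral_centeredQuad_sq hC (hA.add hB)
  have h2 := integral_centeredQuad_sq hC hA
  have h3 := integral_centeredQuad_sq hC hB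
  have hAB : Integrable (fun z => centeredQuad C A z * centeredQuad C B z) (gaussVec C) :=
    hLA.integrable_mul hLB
  have e : ∀ z, centeredQuad C (A + B) z ^ 2 = centeredQuad C A z ^ 2 + centeredQuad C B z ^ 2 +
      2 * (centeredQuad C A z * centeredQuad C B z) := fun z => by
    rw [centeredQuad_add]; ring
  simp_rw [e] at h1
  have hsq : Integrable (fun z => centeredQuad C A z ^ 2 + centeredQuad C B z ^ 2) (gaussVec C) :=
    hLA.integrable_sq.add hLB.integrable_sq
  rw [integral_add hsq (hAB.const_mul 2),
    integral_add hLA.integrable_sq hLB.integrable_sq, integral_const_mul, h2, h3] at h1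
  have ht : ((A + B) * C * ((A + B) * C)).trace = (A * C * (A * C)).trace +
      (B * C * (B * C)).trace + 2 * (A * C * (B * C)).trace := by
    simp only [Matrix.add_mul, Matrix.mul_add, trace_add]
    rw [trace_mul_comm (B * C) (A * C)]
    ring
  rw [ht] at h1
  linarith

end

/-! ### Measures with bounded chi-square divergence -/

/-- `ν` has a density with respect to `μ` whose second moment is at most `c`. -/
def HasSqDensity {Ω : Type*} [MeasurableSpace Ω] (μ ν : Measure Ω) (c : ENNReal) : Prop :=
  ∃ f : Ω → ENNReal, Measurable f ∧ ν = μ.withDensity f ∧ ∫⁻ x, f x ^ 2 ∂μ ≤ c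

/-- Cauchy–Schwarz for the density against the indicator of `E`; the measurable hull takes care of
arbitrary `E`. -/
lemma HasSqDensity.apply_le {Ω : Type*} [MeasurableSpace Ω] {μ ν : Measure Ω} {c : ENNReal}
    (h : HasSqDensity μ ν c) (E : Set Ω) :
    ν E ≤ c ^ (1 / 2 : ℝ) * μ E ^ (1 / 2 : ℝ) := by
  obtain ⟨f, hf, rfl, hc⟩ := h
  have hE := measurableSet_toMeasurable μ E
  calc μ.withDensity f E ≤ μ.withDensity f (toMeasurable μ E) :=
        measure_mono (subset_toMeasurable μ E)
    _ = ∫⁻ x, f x * (toMeasurable μ E).indicator 1 x ∂μ := by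
        rw [withDensity_apply _ hE, ← lintegral_indicator hE]
        congr 1; ext x; by_cases hx : x ∈ toMeasurable μ E <;> simp [hx]
    _ ≤ (∫⁻ x, f x ^ (2 : ℝ) ∂μ) ^ (1 / 2 : ℝ) *
        (∫⁻ x, (toMeasurable μ E).indicator 1 x ^ (2 : ℝ) ∂μ) ^ (1 / 2 : ℝ) :=
        ENNReal.lintegral_mul_le_Lp_mul_Lq μ Real.HolderConjugate.two_two hf.aemeasurable
          (measurable_one.indicator hE).aemeasurable
    _ ≤ _ := by
        gcongr
        · simpa using hc
        · have : ∀ x, (toMeasurable μ E).indicator (1 : Ω → ENNReal) x ^ (2 : ℝ) =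
              (toMeasurable μ E).indicator 1 x := fun x => by
            by_cases hx : x ∈ toMeasurable μ E <;> simp [hx]
          simp_rw [this]
          rw [lintegral_indicator_one hE, measure_toMeasurable]

lemma lintegral_pi_prod {ι : Type*} [Fintype ι] {Ω : ι → Type*} [∀ i, MeasurableSpace (Ω i)]
    (μ : ∀ i, Measure (Ω i)) [∀ i, IsProbabilityMeasure (μ i)] {f : ∀ i, Ω i → ENNReal}
    (hf : ∀ i, Measurable (f i)) :
    ∫⁻ x, ∏ i, f i (x i) ∂(Measure.pi μ) = ∏ i, ∫⁻ y, f i y ∂(μ i) := by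
  refine (lintegral_prod_eq_prod_lintegral_of_indepFun Finset.univ
    (fun i (x : ∀ i, Ω i) => f i (x i)) (iIndepFun_pi fun i => (hf i).aemeasurable)
    (fun i => (hf i).comp (measurable_pi_apply i))).trans ?_
  exact Finset.prod_congr rfl fun i _ => (measurePreserving_eval μ i).lintegral_comp (hf i)

/-- The product of the densities is a density of the product, and by independence its second moment
is the product of the second moments. -/
lemma HasSqDensity.pi {ι : Type*} [Fintype ι] {Ω : ι → Type*} [∀ i, MeasurableSpace (Ω i)]
    {μ ν : ∀ i, Measure (Ω i)} [∀ i, IsProbabilityMeasure (μ i)]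
    [∀ i, IsProbabilityMeasure (ν i)] {c : ι → ENNReal}
    (h : ∀ i, HasSqDensity (μ i) (ν i) (c i)) :
    HasSqDensity (Measure.pi μ) (Measure.pi ν) (∏ i, c i) := by
  choose f hf hν hc using h
  have hmeas : Measurable fun x : ∀ i, Ω i => ∏ i, f i (x i) :=
    Finset.measurable_prod _ fun i _ => (hf i).comp (measurable_pi_apply i)
  refine ⟨fun x => ∏ i, f i (x i), hmeas, ?_, ?_⟩
  · refine Measure.pi_eq (μ := ν) fun s hs => ?_
    rw [withDensity_apply _ (MeasurableSet.univ_pi hs), ← lintegral_indicator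
      (MeasurableSet.univ_pi hs)]
    have : ∀ x : ∀ i, Ω i, (Set.univ.pi s).indicator (fun x => ∏ i, f i (x i)) x =
        ∏ i, (s i).indicator (f i) (x i) := fun x => by
      by_cases hx : x ∈ Set.univ.pi s
      · rw [Set.indicator_of_mem hx]
        exact Finset.prod_congr rfl fun i _ => (Set.indicator_of_mem (hx i trivial) _).symm
      · rw [Set.indicator_of_notMem hx]
        simp only [Set.mem_univ_pi, not_forall] at hx
        obtain ⟨i, hi⟩ := hx
        exact (Finset.prod_eq_zero (Finset.mem_univ i) (Set.indicator_of_notMem hi _)).symm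
    simp_rw [this]
    rw [lintegral_pi_prod μ fun i => (hf i).indicator (hs i)]
    refine Finset.prod_congr rfl fun i _ => ?_
    rw [lintegral_indicator (hs i), hν i, withDensity_apply _ (hs i)]
  · simp_rw [← Finset.prod_pow]
    rw [lintegral_pi_prod μ fun i => (hf i).pow_const 2]
    exact Finset.prod_le_prod' fun i _ => hc i

/-- The second moment of the likelihood ratio is `(1 - (lam - 1)²)^(-1/2)`, and `1 / (1 - x) ≤ exp
(2x)` for `0 ≤ x ≤ 1/2`. The bound is quadratic in `lam - 1`, so it survives `n`-fold products when
`lam - 1` is of order `1/√n`. -/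
lemma hasSqDensity_gaussianReal {lam : ℝ} (h : (lam - 1) ^ 2 ≤ 1 / 4) :
    HasSqDensity (gaussianReal 0 1) (gaussianReal 0 lam.toNNReal)
      (ENNReal.ofReal (Real.exp ((lam - 1) ^ 2))) := by
  have hl : 1 / 2 ≤ lam ∧ lam ≤ 3 / 2 := by constructor <;> nlinarith
  have hl0 : 0 < lam := by linarith
  have hv : lam.toNNReal ≠ 0 := by simpa using hl0
  have hvc : (lam.toNNReal : ℝ) = lam := Real.coe_toNNReal _ hl0.le
  have h1 : ∀ x, gaussianPDF 0 1 x ≠ 0 := fun x => (gaussianPDF_pos 0 one_ne_zero x).ne'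
  have h2 : ∀ x, gaussianPDF 0 1 x ≠ ⊤ := fun x => gaussianPDF_ne_top
  have hmf : Measurable fun x => gaussianPDF 0 lam.toNNReal x / gaussianPDF 0 1 x :=
    (measurable_gaussianPDF _ _).div (measurable_gaussianPDF _ _)
  refine ⟨_, hmf, ?_, ?_⟩
  · rw [gaussianReal_of_var_ne_zero 0 hv, gaussianReal_of_var_ne_zero 0 one_ne_zero,
      ← withDensity_mul _ (measurable_gaussianPDF _ _) hmf]
    congr 1
    ext x
    rw [Pi.mul_apply, ENNReal.mul_div_cancel (h1 x) (h2 x)]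
  · rw [gaussianReal_of_var_ne_zero 0 one_ne_zero, lintegral_withDensity_eq_lintegral_mul _
      (measurable_gaussianPDF _ _) (hmf.pow_const 2)]
    -- Squared `N(0, lam)` density over standard normal density has exponent `-x²/lam + x²/2 = -b
    -- x²`; integrability requires `lam < 2`.
    set b : ℝ := 1 / lam - 1 / 2 with hb
    have hb0 : 0 < b := by
      rw [hb, sub_pos, div_lt_div_iff₀ (by norm_num) hl0]; linarith
    have e : ∀ x, (gaussianPDF 0 1 * fun x => (gaussianPDF 0 lam.toNNReal x /
        gaussianPDF 0 1 x) ^ 2) x =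
        ENNReal.ofReal ((lam * √(2 * Real.pi))⁻¹ * Real.exp (-b * x ^ 2)) := by
      intro x
      have hp1 := gaussianPDFReal_pos 0 1 x one_ne_zero
      simp only [Pi.mul_apply, gaussianPDF]
      rw [← ENNReal.ofReal_div_of_pos hp1, ← ENNReal.ofReal_pow (by
        exact div_nonneg (gaussianPDFReal_nonneg _ _ _) hp1.le), ← ENNReal.ofReal_mul hp1.le]
      congr 1
      rw [div_pow, sq (gaussianPDFReal 0 1 x), mul_div_assoc', mul_div_mul_left _ _ hp1.ne']
      simp only [gaussianPDFReal, hvc, sub_zero, NNReal.coe_one, mul_one, mul_pow, ← Real.exp_nat_mul]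
      have hs : 0 < √(2 * Real.pi) := by positivity
      have hs2 : √(2 * Real.pi * lam) ^ 2 = √(2 * Real.pi) * √(2 * Real.pi) * lam := by
        rw [Real.sq_sqrt (by positivity), Real.mul_self_sqrt (by positivity)]
      rw [mul_div_mul_comm, ← Real.exp_sub, inv_pow, hs2]
      congr 1
      · field_simp
      · congr 1
        rw [hb]; push_cast; field_simp; ring
    rw [lintegral_congr e, ← ofReal_integral_eq_lintegral_ofReal
      ((integrable_exp_neg_mul_sq hb0).const_mul _) (ae_of_all _ fun x => by positivity),
      integral_const_mul, integral_gaussian]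
    apply ENNReal.ofReal_le_ofReal
    refine le_of_sq_le_sq ?_ (Real.exp_pos _).le
    rw [mul_pow, inv_pow, mul_pow, Real.sq_sqrt (by positivity), Real.sq_sqrt (by positivity),
      ← Real.exp_nat_mul]
    have hpi := Real.pi_pos
    have e2 : (lam ^ 2 * (2 * Real.pi))⁻¹ * (Real.pi / b) = (1 - (lam - 1) ^ 2)⁻¹ := by
      have : b = (2 - lam) / (2 * lam) := by rw [hb]; field_simp
      have h3 : (2 - lam) ≠ 0 := by linarith
      have h4 : 1 - (lam - 1) ^ 2 = lam * (2 - lam) := by ring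
      rw [this, h4]; field_simp
    rw [e2, inv_le_iff_one_le_mul₀ (by linarith)]
    -- With `x = (lam - 1)²`: `exp(2x)(1 - x) ≥ (1 + 2x)(1 - x) = 1 + x(1 - 2x) ≥ 1`.
    have := Real.add_one_le_exp (((2 : ℕ) : ℝ) * (lam - 1) ^ 2)
    push_cast at this ⊢
    nlinarith [sq_nonneg (lam - 1)]

/-! ### Contiguity and coupling of nearby Gaussian samples -/

lemma HasSqDensity.map_apply_le {Ω Ω' : Type*} [MeasurableSpace Ω] [MeasurableSpace Ω']
    {μ ν : Measure Ω} {c : ENNReal} (h : HasSqDensity μ ν c) {g : Ω → Ω'} (hg : Measurable g)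
    (E : Set Ω') : ν.map g E ≤ c ^ (1 / 2 : ℝ) * μ.map g E ^ (1 / 2 : ℝ) := by
  have hE := measurableSet_toMeasurable (μ.map g) E
  calc ν.map g E ≤ ν.map g (toMeasurable (μ.map g) E) := measure_mono (subset_toMeasurable _ E)
    _ = ν (g ⁻¹' toMeasurable (μ.map g) E) := Measure.map_apply hg hE
    _ ≤ c ^ (1 / 2 : ℝ) * μ (g ⁻¹' toMeasurable (μ.map g) E) ^ (1 / 2 : ℝ) := h.apply_le _
    _ = _ := by rw [← Measure.map_apply hg hE, measure_toMeasurable]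

section

variable {ι : Type*} [Fintype ι] [DecidableEq ι] {C C' : Matrix ι ι ℝ}

/-- Law of a sample of `n` independent Gaussian vectors. -/
abbrev gaussSample (n : ℕ) (C : Matrix ι ι ℝ) : Measure (Fin n → ι → ℝ) :=
  Measure.pi fun _ : Fin n => gaussVec C

/-- A sample of `n` independent standard Gaussian vectors. -/
abbrev stdSample (n : ℕ) (ι : Type*) [Fintype ι] : Measure (Fin n → ι → ℝ) :=
  Measure.pi fun _ : Fin n => stdVec ι

lemma map_diagonal_sqrt_stdVec {lam : ι → ℝ} (h : ∀ i, 0 ≤ lam i) :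
    (stdVec ι).map (fun x => diagonal (fun i => √(lam i)) *ᵥ x) =
      Measure.pi fun i => gaussianReal 0 (lam i).toNNReal := by
  have e : ∀ i, (gaussianReal 0 1).map (fun y => √(lam i) * y) =
      gaussianReal 0 (lam i).toNNReal := fun i => by
    rw [gaussianReal_map_const_mul]
    congr 1
    · simp
    · ext; simp [h i]
  have : (fun x : ι → ℝ => diagonal (fun i => √(lam i)) *ᵥ x) = fun x i => √(lam i) * x i := by
    ext x i; simp [mulVec_diagonal]
  rw [this, Measure.pi_map_pi (fun i => by fun_prop)]
  simp_rw [e]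

lemma mul_diagonal_mul_transpose_eq {lam : ι → ℝ} (h : ∀ i, 0 ≤ lam i) (G : Matrix ι ι ℝ) :
    G * diagonal lam * Gᵀ =
      G * diagonal (fun i => √(lam i)) * (G * diagonal fun i => √(lam i))ᵀ := by
  rw [transpose_mul, diagonal_transpose, Matrix.mul_assoc G (diagonal fun i => √(lam i)),
    ← Matrix.mul_assoc (diagonal _), diagonal_mul_diagonal, Matrix.mul_assoc]
  simp only [Real.mul_self_sqrt (h _)]

lemma gaussVec_mul_diagonal_mul_transpose {lam : ι → ℝ} (h : ∀ i, 0 ≤ lam i)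
    (G : Matrix ι ι ℝ) : gaussVec (G * diagonal lam * Gᵀ) =
      (Measure.pi fun i => gaussianReal 0 (lam i).toNNReal).map fun x => G *ᵥ x := by
  rw [mul_diagonal_mul_transpose_eq h, gaussVec_mul_transpose, ← map_diagonal_sqrt_stdVec h,
    Measure.map_map (measurable_mulVec_left _) (measurable_mulVec_left _)]
  congr 1
  ext x
  simp [mulVec_mulVec]

/-- A Gaussian analogue of the squared Hellinger distance between two covariance matrices. -/
def covDist (C C' : Matrix ι ι ℝ) : ℝ := (C⁻¹ * (C' - C) * (C⁻¹ * (C' - C))).trace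

/-- After simultaneous diagonalization both samples are images, under the same linear map, of
product measures with factors `N(0, 1)` and `N(0, lam i)`. The one-dimensional chi-square bounds
multiply to `exp(n Σ (lam i - 1)²)`, and applying a common map does not spoil the estimate. -/
lemma gaussSample_apply_le (hC : C.PosDef) (hC' : C'.PosSemidef) (hD : covDist C C' ≤ 1 / 4)
    (n : ℕ) (E : Set (Fin n → ι → ℝ)) :
    gaussSample n C' E ≤ ENNReal.ofReal (Real.exp (n * covDist C C')) ^ (1 / 2 : ℝ) *
      gaussSample n C E ^ (1 / 2 : ℝ) := by
  obtain ⟨G, lam, h1, h2, h3, h4⟩ := exists_simultaneous_diagonalization hC hC'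
  have hle : ∀ i, (lam i - 1) ^ 2 ≤ 1 / 4 := fun i => by
    refine le_trans ?_ (h4.le.trans hD)
    exact Finset.single_le_sum (f := fun i => (lam i - 1) ^ 2) (fun i _ => sq_nonneg _)
      (Finset.mem_univ i)
  have hmeas : Measurable fun (x : Fin n → ι → ℝ) (i : Fin n) => G *ᵥ x i :=
    measurable_pi_lambda _ fun i => (measurable_mulVec_left G).comp (measurable_pi_apply i)
  have e1 : gaussSample n C = (stdSample n ι).map fun x i => G *ᵥ x i := by
    have hp : ∀ _ : Fin n, SigmaFinite ((stdVec ι).map fun x => G *ᵥ x) := fun _ =>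
      (measurePreserving_mulVec_gaussVec h1).map_eq ▸ inferInstance
    rw [Measure.pi_map_pi (fun i => (measurable_mulVec_left G).aemeasurable)]
    rw [(measurePreserving_mulVec_gaussVec h1).map_eq]
  have e2 : gaussSample n C' = (Measure.pi fun _ : Fin n =>
      Measure.pi fun i => gaussianReal 0 (lam i).toNNReal).map fun x i => G *ᵥ x i := by
    have e := gaussVec_mul_diagonal_mul_transpose h3 G
    have hp : ∀ _ : Fin n, SigmaFinite ((Measure.pi fun i =>
        gaussianReal 0 (lam i).toNNReal).map fun x => G *ᵥ x) := fun _ =>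
      e ▸ inferInstance
    rw [Measure.pi_map_pi (fun i => (measurable_mulVec_left G).aemeasurable), ← e, ← h2]
  have hsq : HasSqDensity (stdSample n ι) (Measure.pi fun _ : Fin n =>
      Measure.pi fun i => gaussianReal 0 (lam i).toNNReal)
      (∏ _k : Fin n, ∏ i, ENNReal.ofReal (Real.exp ((lam i - 1) ^ 2))) :=
    HasSqDensity.pi fun _ => HasSqDensity.pi fun i => hasSqDensity_gaussianReal (hle i)
  rw [e1, e2]
  convert hsq.map_apply_le hmeas E using 3
  rw [covDist, ← h4, Finset.prod_const, Finset.card_univ, Fintype.card_fin,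
    ← ENNReal.ofReal_prod_of_nonneg (fun i _ => (Real.exp_pos _).le), ← Real.exp_sum,
    ← ENNReal.ofReal_pow (Real.exp_pos _).le, ← Real.exp_nat_mul]

/-- The geometric mean of two numbers in `[1 - √D, 1 + √D]` stays in that interval. -/
lemma abs_sqrt_mul_sqrt_sub_one_sq_le {a b D : ℝ} (ha : 0 ≤ a) (_hb : 0 ≤ b)
    (haD : (a - 1) ^ 2 ≤ D) (hbD : (b - 1) ^ 2 ≤ D) (hD : D ≤ 1) : (√a * √b - 1) ^ 2 ≤ D := by
  have hD0 : 0 ≤ D := (sq_nonneg _).trans haD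
  have hd1 : √D ≤ 1 := Real.sqrt_le_one.2 hD
  have hd0 : 0 ≤ √D := Real.sqrt_nonneg D
  have h1 := abs_le.1 (Real.abs_le_sqrt haD)
  have h2 := abs_le.1 (Real.abs_le_sqrt hbD)
  have h3 : √a * √b ≤ 1 + √D := by
    rw [← Real.sqrt_mul ha]
    exact Real.sqrt_le_iff.2 ⟨by linarith, by nlinarith⟩
  have h4 : 1 - √D ≤ √a * √b := by
    rw [← Real.sqrt_mul ha]
    exact Real.le_sqrt_of_sq_le (by nlinarith)
  have h5 : |√a * √b - 1| ≤ √D := abs_le.2 ⟨by linarith, by linarith⟩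
  calc (√a * √b - 1) ^ 2 = |√a * √b - 1| ^ 2 := (sq_abs _).symm
    _ ≤ √D ^ 2 := by gcongr
    _ = D := Real.sq_sqrt hD0

lemma trace_mul_self_of_isSymm {H : Matrix ι ι ℝ} (hH : H.IsSymm) :
    (H * H).trace = ∑ i, ∑ j, H i j ^ 2 := by
  simp only [trace, diag_apply, mul_apply]
  refine Finset.sum_congr rfl fun i _ => Finset.sum_congr rfl fun j _ => ?_
  rw [hH.apply i j, sq]

/-- Samples from `N(0, C)` and `N(0, C')` can be coupled so that the normalized sums of all
quadratic forms differ by their mean difference up to a small error. -/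
lemma exists_coupling (hC : C.PosDef) (hC' : C'.PosSemidef) (hD : covDist C C' ≤ 1 / 4) (n : ℕ) :
    ∃ W Z : (Fin n → ι → ℝ) → Fin n → ι → ℝ,
      MeasurePreserving W (stdSample n ι) (gaussSample n C) ∧
      MeasurePreserving Z (stdSample n ι) (gaussSample n C') ∧
      ∀ A : Matrix ι ι ℝ, A.IsSymm → ∀ ε : ℝ, 0 < ε →
        stdSample n ι {g | ε ≤ |(√(n : ℝ))⁻¹ * ∑ i, (centeredQuad C A (Z g i) -
          centeredQuad C A (W g i)) - √(n : ℝ) * (1 / 2 * (A * (C' - C)).trace)|} ≤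
        ENNReal.ofReal (1 / 2 * covDist C C' * (A * C * (A * C)).trace / ε ^ 2) := by
  obtain ⟨G, lam, h1, h2, h3, h4⟩ := exists_simultaneous_diagonalization hC hC'
  have hle : ∀ i, (lam i - 1) ^ 2 ≤ covDist C C' := fun i => by
    refine le_trans ?_ h4.le
    exact Finset.single_le_sum (f := fun i => (lam i - 1) ^ 2) (fun i _ => sq_nonneg _)
      (Finset.mem_univ i)
  set S : Matrix ι ι ℝ := diagonal fun i => √(lam i) with hS
  -- The coupling uses the same standard normal `g` twice: `W = G g` and `Z = G S g`. A quadratic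
  -- form then changes by a form in `g` with matrix `N = S H S - H`, `H = GᵀAG`.
  have h2' : C' = (G * S) * (G * S)ᵀ := by rw [h2, hS, mul_diagonal_mul_transpose_eq h3]
  have hmp : ∀ {K M : Matrix ι ι ℝ}, K = M * Mᵀ → MeasurePreserving
      (fun (x : Fin n → ι → ℝ) (i : Fin n) => M *ᵥ x i) (stdSample n ι) (gaussSample n K) :=
    fun {K M} h => measurePreserving_pi _ _ fun _ => measurePreserving_mulVec_gaussVec h
  refine ⟨_, _, hmp h1, hmp h2', fun A hA ε hε => ?_⟩
  set N : Matrix ι ι ℝ := (G * S)ᵀ * A * (G * S) - Gᵀ * A * G with hN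
  have hNs : N.IsSymm := (isSymm_transpose_mul_mul hA _).sub (isSymm_transpose_mul_mul hA _)
  obtain ⟨q1, q2, q3⟩ := quadraticForm_stdVec hNs
  have htr : N.trace = (A * (C' - C)).trace := by
    rw [hN, trace_sub, trace_transpose_mul_mul, trace_transpose_mul_mul, ← h1, ← h2',
      Matrix.mul_sub, trace_sub]
  have hval : ∀ x : ι → ℝ, centeredQuad C A ((G * S) *ᵥ x) - centeredQuad C A (G *ᵥ x) =
      1 / 2 * (x ⬝ᵥ (N *ᵥ x)) := fun x => by
    rw [centeredQuad, centeredQuad, dotProduct_mulVec_mulVec, dotProduct_mulVec_mulVec, hN,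
      sub_mulVec, dotProduct_sub]
    ring
  have hH := isSymm_transpose_mul_mul hA G
  have hNN : (N * N).trace ≤ covDist C C' * (A * C * (A * C)).trace := by
    have e : (A * C * (A * C)).trace = ((Gᵀ * A * G) * (Gᵀ * A * G)).trace := by
      rw [trace_transpose_mul_mul_sq, ← h1]
    rw [e, trace_mul_self_of_isSymm hNs, trace_mul_self_of_isSymm hH, Finset.mul_sum]
    refine Finset.sum_le_sum fun i _ => ?_
    rw [Finset.mul_sum]
    refine Finset.sum_le_sum fun j _ => ?_
    -- The entries of `N` are those of `H` damped by `√(lam i) √(lam j) - 1`, so `tr N²` is at most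
    -- `covDist C C'` times `tr H²`.
    have : N i j = (Gᵀ * A * G) i j * (√(lam i) * √(lam j) - 1) := by
      have e' : (G * S)ᵀ * A * (G * S) = S * (Gᵀ * A * G) * S := by
        rw [transpose_mul, hS, diagonal_transpose]; simp only [Matrix.mul_assoc]
      rw [hN, e', Matrix.sub_apply, hS, mul_diagonal, diagonal_mul]
      ring
    rw [this, mul_pow, mul_comm]
    gcongr
    exact abs_sqrt_mul_sqrt_sub_one_sq_le (h3 i) (h3 j) (hle i) (hle j) (by linarith)
  simp only [hval]
  set X : (Fin n → ι → ℝ) → ℝ := fun g => (√(n : ℝ))⁻¹ * ∑ i, 1 / 2 * (g i ⬝ᵥ (N *ᵥ g i)) with hX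
  have hq := q1.const_mul (1 / 2 : ℝ)
  have hq' : ∀ i : Fin n, MemLp (fun g : Fin n → ι → ℝ => 1 / 2 * (g i ⬝ᵥ (N *ᵥ g i))) 2
      (stdSample n ι) := fun i =>
    hq.comp_measurePreserving (measurePreserving_eval (fun _ : Fin n => stdVec ι) i)
  have hXL : MemLp X 2 (stdSample n ι) := (memLp_finsetSum _ fun i _ => hq' i).const_mul _
  have hmean : ∫ g, X g ∂(stdSample n ι) = √(n : ℝ) * (1 / 2 * (A * (C' - C)).trace) := by
    rw [hX, integral_const_mul, integral_finsetSum _ fun i _ => (hq' i).integrable (by simp)]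
    have : ∀ i : Fin n, ∫ g, 1 / 2 * (g i ⬝ᵥ (N *ᵥ g i)) ∂(stdSample n ι) =
        1 / 2 * (A * (C' - C)).trace := fun i => by
      rw [integral_comp_eval (μ := fun _ : Fin n => stdVec ι) (i := i)
        (f := fun x => 1 / 2 * (x ⬝ᵥ (N *ᵥ x))) hq.1, integral_const_mul, q2, htr]
    simp_rw [this]
    rw [Finset.sum_const, Finset.card_univ, Fintype.card_fin, nsmul_eq_mul, ← mul_assoc]
    congr 1
    rcases Nat.eq_zero_or_pos n with rfl | hn
    · simp
    · have : (0 : ℝ) < √(n : ℝ) := Real.sqrt_pos.2 (by exact_mod_cast hn)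
      field_simp
      rw [Real.sq_sqrt (by positivity)]
  have hD0 : 0 ≤ covDist C C' := by
    rw [covDist, ← h4]; exact Finset.sum_nonneg fun i _ => sq_nonneg _
  -- The normalization `1/√n` cancels the number of summands, leaving `¼ · 2 tr N²`; Chebyshev's
  -- inequality finishes.
  have hvar : Var[X; stdSample n ι] ≤ 1 / 2 * covDist C C' * (A * C * (A * C)).trace := by
    have h := variance_sum_pi (μ := fun _ : Fin n => stdVec ι) (fun _ : Fin n => hq)
    have e : (∑ i, fun ω : Fin n → ι → ℝ => 1 / 2 * (ω i ⬝ᵥ (N *ᵥ ω i))) =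
        fun g => ∑ i, 1 / 2 * (g i ⬝ᵥ (N *ᵥ g i)) := by ext x; simp
    rw [e] at h
    rw [hX, variance_const_mul, h]
    simp_rw [variance_const_mul, q3]
    rw [Finset.sum_const, Finset.card_univ, Fintype.card_fin, nsmul_eq_mul, inv_pow,
      Real.sq_sqrt (Nat.cast_nonneg n)]
    have hnn : 0 ≤ (N * N).trace := by
      rw [trace_mul_self_of_isSymm hNs]
      exact Finset.sum_nonneg fun i _ => Finset.sum_nonneg fun j _ => sq_nonneg _
    rcases Nat.eq_zero_or_pos n with rfl | hn
    · simp; linarith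
    · have : (0 : ℝ) < n := by exact_mod_cast hn
      rw [← mul_assoc, inv_mul_cancel₀ this.ne']
      linarith
  rw [← hmean]
  refine (meas_ge_le_variance_div_sq hXL hε).trans (ENNReal.ofReal_le_ofReal ?_)
  gcongr

end

/-! ### Calculus of `o_P(1)` -/

section

variable {k : ℕ} {Ω Ω' : ℕ → Type} [∀ n, MeasurableSpace (Ω n)] [∀ n, MeasurableSpace (Ω' n)]
  {μ : ∀ n, Measure (Ω n)} {ν : ∀ n, Measure (Ω' n)}

lemma IsLittleOP.add {X Y : ∀ n, Ω n → Fin k → ℝ} (hX : IsLittleOP μ X) (hY : IsLittleOP μ Y) :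
    IsLittleOP μ fun n x => X n x + Y n x := by
  intro ε hε
  have h := (hX (ε / 2) (half_pos hε)).add (hY (ε / 2) (half_pos hε))
  rw [add_zero] at h
  refine tendsto_of_tendsto_of_tendsto_of_le_of_le tendsto_const_nhds h (fun _ => zero_le)
    fun n => ?_
  refine (measure_mono fun x hx => ?_).trans (measure_union_le _ _)
  by_contra hcon
  simp only [Set.mem_union, Set.mem_ofPred_eq, not_or, not_le] at hcon hx
  linarith [norm_add_le (X n x) (Y n x)]

lemma IsLittleOP.neg {X : ∀ n, Ω n → Fin k → ℝ} (hX : IsLittleOP μ X) :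
    IsLittleOP μ fun n x => -X n x := by
  intro ε hε
  simpa using hX ε hε

lemma IsLittleOP.sub {X Y : ∀ n, Ω n → Fin k → ℝ} (hX : IsLittleOP μ X) (hY : IsLittleOP μ Y) :
    IsLittleOP μ fun n x => X n x - Y n x := by
  simpa only [sub_eq_add_neg] using hX.add hY.neg

/-- Smallness in probability can be checked on any coupling space, and only for large `n`; the
inequality between a measure and its image copes with sets not known to be measurable. -/
lemma IsLittleOP.comp {X : ∀ n, Ω' n → Fin k → ℝ} (hX : IsLittleOP ν X) {g : ∀ n, Ω n → Ω' n}
    (hg : ∀ᶠ n in atTop, MeasurePreserving (g n) (μ n) (ν n)) :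
    IsLittleOP μ fun n x => X n (g n x) := by
  intro ε hε
  refine tendsto_of_tendsto_of_tendsto_of_le_of_le' tendsto_const_nhds (hX ε hε)
    (Eventually.of_forall fun _ => zero_le) ?_
  filter_upwards [hg] with n hn
  have := Measure.le_map_apply (μ := μ n) hn.measurable.aemeasurable {x | ε ≤ ‖X n x‖}
  rw [hn.map_eq] at this
  exact this

lemma isLittleOP_of_forall_apply {X : ∀ n, Ω n → Fin k → ℝ}
    (hX : ∀ m, ∀ ε : ℝ, 0 < ε → Tendsto (fun n => μ n {x | ε ≤ |X n x m|}) atTop (𝓝 0)) :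
    IsLittleOP μ X := by
  intro ε hε
  have h : Tendsto (fun n => ∑ m, μ n {x | ε ≤ |X n x m|}) atTop (𝓝 0) := by
    have := tendsto_finsetSum Finset.univ fun m (_ : m ∈ Finset.univ) => hX m ε hε
    simpa using this
  refine tendsto_of_tendsto_of_tendsto_of_le_of_le tendsto_const_nhds h (fun _ => zero_le)
    fun n => ?_
  refine (measure_mono fun x hx => ?_).trans (measure_iUnion_fintype_le (μ n)
    fun m => {x | ε ≤ |X n x m|})
  by_contra hcon
  simp only [Set.mem_iUnion, Set.mem_ofPred_eq, not_exists, not_le] at hcon hx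
  exact absurd hx (not_le.2 ((pi_norm_lt_iff hε).2 hcon))

lemma isLittleOP_of_tendsto {c : ℕ → Fin k → ℝ} (hc : Tendsto c atTop (𝓝 0)) :
    IsLittleOP μ fun n _ => c n := by
  intro ε hε
  refine tendsto_const_nhds.congr' ?_
  filter_upwards [(tendsto_zero_iff_norm_tendsto_zero.1 hc).eventually_lt_const hε] with n hn
  simp [not_le.2 hn]

lemma IsLittleOP.congr {X Y : ∀ n, Ω n → Fin k → ℝ} (hX : IsLittleOP μ X)
    (h : ∀ n, ∀ᵐ x ∂(μ n), X n x = Y n x) : IsLittleOP μ Y := by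
  intro ε hε
  refine (hX ε hε).congr fun n => measure_congr (eventuallyEq_set.2 ?_)
  filter_upwards [h n] with x hx
  simp [hx]

/-- A constant sequence is `o_P(1)` only if it vanishes. -/
lemma IsLittleOP.eq_zero_of_const [∀ n, IsProbabilityMeasure (μ n)] {c : Fin k → ℝ}
    (h : IsLittleOP μ fun _ _ => c) : c = 0 := by
  by_contra hc
  have := h ‖c‖ (norm_pos_iff.2 hc)
  simp at this

/-- The function `y ↦ 1 / (1 + ‖y + w‖)`. -/
def bump {k : ℕ} (w : Fin k → ℝ) : BoundedContinuousFunction (Fin k → ℝ) ℝ :=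
  BoundedContinuousFunction.ofNormedAddCommGroup (fun y => (1 + ‖y + w‖)⁻¹)
    (Continuous.inv₀ (by fun_prop) fun y => by positivity) 1 fun y => by
      rw [Real.norm_of_nonneg (by positivity)]
      exact inv_le_one_of_one_le₀ (by linarith [norm_nonneg (y + w)])

lemma bump_apply (w y : Fin k → ℝ) : bump w y = (1 + ‖y + w‖)⁻¹ := rfl

lemma bump_pos (w y : Fin k → ℝ) : 0 < bump w y := by rw [bump_apply]; positivity

lemma bump_le_one (w y : Fin k → ℝ) : bump w y ≤ 1 := by
  rw [bump_apply]; exact inv_le_one_of_one_le₀ (by linarith [norm_nonneg (y + w)])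

lemma abs_bump_sub_le (w y z : Fin k → ℝ) : |bump w y - bump w z| ≤ ‖y - z‖ := by
  rw [bump_apply, bump_apply]
  have h1 : 0 ≤ ‖y + w‖ := norm_nonneg _
  have h2 : 0 ≤ ‖z + w‖ := norm_nonneg _
  rw [inv_sub_inv (by positivity) (by positivity), abs_div,
    abs_of_pos (show 0 < (1 + ‖y + w‖) * (1 + ‖z + w‖) by positivity)]
  have h3 : |1 + ‖z + w‖ - (1 + ‖y + w‖)| ≤ ‖y - z‖ := by
    rw [show 1 + ‖z + w‖ - (1 + ‖y + w‖) = ‖z + w‖ - ‖y + w‖ by ring]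
    refine (abs_norm_sub_norm_le _ _).trans ?_
    rw [show z + w - (y + w) = z - y by abel, norm_sub_rev]
  refine (div_le_self (abs_nonneg _) ?_).trans h3
  nlinarith

/-- If `U_n` and `V_n` have the same limit law and `U_n - V_n → c` in probability, then `c = 0`. -/
lemma shift_eq_zero [∀ n, IsProbabilityMeasure (μ n)] {U V : ∀ n, Ω n → Fin k → ℝ}
    {c : Fin k → ℝ} (hU : ∀ᶠ n in atTop, AEMeasurable (U n) (μ n))
    (hV : ∀ᶠ n in atTop, AEMeasurable (V n) (μ n)) (L : ProbabilityMeasure (Fin k → ℝ))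
    (hUL : ∀ f : BoundedContinuousFunction (Fin k → ℝ) ℝ,
      Tendsto (fun n => ∫ x, f (U n x) ∂(μ n)) atTop (𝓝 (∫ y, f y ∂(L : Measure (Fin k → ℝ)))))
    (hVL : ∀ f : BoundedContinuousFunction (Fin k → ℝ) ℝ,
      Tendsto (fun n => ∫ x, f (V n x) ∂(μ n)) atTop (𝓝 (∫ y, f y ∂(L : Measure (Fin k → ℝ)))))
    (h : IsLittleOP μ fun n x => U n x - V n x - c) : c = 0 := by
  -- `bump w (V + c) = bump (w + c) V`, so the assumption that `U - V` tends to `c` makes the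
  -- integrals of `bump w` and `bump (w + c)` agree under `L`.
  have step : ∀ w, ∫ y, bump w y ∂(L : Measure (Fin k → ℝ)) =
      ∫ y, bump (w + c) y ∂(L : Measure (Fin k → ℝ)) := by
    intro w
    have hdiff : Tendsto (fun n => ∫ x, bump w (U n x) ∂(μ n) -
        ∫ x, bump (w + c) (V n x) ∂(μ n)) atTop (𝓝 0) := by
      rw [Metric.tendsto_atTop']
      intro ε hε
      have h1 := (ENNReal.tendsto_toReal ENNReal.zero_ne_top).comp (h (ε / 4) (by positivity))
      have h2 := h1.eventually_lt_const (show (0 : ENNReal).toReal < ε / 4 by simpa using hε)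
      obtain ⟨N, hN⟩ := eventually_atTop.1 (hU.and (hV.and h2))
      refine ⟨N, fun n hn => ?_⟩
      obtain ⟨hUn, hVn, hn2⟩ := hN n hn.le
      have hi : ∀ (w : Fin k → ℝ) {X : Ω n → Fin k → ℝ}, AEMeasurable X (μ n) →
          Integrable (fun x => bump w (X x)) (μ n) := fun w X hX =>
        Integrable.of_bound ((bump w).continuous.measurable.comp_aemeasurable
          hX).aestronglyMeasurable 1 (ae_of_all _ fun x => by
            rw [Real.norm_of_nonneg (bump_pos _ _).le]; exact bump_le_one _ _)
      rw [dist_zero_right, ← integral_sub (hi w hUn) (hi _ hVn)]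
      set E := {x | ε / 4 ≤ ‖U n x - V n x - c‖} with hE
      set E' := toMeasurable (μ n) E
      have hE' : MeasurableSet E' := measurableSet_toMeasurable _ _
      have hb : ∀ x, ‖bump w (U n x) - bump (w + c) (V n x)‖ ≤ ε / 4 + E'.indicator 1 x := by
        intro x
        have e : bump (w + c) (V n x) = bump w (V n x + c) := by
          rw [bump_apply, bump_apply]; congr 3; abel
        -- On the exceptional set, of probability below `ε / 4`, only the bound `1` is available;
        -- off it the 1-Lipschitz property gives `ε / 4`.
        by_cases hx : x ∈ E'
        · rw [Set.indicator_of_mem hx, Real.norm_eq_abs, Pi.one_apply, abs_le]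
          constructor <;> linarith [bump_pos w (U n x), bump_le_one w (U n x),
            bump_pos (w + c) (V n x), bump_le_one (w + c) (V n x)]
        · rw [Set.indicator_of_notMem hx, e, Real.norm_eq_abs, add_zero]
          have hx' : x ∉ E := fun hh => hx (subset_toMeasurable _ _ hh)
          simp only [hE, Set.mem_ofPred_eq, not_le] at hx'
          refine (abs_bump_sub_le _ _ _).trans ?_
          rw [← sub_sub]
          exact hx'.le
      have hind : Integrable (E'.indicator (1 : Ω n → ℝ)) (μ n) :=
        (integrable_const (1 : ℝ)).indicator hE'
      have hint : Integrable (fun x => ε / 4 + E'.indicator (1 : Ω n → ℝ) x) (μ n) :=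
        (integrable_const _).add hind
      calc ‖∫ x, bump w (U n x) - bump (w + c) (V n x) ∂(μ n)‖
          ≤ ∫ x, (ε / 4 + E'.indicator (1 : Ω n → ℝ) x) ∂(μ n) :=
            norm_integral_le_of_norm_le hint (ae_of_all _ hb)
        _ = ε / 4 + (μ n).real E' := by
            rw [integral_add (integrable_const _) hind,
              integral_indicator_one hE']
            simp
        _ < ε := by
            have : (μ n).real E' = (μ n E).toReal := by rw [Measure.real, measure_toMeasurable]
            rw [this]
            simp only [Function.comp] at hn2
            linarith
    have := tendsto_nhds_unique hdiff ((hUL (bump w)).sub (hVL (bump (w + c))))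
    linarith
  have iter : ∀ m : ℕ, ∫ y, bump 0 y ∂(L : Measure (Fin k → ℝ)) =
      ∫ y, bump (m • c) y ∂(L : Measure (Fin k → ℝ)) := by
    intro m
    induction m with
    | zero => simp
    | succ m ih => rw [ih, step, succ_nsmul]
  by_contra hc
  -- If `c ≠ 0`, the bumps with parameter `m • c` escape to infinity and their integrals vanish in
  -- the limit, while by iteration they all equal the positive integral of `bump 0`.
  have hlim : Tendsto (fun m : ℕ => ∫ y, bump (m • c) y ∂(L : Measure (Fin k → ℝ))) atTop
      (𝓝 (∫ _, (0 : ℝ) ∂(L : Measure (Fin k → ℝ)))) := by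
    refine tendsto_integral_of_dominated_convergence (fun _ => 1)
      (fun m => (bump (m • c)).continuous.aestronglyMeasurable) (integrable_const _)
      (fun m => ae_of_all _ fun y => ?_) (ae_of_all _ fun y => ?_)
    · rw [Real.norm_of_nonneg (bump_pos _ _).le]; exact bump_le_one _ _
    · simp only [bump_apply]
      refine tendsto_inv_atTop_zero.comp (tendsto_atTop_mono (f := fun m : ℕ =>
        (m : ℝ) * ‖c‖ + (-‖y‖)) (fun m => ?_) ?_)
      · have h1 : ‖m • c‖ = m * ‖c‖ := by rw [← Nat.cast_smul_eq_nsmul ℝ, norm_smul]; simp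
        have h2 := norm_sub_le (y + m • c) y
        rw [add_sub_cancel_left, h1] at h2
        linarith
      · exact tendsto_atTop_add_const_right _ _
          (tendsto_natCast_atTop_atTop.atTop_mul_const (norm_pos_iff.2 hc))
  simp_rw [← iter] at hlim
  have h0 := tendsto_nhds_unique hlim tendsto_const_nhds
  rw [integral_zero] at h0
  have hpos : 0 < ∫ y, bump (0 : Fin k → ℝ) y ∂(L : Measure (Fin k → ℝ)) := by
    rw [integral_pos_iff_support_of_nonneg (fun y => (bump_pos _ _).le)
      ((bump 0).integrable _)]
    have : Function.support (fun y => bump (0 : Fin k → ℝ) y) = Set.univ :=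
      Set.eq_univ_of_forall fun y => (bump_pos _ _).ne'
    rw [this]; simp
  linarith

end

/-! ### Local perturbations of the covariance matrix -/

section

variable {p k : ℕ} {C Δ : Matrix (Fin p) (Fin p) ℝ} {Cn : ℕ → Matrix (Fin p) (Fin p) ℝ}

/-- `covDist C` is a quadratic form in the difference of covariances, so a perturbation of order
`1/√n` leaves `n * covDist` bounded: the samples stay contiguous. -/
lemma tendsto_mul_covDist
    (hlim : Tendsto (fun n : ℕ => √(n : ℝ) • (Cn n - C)) atTop (𝓝 Δ)) :
    Tendsto (fun n : ℕ => (n : ℝ) * covDist C (Cn n)) atTop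
      (𝓝 (C⁻¹ * Δ * (C⁻¹ * Δ)).trace) := by
  have hc : Continuous fun X : Matrix (Fin p) (Fin p) ℝ => (C⁻¹ * X * (C⁻¹ * X)).trace := by
    fun_prop
  refine ((hc.tendsto Δ).comp hlim).congr fun n => ?_
  simp only [Function.comp, covDist, Matrix.mul_smul, Matrix.smul_mul, trace_smul, smul_eq_mul,
    ← mul_assoc, Real.mul_self_sqrt (Nat.cast_nonneg n)]

lemma tendsto_covDist
    (hlim : Tendsto (fun n : ℕ => √(n : ℝ) • (Cn n - C)) atTop (𝓝 Δ)) :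
    Tendsto (fun n : ℕ => covDist C (Cn n)) atTop (𝓝 0) := by
  have h := (tendsto_mul_covDist hlim).mul (tendsto_inv_atTop_nhds_zero_nat (𝕜 := ℝ))
  rw [mul_zero] at h
  refine h.congr' ?_
  filter_upwards [eventually_gt_atTop 0] with n hn
  have : (n : ℝ) ≠ 0 := by exact_mod_cast hn.ne'
  field_simp

/-- Contiguity: `o_P(1)` is inherited by samples with a nearby covariance matrix. -/
lemma IsLittleOP.of_covariance_tendsto (hC : C.PosDef) (hCn : ∀ᶠ n in atTop, (Cn n).PosSemidef)
    (hlim : Tendsto (fun n : ℕ => √(n : ℝ) • (Cn n - C)) atTop (𝓝 Δ))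
    {Y : ∀ n, (Fin n → Fin p → ℝ) → Fin k → ℝ} (hY : IsLittleOP (fun n => gaussSample n C) Y) :
    IsLittleOP (fun n => gaussSample n (Cn n)) Y := by
  intro ε hε
  set M := (C⁻¹ * Δ * (C⁻¹ * Δ)).trace + 1
  have h1 : ∀ᶠ n : ℕ in atTop, (n : ℝ) * covDist C (Cn n) < M :=
    (tendsto_mul_covDist hlim).eventually_lt_const (lt_add_one _)
  have h2 : ∀ᶠ n : ℕ in atTop, covDist C (Cn n) < 1 / 4 :=
    (tendsto_covDist hlim).eventually_lt_const (by norm_num)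
  have h3 : Tendsto (fun n => ENNReal.ofReal (Real.exp M) ^ (1 / 2 : ℝ) *
      gaussSample n C {x | ε ≤ ‖Y n x‖} ^ (1 / 2 : ℝ)) atTop (𝓝 0) := by
    have := ((ENNReal.continuous_rpow_const (y := 1 / 2)).tendsto 0).comp (hY ε hε)
    rw [ENNReal.zero_rpow_of_pos (by norm_num)] at this
    have := ENNReal.Tendsto.const_mul (a := ENNReal.ofReal (Real.exp M) ^ (1 / 2 : ℝ)) this
      (Or.inr (ENNReal.rpow_ne_top_of_nonneg (by norm_num) ENNReal.ofReal_ne_top))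
    rwa [mul_zero] at this
  refine tendsto_of_tendsto_of_tendsto_of_le_of_le' tendsto_const_nhds h3
    (Eventually.of_forall fun _ => zero_le) ?_
  filter_upwards [h1, h2, hCn] with n hn1 hn2 hn3
  refine (gaussSample_apply_le hC hn3 hn2.le n _).trans ?_
  gcongr

/-- If `Y_n` is asymptotically equivalent to a normalized sum of quadratic forms under `N(0, C)`,
then it shifts by `tr(A Δ) / 2` when `C` is perturbed by `Δ / √n`. -/
lemma exists_coupling_shift (hC : C.PosDef) (hCn : ∀ᶠ n in atTop, (Cn n).PosSemidef)
    (hlim : Tendsto (fun n : ℕ => √(n : ℝ) • (Cn n - C)) atTop (𝓝 Δ))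
    {A : Fin k → Matrix (Fin p) (Fin p) ℝ} (hA : ∀ m, (A m).IsSymm)
    {Y : ∀ n, (Fin n → Fin p → ℝ) → Fin k → ℝ}
    (hY : IsLittleOP (fun n => gaussSample n C) fun n x =>
      Y n x - (√(n : ℝ))⁻¹ • ∑ i, fun m => centeredQuad C (A m) (x i)) :
    ∃ W Z : ∀ n, (Fin n → Fin p → ℝ) → Fin n → Fin p → ℝ,
      (∀ᶠ n in atTop, MeasurePreserving (W n) (stdSample n (Fin p)) (gaussSample n C)) ∧
      (∀ᶠ n in atTop, MeasurePreserving (Z n) (stdSample n (Fin p)) (gaussSample n (Cn n))) ∧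
      IsLittleOP (fun n => stdSample n (Fin p)) fun n g =>
        Y n (Z n g) - Y n (W n g) - fun m => 1 / 2 * (A m * Δ).trace := by
  have hgood : ∀ᶠ n : ℕ in atTop, (Cn n).PosSemidef ∧ covDist C (Cn n) ≤ 1 / 4 :=
    hCn.and (((tendsto_covDist hlim).eventually_lt_const (by norm_num : (0 : ℝ) < 1 / 4)).mono
      fun n h => h.le)
  -- The coupling exists only once `Cn n` is positive semidefinite and near `C`. For the finitely
  -- many other `n` the identity maps serve as placeholders.
  have hex : ∀ n, ∃ WZ : ((Fin n → Fin p → ℝ) → Fin n → Fin p → ℝ) ×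
      ((Fin n → Fin p → ℝ) → Fin n → Fin p → ℝ),
      ((Cn n).PosSemidef ∧ covDist C (Cn n) ≤ 1 / 4) →
      MeasurePreserving WZ.1 (stdSample n (Fin p)) (gaussSample n C) ∧
      MeasurePreserving WZ.2 (stdSample n (Fin p)) (gaussSample n (Cn n)) ∧
      ∀ A : Matrix (Fin p) (Fin p) ℝ, A.IsSymm → ∀ ε : ℝ, 0 < ε →
        stdSample n (Fin p) {g | ε ≤ |(√(n : ℝ))⁻¹ * ∑ i, (centeredQuad C A (WZ.2 g i) -
          centeredQuad C A (WZ.1 g i)) - √(n : ℝ) * (1 / 2 * (A * (Cn n - C)).trace)|} ≤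
        ENNReal.ofReal (1 / 2 * covDist C (Cn n) * (A * C * (A * C)).trace / ε ^ 2) := by
    intro n
    by_cases h : (Cn n).PosSemidef ∧ covDist C (Cn n) ≤ 1 / 4
    · obtain ⟨W, Z, hWZ⟩ := exists_coupling hC h.1 h.2 n
      exact ⟨⟨W, Z⟩, fun _ => hWZ⟩
    · exact ⟨⟨id, id⟩, fun h' => absurd h' h⟩
  choose WZ hWZ using hex
  have hW : ∀ᶠ n in atTop, MeasurePreserving (WZ n).1 (stdSample n (Fin p)) (gaussSample n C) :=
    hgood.mono fun n hn => (hWZ n hn).1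
  have hZ : ∀ᶠ n in atTop, MeasurePreserving (WZ n).2 (stdSample n (Fin p))
      (gaussSample n (Cn n)) := hgood.mono fun n hn => (hWZ n hn).2.1
  refine ⟨fun n => (WZ n).1, fun n => (WZ n).2, hW, hZ, ?_⟩
  have hYW := hY.comp hW
  have hYZ := (hY.of_covariance_tendsto hC hCn hlim).comp hZ
  have hdiff : IsLittleOP (fun n => stdSample n (Fin p)) fun n g => fun m =>
      (√(n : ℝ))⁻¹ * ∑ i, (centeredQuad C (A m) ((WZ n).2 g i) -
        centeredQuad C (A m) ((WZ n).1 g i)) -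
        √(n : ℝ) * (1 / 2 * (A m * (Cn n - C)).trace) := by
    refine isLittleOP_of_forall_apply fun m ε hε => ?_
    have hb : Tendsto (fun n => ENNReal.ofReal (1 / 2 * covDist C (Cn n) *
        (A m * C * (A m * C)).trace / ε ^ 2)) atTop (𝓝 0) := by
      have := ENNReal.tendsto_ofReal ((((tendsto_covDist hlim).const_mul (1 / 2)).mul_const
        (A m * C * (A m * C)).trace).div_const (ε ^ 2))
      simpa using this
    refine tendsto_of_tendsto_of_tendsto_of_le_of_le' tendsto_const_nhds hb
      (Eventually.of_forall fun _ => zero_le) (hgood.mono fun n hn => ?_)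
    exact (hWZ n hn).2.2 (A m) (hA m) ε hε
  -- The deterministic part of the shift, `√n · ½ tr(A (Cn - C))`, converges to `½ tr(A Δ)`.
  have hdet : Tendsto (fun (n : ℕ) m => √(n : ℝ) * (1 / 2 * (A m * (Cn n - C)).trace) -
      1 / 2 * (A m * Δ).trace) atTop (𝓝 (0 : Fin k → ℝ)) := by
    rw [tendsto_pi_nhds]
    intro m
    have hc : Continuous fun X : Matrix (Fin p) (Fin p) ℝ => 1 / 2 * (A m * X).trace := by
      fun_prop
    have := ((hc.tendsto Δ).comp hlim).sub_const (1 / 2 * (A m * Δ).trace)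
    rw [sub_self] at this
    refine this.congr fun n => ?_
    simp only [Function.comp, Matrix.mul_smul, trace_smul, smul_eq_mul]
    ring
  refine (((hYZ.sub hYW).add hdiff).add (isLittleOP_of_tendsto hdet)).congr fun n =>
    ae_of_all _ fun g => ?_
  ext m
  simp only [Pi.sub_apply, Pi.add_apply, Pi.smul_apply, Finset.sum_apply, smul_eq_mul,
    Finset.sum_sub_distrib]
  ring

/-- If a statistic that is asymptotically a normalized sum of quadratic forms has, up to a shift by
`v`, the same limit law under `N(0, C)` and under the perturbed covariance matrices, then `v` is the
shift predicted by the quadratic forms. -/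
lemma half_trace_eq_of_same_limit (hC : C.PosDef) (hCn : ∀ᶠ n in atTop, (Cn n).PosSemidef)
    (hlim : Tendsto (fun n : ℕ => √(n : ℝ) • (Cn n - C)) atTop (𝓝 Δ))
    {A : Fin k → Matrix (Fin p) (Fin p) ℝ} (hA : ∀ m, (A m).IsSymm)
    {Y : ∀ n, (Fin n → Fin p → ℝ) → Fin k → ℝ} (hYm : ∀ n, Measurable (Y n))
    (hY : IsLittleOP (fun n => gaussSample n C) fun n x =>
      Y n x - (√(n : ℝ))⁻¹ • ∑ i, fun m => centeredQuad C (A m) (x i))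
    (L : ProbabilityMeasure (Fin k → ℝ)) (v : Fin k → ℝ)
    (h0 : ∀ f : BoundedContinuousFunction (Fin k → ℝ) ℝ,
      Tendsto (fun n => ∫ x, f (Y n x) ∂(gaussSample n C)) atTop
        (𝓝 (∫ y, f y ∂(L : Measure (Fin k → ℝ)))))
    (h1 : ∀ f : BoundedContinuousFunction (Fin k → ℝ) ℝ,
      Tendsto (fun n => ∫ x, f (Y n x - v) ∂(gaussSample n (Cn n))) atTop
        (𝓝 (∫ y, f y ∂(L : Measure (Fin k → ℝ))))) (m : Fin k) :
    1 / 2 * (A m * Δ).trace = v m := by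
  obtain ⟨W, Z, hW, hZ, hWZ⟩ := exists_coupling_shift hC hCn hlim hA hY
  have hs := shift_eq_zero (μ := fun n => stdSample n (Fin p)) (U := fun n g => Y n (Z n g) - v)
    (V := fun n g => Y n (W n g)) (c := (fun m => 1 / 2 * (A m * Δ).trace) - v)
    (hZ.mono fun n hn => (((hYm n).sub_const v).comp hn.measurable).aemeasurable)
    (hW.mono fun n hn => ((hYm n).comp hn.measurable).aemeasurable) L ?_ ?_ ?_
  · have := congrFun hs m
    simpa [sub_eq_zero] using this
  · intro f
    refine (h1 f).congr' (hZ.mono fun n hn => ?_)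
    rw [← hn.map_eq, integral_map hn.measurable.aemeasurable]
    exact (f.continuous.measurable.comp ((hYm n).sub_const v)).aestronglyMeasurable
  · intro f
    refine (h0 f).congr' (hW.mono fun n hn => ?_)
    rw [← hn.map_eq, integral_map hn.measurable.aemeasurable]
    exact (f.continuous.measurable.comp (hYm n)).aestronglyMeasurable
  · refine hWZ.congr fun n => ae_of_all _ fun g => ?_
    abel

lemma tendsto_perturbed_congruence (N : Matrix (Fin p) (Fin p) ℝ) :
    Tendsto (fun n : ℕ => √(n : ℝ) • ((1 + (√(n : ℝ))⁻¹ • N) * C * (1 + (√(n : ℝ))⁻¹ • N)ᵀ - C))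
      atTop (𝓝 (N * C + C * Nᵀ)) := by
  have h0 : Tendsto (fun n : ℕ => (√(n : ℝ))⁻¹) atTop (𝓝 0) :=
    tendsto_inv_atTop_zero.comp (Real.tendsto_sqrt_atTop.comp tendsto_natCast_atTop_atTop)
  have h1 : Tendsto (fun n : ℕ => N * C + C * Nᵀ + (√(n : ℝ))⁻¹ • (N * C * Nᵀ)) atTop
      (𝓝 (N * C + C * Nᵀ)) := by
    have := (h0.smul_const (N * C * Nᵀ)).const_add (N * C + C * Nᵀ)
    simpa using this
  refine h1.congr' ?_
  filter_upwards [eventually_gt_atTop 0] with n hn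
  have hs : (√(n : ℝ)) ≠ 0 := (Real.sqrt_pos.2 (by exact_mod_cast hn)).ne'
  rw [transpose_add, transpose_one, transpose_smul]
  simp only [Matrix.add_mul, Matrix.mul_add, Matrix.one_mul, Matrix.mul_one, Matrix.smul_mul,
    Matrix.mul_smul]
  have e : C + (√(n : ℝ))⁻¹ • (N * C) + (√(n : ℝ))⁻¹ • (C * Nᵀ +
      (√(n : ℝ))⁻¹ • (N * C * Nᵀ)) - C =
      (√(n : ℝ))⁻¹ • (N * C + C * Nᵀ + (√(n : ℝ))⁻¹ • (N * C * Nᵀ)) := by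
    simp only [smul_add]; abel
  rw [e, smul_smul, mul_inv_cancel₀ hs, one_smul]

lemma posSemidef_perturbed_congruence (hC : C.PosSemidef) (M : Matrix (Fin p) (Fin p) ℝ) :
    (M * C * Mᵀ).PosSemidef := by
  have := hC.mul_mul_conjTranspose_same M
  rwa [conjTranspose_eq_transpose_of_trivial] at this

/-- Normalized sums of centered quadratic forms are degenerate only if the forms vanish. -/
lemma eq_zero_of_isLittleOP_sum (hC : C.PosDef) {K : Fin k → Matrix (Fin p) (Fin p) ℝ}
    (hK : ∀ m, (K m).IsSymm)
    (h : IsLittleOP (fun n => gaussSample n C) fun n x =>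
      (√(n : ℝ))⁻¹ • ∑ i, fun m => centeredQuad C (K m) (x i)) (m : Fin k) : K m = 0 := by
  have hCs := PosSemidef.isSymm hC.posSemidef
  -- The zero statistic is equivalent to the normalized sum, so it shifts by `½ tr(K Δ)`; but zero
  -- does not shift. Perturbing `C` along `Δ = 2 C (K m) C` turns this into `tr(K C K C) = 0`, with
  -- no central limit theorem.
  obtain ⟨W, Z, hW, hZ, hWZ⟩ := exists_coupling_shift hC
    (Eventually.of_forall fun n => posSemidef_perturbed_congruence hC.posSemidef _)
    (tendsto_perturbed_congruence (C * K m)) hK (Y := fun _ _ => 0)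
    (h.neg.congr fun n => ae_of_all _ fun x => (zero_sub _).symm)
  have h0 := congrFun (IsLittleOP.eq_zero_of_const (c := -(fun m' => 1 / 2 * (K m' * (C * K m * C +
    C * (C * K m)ᵀ)).trace)) (hWZ.congr fun n => ae_of_all _ fun g => by
      simp)) m
  have h1 : (K m * C * (K m * C)).trace = 0 := by
    rw [transpose_mul, hCs, hK m] at h0
    have e : K m * (C * K m * C + C * (K m * C)) = (2 : ℝ) • (K m * C * (K m * C)) := by
      rw [two_smul]; simp only [Matrix.mul_add, Matrix.mul_assoc]
    simp only [Pi.neg_apply, e, trace_smul] at h0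
    simpa using h0
  obtain ⟨G, hG⟩ := exists_eq_mul_transpose hC.posSemidef
  have hdet : IsUnit G.det := by
    have h := hC.det_pos
    rw [hG, det_mul, det_transpose] at h
    exact isUnit_iff_ne_zero.2 fun h0 => by simp [h0] at h
  have hdetT : IsUnit Gᵀ.det := by rwa [det_transpose]
  have hH := isSymm_transpose_mul_mul (hK m) G
  rw [hG, ← trace_transpose_mul_mul_sq, trace_mul_self_of_isSymm hH] at h1
  -- In whitened coordinates `tr(K C K C)` is the sum of the squared entries of the symmetric matrix
  -- `GᵀKG`.
  have hz : Gᵀ * K m * G = 0 := by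
    ext i j
    have h2 := (Finset.sum_eq_zero_iff_of_nonneg fun i _ =>
      Finset.sum_nonneg fun j _ => sq_nonneg _).1 h1 i (Finset.mem_univ i)
    have h3 := (Finset.sum_eq_zero_iff_of_nonneg fun j _ => sq_nonneg _).1 h2 j
      (Finset.mem_univ j)
    simpa using h3
  calc K m = Gᵀ⁻¹ * Gᵀ * K m * (G * G⁻¹) := by
        rw [nonsing_inv_mul _ hdetT, mul_nonsing_inv _ hdet]; simp
    _ = Gᵀ⁻¹ * (Gᵀ * K m * G) * G⁻¹ := by simp only [Matrix.mul_assoc]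
    _ = 0 := by rw [hz]; simp

end

/-! ### Quantile functions -/

/-- Right continuity of the distribution function makes the infimum attained. -/
lemma quantile_le_iff (ν : Measure ℝ) {u : ℝ} (hu : u ∈ Set.Ioo (0 : ℝ) 1)
    (x : ℝ) : quantile ν u ≤ x ↔ u ≤ cdf ν x := by
  have hne : {y | u ≤ cdf ν y}.Nonempty :=
    ((tendsto_cdf_atTop ν).eventually (eventually_ge_nhds hu.2)).exists
  have hbdd : BddBelow {y | u ≤ cdf ν y} := by
    obtain ⟨a, ha⟩ := ((tendsto_cdf_atBot ν).eventually_lt_const hu.1).exists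
    exact ⟨a, fun y hy => le_of_lt ((monotone_cdf ν).reflect_lt (ha.trans_le hy))⟩
  constructor
  · intro h
    have hgt : ∀ y, x < y → u ≤ cdf ν y := fun y hy => by
      obtain ⟨z, hz, hzy⟩ := exists_lt_of_csInf_lt hne (h.trans_lt hy)
      exact le_trans hz (monotone_cdf ν hzy.le)
    have hc : Tendsto (cdf ν) (𝓝[>] x) (𝓝 (cdf ν x)) :=
      ((cdf ν).right_continuous x).mono Set.Ioi_subset_Ici_self
    exact ge_of_tendsto hc (eventually_nhdsWithin_of_forall fun y hy => hgt y hy)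
  · intro h
    exact csInf_le hbdd h

lemma measurable_quantile (ν : Measure ℝ) : Measurable (quantile ν) := by
  refine measurable_of_Iic fun x => ?_
  -- For `u ≤ 0` the infimum is over the whole line and for `u > 1` over the empty set, so
  -- `quantile` takes the default value `0`. At `u = 1` a single point is split off.
  have e : quantile ν ⁻¹' Set.Iic x = (Set.Ioo 0 1 ∩ Set.Iic (cdf ν x)) ∪
      (Set.Iic 0 ∩ {_u | (0 : ℝ) ≤ x}) ∪ (Set.Ioi 1 ∩ {_u | (0 : ℝ) ≤ x}) ∪
      ({1} ∩ {_u | quantile ν 1 ≤ x}) := by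
    ext u
    simp only [Set.mem_preimage, Set.mem_Iic, Set.mem_union, Set.mem_inter_iff, Set.mem_ofPred_eq,
      Set.mem_Ioi, Set.mem_singleton_iff]
    rcases le_or_gt u 0 with h0 | h0
    · have : quantile ν u = 0 := by
        have : {y | u ≤ cdf ν y} = Set.univ :=
          Set.eq_univ_of_forall fun y => h0.trans (cdf_nonneg ν y)
        rw [quantile, this, Real.sInf_univ]
      have h1 : ¬ (1 < u) := by linarith
      have h2 : u ≠ 1 := by linarith
      have h3 : u ∉ Set.Ioo (0 : ℝ) 1 := fun h => absurd h.1 (not_lt.2 h0)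
      simp [this, h0, h1, h2, h3]
    · rcases lt_trichotomy u 1 with h1 | h1 | h1
      · have h2 : u ≠ 1 := h1.ne
        have h3 : ¬ (1 < u) := by linarith
        have h4 : u ∈ Set.Ioo (0 : ℝ) 1 := ⟨h0, h1⟩
        simp [quantile_le_iff ν h4 x, h2, h3, h4, not_le.2 h0]
      · subst h1; simp
      · have : quantile ν u = 0 := by
          have : {y | u ≤ cdf ν y} = ∅ :=
            Set.eq_empty_of_forall_notMem fun y hy => by
              have := cdf_le_one ν y
              simp only [Set.mem_ofPred_eq] at hy
              linarith
          rw [quantile, this, Real.sInf_empty]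
        have h2 : u ≠ 1 := h1.ne'
        have h3 : u ∉ Set.Ioo (0 : ℝ) 1 := fun h => absurd h.2 (not_lt.2 h1.le)
        simp [this, h1, h2, h3, not_le.2 h0]
  rw [e]
  exact (((measurableSet_Ioo.inter measurableSet_Iic).union
    (measurableSet_Iic.inter (MeasurableSet.const _))).union
    (measurableSet_Ioi.inter (MeasurableSet.const _))).union
    ((measurableSet_singleton _).inter (MeasurableSet.const _))

/-- Without atoms the distribution function is also left continuous, so it cannot jump over `u`. -/
lemma cdf_quantile (ν : Measure ℝ) [IsProbabilityMeasure ν] [NullSingletonClass ν] {u : ℝ}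
    (hu : u ∈ Set.Ioo (0 : ℝ) 1) : cdf ν (quantile ν u) = u := by
  set q := quantile ν u with hq
  refine le_antisymm ?_ ((quantile_le_iff ν hu q).1 le_rfl)
  have h0 : Function.leftLim (cdf ν) q = cdf ν q := by
    have h1 := (cdf ν).measure_singleton q
    rw [measure_cdf, measure_singleton] at h1
    have h2 := ENNReal.ofReal_eq_zero.1 h1.symm
    exact le_antisymm ((monotone_cdf ν).leftLim_le le_rfl) (by linarith)
  rw [← h0]
  have ht := (monotone_cdf ν).tendsto_leftLim q
  refine le_of_tendsto ht (eventually_nhdsWithin_of_forall fun y hy => ?_)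
  by_contra hcon
  exact absurd ((quantile_le_iff ν hu y).2 (not_le.1 hcon).le) (not_le.2 hy)

lemma strictMonoOn_quantile (ν : Measure ℝ) [IsProbabilityMeasure ν] [NullSingletonClass ν] :
    StrictMonoOn (quantile ν) (Set.Ioo 0 1) := by
  intro u hu v hv huv
  by_contra h
  have := monotone_cdf ν (not_lt.1 h)
  rw [cdf_quantile ν hu, cdf_quantile ν hv] at this
  linarith

/-! ### The standard normal distribution function -/

/-- The standard normal distribution function. -/
abbrev stdCdf : ℝ → ℝ := fun x => cdf (gaussianReal 0 1) x

lemma integrable_stdPdf : Integrable stdPdf := integrable_gaussianPDFReal 0 1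

lemma stdCdf_eq_setIntegral (x : ℝ) : stdCdf x = ∫ y in Set.Iic x, stdPdf y := by
  rw [stdCdf, cdf_eq_real, Measure.real, gaussianReal_apply_eq_integral 0 one_ne_zero,
    ENNReal.toReal_ofReal]
  exact integral_nonneg fun y => (stdPdf_pos y).le

lemma hasDerivAt_setIntegral_Iic {f : ℝ → ℝ} (hf : Continuous f) (hi : Integrable f) (x : ℝ) :
    HasDerivAt (fun x => ∫ y in Set.Iic x, f y) (f x) x := by
  have e : (fun x => ∫ y in Set.Iic x, f y) =
      fun x => (∫ y in Set.Iic (0 : ℝ), f y) + ∫ y in (0 : ℝ)..x, f y := by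
    ext x
    rw [← intervalIntegral.integral_Iic_sub_Iic hi.integrableOn hi.integrableOn]
    ring
  rw [e]
  exact (hf.integral_hasStrictDerivAt 0 x).hasDerivAt.const_add _

lemma hasDerivAt_stdCdf (x : ℝ) : HasDerivAt stdCdf (stdPdf x) x := by
  have e : stdCdf = fun x => ∫ y in Set.Iic x, stdPdf y := funext stdCdf_eq_setIntegral
  rw [e]
  exact hasDerivAt_setIntegral_Iic continuous_stdPdf integrable_stdPdf x

lemma continuous_stdCdf : Continuous stdCdf :=
  continuous_iff_continuousAt.2 fun x => (hasDerivAt_stdCdf x).continuousAt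

lemma strictMono_stdCdf : StrictMono stdCdf :=
  strictMono_of_deriv_pos fun x => by
    rw [(hasDerivAt_stdCdf x).deriv]; exact stdPdf_pos x

lemma stdCdf_mem_Ioo (x : ℝ) : stdCdf x ∈ Set.Ioo (0 : ℝ) 1 :=
  ⟨(cdf_nonneg _ (x - 1)).trans_lt (strictMono_stdCdf (by linarith)),
    (strictMono_stdCdf (by linarith : x < x + 1)).trans_le (cdf_le_one _ _)⟩

lemma quantile_stdCdf (z : ℝ) : quantile (gaussianReal 0 1) (stdCdf z) = z := by
  have h : ∀ x, quantile (gaussianReal 0 1) (stdCdf z) ≤ x ↔ z ≤ x := fun x =>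
    (quantile_le_iff _ (stdCdf_mem_Ioo z) x).trans strictMono_stdCdf.le_iff_le
  exact le_antisymm ((h z).2 le_rfl) ((h _).1 le_rfl)

instance nullSingletonClass_gaussianReal_zero_one : NullSingletonClass (gaussianReal 0 1) :=
  nullSingletonClass_gaussianReal one_ne_zero

lemma stdCdf_quantile {u : ℝ} (hu : u ∈ Set.Ioo (0 : ℝ) 1) :
    stdCdf (quantile (gaussianReal 0 1) u) = u := cdf_quantile _ hu

lemma hasDerivAt_quantile {u : ℝ} (hu : u ∈ Set.Ioo (0 : ℝ) 1) :
    HasDerivAt (quantile (gaussianReal 0 1)) (stdPdf (quantile (gaussianReal 0 1) u))⁻¹ u := by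
  have himg : quantile (gaussianReal 0 1) '' Set.Ioo 0 1 = Set.univ :=
    Set.eq_univ_of_forall fun z => ⟨stdCdf z, stdCdf_mem_Ioo z, quantile_stdCdf z⟩
  have hc : ContinuousAt (quantile (gaussianReal 0 1)) u :=
    (strictMonoOn_quantile _).continuousAt_of_image_mem_nhds (isOpen_Ioo.mem_nhds hu)
      (by rw [himg]; exact univ_mem)
  refine HasDerivAt.of_local_left_inverse hc (hasDerivAt_stdCdf _) (stdPdf_pos _).ne' ?_
  filter_upwards [isOpen_Ioo.mem_nhds hu] with v hv using stdCdf_quantile hv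

/-- The probability integral transform, used to translate `L₂⁰[0, 1]` into centered functions in
`L₂` of the standard normal law. -/
lemma map_stdCdf : (gaussianReal 0 1).map stdCdf = volume.restrict (Set.Icc 0 1) := by
  have hp : IsProbabilityMeasure ((gaussianReal 0 1).map stdCdf) :=
    Measure.isProbabilityMeasure_map continuous_stdCdf.measurable.aemeasurable
  refine Measure.ext_of_Iic _ _ fun u => ?_
  rw [Measure.map_apply continuous_stdCdf.measurable measurableSet_Iic,
    Measure.restrict_apply measurableSet_Iic]
  rcases le_or_gt u 0 with h0 | h0
  · have e1 : stdCdf ⁻¹' Set.Iic u = ∅ := Set.eq_empty_of_forall_notMem fun x hx =>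
      absurd ((stdCdf_mem_Ioo x).1.trans_le hx) (not_lt.2 h0)
    have e2 : Set.Iic u ∩ Set.Icc 0 1 ⊆ {(0 : ℝ)} := fun x hx =>
      le_antisymm (le_trans hx.1 h0) hx.2.1
    rw [e1, measure_empty, measure_mono_null e2 (by simp)]
  · rcases lt_or_ge u 1 with h1 | h1
    · have hu : u ∈ Set.Ioo (0 : ℝ) 1 := ⟨h0, h1⟩
      have e1 : stdCdf ⁻¹' Set.Iic u = Set.Iic (quantile (gaussianReal 0 1) u) := by
        ext x
        rw [Set.mem_preimage, Set.mem_Iic, Set.mem_Iic]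
        conv_lhs => rw [← stdCdf_quantile hu]
        exact strictMono_stdCdf.le_iff_le
      have e2 : Set.Iic u ∩ Set.Icc 0 1 = Set.Icc 0 u := by
        ext x; simp only [Set.mem_inter_iff, Set.mem_Iic, Set.mem_Icc]
        exact ⟨fun h => ⟨h.2.1, h.1⟩, fun h => ⟨h.2, h.1, h.2.trans h1.le⟩⟩
      rw [e1, e2, Real.volume_Icc, ← ofReal_cdf]
      congr 1
      rw [sub_zero]
      exact stdCdf_quantile hu
    · have e1 : stdCdf ⁻¹' Set.Iic u = Set.univ := Set.eq_univ_of_forall fun x =>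
        (stdCdf_mem_Ioo x).2.le.trans h1
      have e2 : Set.Iic u ∩ Set.Icc 0 1 = Set.Icc 0 1 :=
        Set.inter_eq_right.2 fun x hx => hx.2.trans h1
      rw [e1, e2]; simp

/-! ### Transfer of the model to the Gaussian scale -/

section

variable {p k : ℕ}

lemma measurable_gaussianize : Measurable (gaussianize (p := p)) :=
  measurable_pi_lambda _ fun j => (measurable_quantile _).comp (measurable_pi_apply j)

/-- The coordinatewise standard normal distribution function. -/
def uniformize (z : Fin p → ℝ) : Fin p → ℝ := fun j => stdCdf (z j)

lemma measurable_uniformize : Measurable (uniformize (p := p)) :=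
  measurable_pi_lambda _ fun j => continuous_stdCdf.measurable.comp (measurable_pi_apply j)

lemma gaussianize_uniformize (z : Fin p → ℝ) : gaussianize (uniformize z) = z :=
  funext fun j => quantile_stdCdf (z j)

lemma copulaLaw_eq_map (C : Matrix (Fin p) (Fin p) ℝ) :
    copulaLaw C = (gaussVec C).map uniformize := by
  rw [gaussVec, Measure.map_map measurable_uniformize (by fun_prop)]
  rfl

lemma measurePreserving_uniformize (C : Matrix (Fin p) (Fin p) ℝ) :
    MeasurePreserving uniformize (gaussVec C) (copulaLaw C) :=
  ⟨measurable_uniformize, (copulaLaw_eq_map C).symm⟩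

/-- The observation with Gaussian scores `z` and margins `F`. -/
def observation (F : Fin p → Measure ℝ) (z : Fin p → ℝ) : Fin p → ℝ :=
  fun j => quantile (F j) (stdCdf (z j))

lemma measurable_observation (F : Fin p → Measure ℝ) : Measurable (observation F) :=
  measurable_pi_lambda _ fun j => ((measurable_quantile (F j)).comp
    continuous_stdCdf.measurable).comp (measurable_pi_apply j)

lemma measurePreserving_observation (C : Matrix (Fin p) (Fin p) ℝ) (F : Fin p → Measure ℝ) :
    MeasurePreserving (observation F) (gaussVec C) (modelLaw C F) := by
  refine ⟨measurable_observation F, ?_⟩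
  have hq : Measurable fun (u : Fin p → ℝ) j => quantile (F j) (u j) :=
    measurable_pi_lambda _ fun j => (measurable_quantile (F j)).comp (measurable_pi_apply j)
  rw [modelLaw, copulaLaw_eq_map, Measure.map_map hq measurable_uniformize]
  rfl

instance (C : Matrix (Fin p) (Fin p) ℝ) (F : Fin p → Measure ℝ) :
    IsProbabilityMeasure (modelLaw C F) := by
  rw [← (measurePreserving_observation C F).map_eq]
  exact Measure.isProbabilityMeasure_map (measurable_observation F).aemeasurable

lemma measurePreserving_sample (n : ℕ) (C : Matrix (Fin p) (Fin p) ℝ) (F : Fin p → Measure ℝ) :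
    MeasurePreserving (fun (x : Fin n → Fin p → ℝ) i => observation F (x i))
      (gaussSample n C) (sampleLaw n C F) :=
  measurePreserving_pi _ _ fun _ => measurePreserving_observation C F

variable {F : Fin p → Measure ℝ}

lemma ranks_eq_of_le_iff {n : ℕ} {x y : Fin n → Fin p → ℝ}
    (h : ∀ i l j, x l j ≤ x i j ↔ y l j ≤ y i j) : ranks x = ranks y := by
  ext i j
  simp only [ranks, h]

lemma measurable_ranks {n : ℕ} : Measurable (ranks (n := n) (p := p)) := by
  refine measurable_pi_lambda _ fun i => measurable_pi_lambda _ fun j => ?_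
  simp only [ranks, Finset.card_filter]
  refine Finset.measurable_sum _ fun l _ => ?_
  refine Measurable.ite (measurableSet_le ?_ ?_) measurable_const measurable_const <;> fun_prop

/-- Rank vectors live in a countable discrete space, so every function of them is measurable. -/
lemma IsRankBased.measurable {est : ∀ n, (Fin n → Fin p → ℝ) → Fin k → ℝ} (h : IsRankBased est)
    (n : ℕ) : Measurable (est n) := by
  obtain ⟨t, ht⟩ := h
  have : est n = t n ∘ ranks := funext (ht n)
  rw [this]
  exact Measurable.of_discrete.comp measurable_ranks

lemma IsRankBased.eq_of_le_iff {est : ∀ n, (Fin n → Fin p → ℝ) → Fin k → ℝ} (h : IsRankBased est)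
    {n : ℕ} {x y : Fin n → Fin p → ℝ} (hxy : ∀ i l j, x l j ≤ x i j ↔ y l j ≤ y i j) :
    est n x = est n y := by
  obtain ⟨t, ht⟩ := h
  rw [ht, ht, ranks_eq_of_le_iff hxy]

lemma nullSingletonClass_of_absolutelyContinuous (hFac : ∀ j, F j ≪ volume) (j : Fin p) :
    NullSingletonClass (F j) :=
  ⟨fun x => hFac j (measure_singleton x)⟩

lemma toUniform_observation (hF : ∀ j, IsProbabilityMeasure (F j)) (hFac : ∀ j, F j ≪ volume)
    (z : Fin p → ℝ) : toUniform F (observation F z) = uniformize z := by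
  ext j
  have := hF j
  have := nullSingletonClass_of_absolutelyContinuous hFac j
  exact cdf_quantile (F j) (stdCdf_mem_Ioo (z j))

/-- Each coordinate map `F_j⁻¹ ∘ Φ` is strictly increasing, since `F_j` has no atoms, and hence
preserves ranks. The estimator may thus be evaluated on the Gaussian scores themselves. -/
lemma IsRankBased.apply_observation (hF : ∀ j, IsProbabilityMeasure (F j))
    (hFac : ∀ j, F j ≪ volume) {est : ∀ n, (Fin n → Fin p → ℝ) → Fin k → ℝ}
    (h : IsRankBased est) {n : ℕ} (x : Fin n → Fin p → ℝ) :
    est n (fun i => observation F (x i)) = est n x := by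
  refine h.eq_of_le_iff fun i l j => ?_
  have := hF j
  have := nullSingletonClass_of_absolutelyContinuous hFac j
  exact ((strictMonoOn_quantile (F j)).le_iff_le (stdCdf_mem_Ioo _) (stdCdf_mem_Ioo _)).trans
    strictMono_stdCdf.le_iff_le

end

/-! ### Regular, asymptotically linear, rank-based estimators -/

section

variable {p k : ℕ}

lemma integral_quadraticForm_copulaLaw {C A : Matrix (Fin p) (Fin p) ℝ} (hC : C.PosSemidef)
    (hA : A.IsSymm) :
    ∫ v, gaussianize v ⬝ᵥ (A *ᵥ gaussianize v) ∂(copulaLaw C) = (A * C).trace := by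
  have hm : Measurable fun v : Fin p → ℝ => gaussianize v ⬝ᵥ (A *ᵥ gaussianize v) :=
    (continuous_quadraticForm A).measurable.comp measurable_gaussianize
  rw [copulaLaw_eq_map, integral_map measurable_uniformize.aemeasurable hm.aestronglyMeasurable]
  simp_rw [gaussianize_uniformize]
  exact (quadraticForm_gaussVec hC hA).2.1

lemma quadInfluence_eq_centeredQuad {C A : Matrix (Fin p) (Fin p) ℝ} (hC : C.PosSemidef)
    (hA : A.IsSymm) (u : Fin p → ℝ) : quadInfluence C A u = centeredQuad C A (gaussianize u) := by
  rw [quadInfluence, integral_quadraticForm_copulaLaw hC hA, centeredQuad]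

lemma quadInfluence_uniformize {C A : Matrix (Fin p) (Fin p) ℝ} (hC : C.PosSemidef)
    (hA : A.IsSymm) (z : Fin p → ℝ) : quadInfluence C A (uniformize z) = centeredQuad C A z := by
  rw [quadInfluence_eq_centeredQuad hC hA, gaussianize_uniformize]

lemma localMargin_zero (ν : Measure ℝ) [IsProbabilityMeasure ν] (η : ℝ) :
    localMargin ν 0 η = ν := by
  have : (2 : ℝ) / (1 + 1) = 1 := by norm_num
  simp [localMargin, this]

lemma zero_mem_L2Zero : (0 : ℝ → ℝ) ∈ L2Zero := ⟨MemLp.zero, by simp⟩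

variable {R : (Fin k → ℝ) → Matrix (Fin p) (Fin p) ℝ} {θ : Fin k → ℝ} {F : Fin p → Measure ℝ}
  {est : ∀ n, (Fin n → Fin p → ℝ) → Fin k → ℝ}

lemma IsAsymptoticallyLinearAt.isLittleOP_gaussSample (hF : ∀ j, IsProbabilityMeasure (F j))
    (hFac : ∀ j, F j ≪ volume) (hrank : IsRankBased est) {ψ : (Fin p → ℝ) → Fin k → ℝ}
    (h : IsAsymptoticallyLinearAt R est θ F ψ) :
    IsLittleOP (fun n => gaussSample n (R θ)) fun n x =>
      √(n : ℝ) • (est n x - θ) - (√(n : ℝ))⁻¹ • ∑ i, ψ (uniformize (x i)) := by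
  refine (IsLittleOP.comp h (Eventually.of_forall fun n =>
    measurePreserving_sample n (R θ) F)).congr fun n => ae_of_all _ fun x => ?_
  simp only [toUniform_observation hF hFac, hrank.apply_observation hF hFac]

lemma IsAsymptoticallyLinearAt.isLittleOP_centeredQuad (hF : ∀ j, IsProbabilityMeasure (F j))
    (hFac : ∀ j, F j ≪ volume) (hrank : IsRankBased est) (hC : (R θ).PosSemidef)
    {A : Fin k → Matrix (Fin p) (Fin p) ℝ} (hA : ∀ m, (A m).IsSymm)
    {ψ : (Fin p → ℝ) → Fin k → ℝ}
    (hψ : ∀ m, (fun u => ψ u m) =ᵐ[copulaLaw (R θ)] quadInfluence (R θ) (A m))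
    (h : IsAsymptoticallyLinearAt R est θ F ψ) :
    IsLittleOP (fun n => gaussSample n (R θ)) fun n x => √(n : ℝ) • (est n x - θ) -
      (√(n : ℝ))⁻¹ • ∑ i, fun m => centeredQuad (R θ) (A m) (x i) := by
  refine (h.isLittleOP_gaussSample hF hFac hrank).congr fun n => ?_
  have h1 : ∀ᵐ z ∂(gaussVec (R θ)), ψ (uniformize z) = fun m => centeredQuad (R θ) (A m) z := by
    have h2 : ∀ᵐ u ∂(copulaLaw (R θ)), ∀ m, ψ u m = quadInfluence (R θ) (A m) u :=
      ae_all_iff.2 hψ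
    filter_upwards [(measurePreserving_uniformize (R θ)).quasiMeasurePreserving.ae h2] with z hz
    ext m
    rw [hz m, quadInfluence_uniformize hC (hA m)]
  have h3 : ∀ᵐ x ∂(gaussSample n (R θ)), ∀ i, ψ (uniformize (x i)) =
      fun m => centeredQuad (R θ) (A m) (x i) :=
    ae_all_iff.2 fun i => (measurePreserving_eval (fun _ : Fin n => gaussVec (R θ))
      i).quasiMeasurePreserving.ae h1
  filter_upwards [h3] with x hx
  simp only [hx]

lemma tendsto_inv_sqrt_natCast : Tendsto (fun n : ℕ => (√(n : ℝ))⁻¹) atTop (𝓝[≠] 0) := by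
  refine tendsto_nhdsWithin_iff.2 ⟨tendsto_inv_atTop_zero.comp
    (Real.tendsto_sqrt_atTop.comp tendsto_natCast_atTop_atTop), ?_⟩
  filter_upwards [eventually_gt_atTop 0] with n hn
  exact inv_ne_zero (Real.sqrt_pos.2 (by exact_mod_cast hn)).ne'

lemma IsRankBased.measurable_smul_sub (hrank : IsRankBased est) (n : ℕ) (a : ℝ)
    (t : Fin k → ℝ) : Measurable fun x => a • (est n x - t) := by
  have := hrank.measurable n
  fun_prop

/-- Take the local paths with fixed margins, that is `h = 0`, and pass to Gaussian scores; centering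
at `θ + α/√n` becomes subtraction of `α` after scaling by `√n`. -/
lemma IsRegularAt.exists_limit (hF : ∀ j, IsProbabilityMeasure (F j))
    (hFac : ∀ j, F j ≪ volume) (hrank : IsRankBased est) (hreg : IsRegularAt R est θ F) :
    ∃ L : ProbabilityMeasure (Fin k → ℝ), ∀ (α : Fin k → ℝ)
      (f : BoundedContinuousFunction (Fin k → ℝ) ℝ),
      Tendsto (fun n : ℕ => ∫ x, f (√(n : ℝ) • (est n x - θ) - α)
          ∂(gaussSample n (R (θ + (√(n : ℝ))⁻¹ • α))))
        atTop (𝓝 (∫ y, f y ∂(L : Measure (Fin k → ℝ)))) := by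
  obtain ⟨L, hL⟩ := hreg
  refine ⟨L, fun α f => (hL α (fun _ => 0) (fun _ => zero_mem_L2Zero) f).congr' ?_⟩
  filter_upwards [eventually_gt_atTop 0] with n hn
  have hs : √(n : ℝ) ≠ 0 := (Real.sqrt_pos.2 (by exact_mod_cast hn)).ne'
  have hm : (fun j => localMargin (F j) ((fun _ => 0 : Fin p → ℝ → ℝ) j) (√(n : ℝ))⁻¹) = F := by
    ext1 j
    have := hF j
    exact localMargin_zero (F j) _
  have hmp := measurePreserving_sample n (R (θ + (√(n : ℝ))⁻¹ • α)) F
  have hmeas : Measurable fun x => f (√(n : ℝ) • (est n x - (θ + (√(n : ℝ))⁻¹ • α))) :=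
    f.continuous.measurable.comp (hrank.measurable_smul_sub n _ _)
  rw [hm, ← hmp.map_eq, integral_map hmp.measurable.aemeasurable hmeas.aestronglyMeasurable]
  refine integral_congr_ae (ae_of_all _ fun x => ?_)
  simp only [hrank.apply_observation hF hFac]
  congr 1
  rw [← sub_sub, smul_sub, smul_smul, mul_inv_cancel₀ hs, one_smul]

lemma gaussVec_congruence {C : Matrix (Fin p) (Fin p) ℝ} (hC : C.PosSemidef)
    (M : Matrix (Fin p) (Fin p) ℝ) :
    MeasurePreserving (fun z => M *ᵥ z) (gaussVec C) (gaussVec (M * C * Mᵀ)) := by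
  obtain ⟨G, hG⟩ := exists_eq_mul_transpose hC
  have h1 := measurePreserving_mulVec_gaussVec hG
  have h2 : MeasurePreserving (fun x => (M * G) *ᵥ x) (stdVec (Fin p)) (gaussVec (M * C * Mᵀ)) :=
    measurePreserving_mulVec_gaussVec (by
      rw [hG, transpose_mul]; simp only [Matrix.mul_assoc])
  refine ⟨measurable_mulVec_left M, ?_⟩
  rw [← h1.map_eq, Measure.map_map (measurable_mulVec_left _) (measurable_mulVec_left _),
    ← h2.map_eq]
  congr 1
  ext1 x
  simp [mulVec_mulVec]

/-- The influence function of a rank-based estimator is orthogonal to changes of scale of the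
margins. -/
lemma IsRankBased.diag_mul_eq_zero (hF : ∀ j, IsProbabilityMeasure (F j))
    (hFac : ∀ j, F j ≪ volume) (hrank : IsRankBased est) (hC : (R θ).PosDef)
    (hreg : IsRegularAt R est θ F) {A : Fin k → Matrix (Fin p) (Fin p) ℝ}
    (hA : ∀ m, (A m).IsSymm)
    (hlin : IsAsymptoticallyLinearAt R est θ F fun u m => quadInfluence (R θ) (A m) u)
    (m : Fin k) (j : Fin p) : (A m * R θ) j j = 0 := by
  obtain ⟨L, hL⟩ := hreg.exists_limit hF hFac hrank
  have hY := hlin.isLittleOP_centeredQuad hF hFac hrank hC.posSemidef hA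
    (fun m => EventuallyEq.rfl)
  have hYm : ∀ n : ℕ, Measurable fun x => √(n : ℝ) • (est n x - θ) := fun n =>
    hrank.measurable_smul_sub n _ _
  set d : Fin p → ℝ := Pi.single j 1 with hd
  have h0 : ∀ f : BoundedContinuousFunction (Fin k → ℝ) ℝ,
      Tendsto (fun n => ∫ x, f (√(n : ℝ) • (est n x - θ)) ∂(gaussSample n (R θ))) atTop
        (𝓝 (∫ y, f y ∂(L : Measure (Fin k → ℝ)))) := fun f => by simpa using hL 0 f
  -- Multiply coordinate `j` by `1 + 1/√n`. Ranks do not change, so the limit law is unshifted (`v =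
  -- 0`), while the quadratic forms predict a shift `½ tr(A (DC + CD)) = (A C)_{jj}`.
  have key := half_trace_eq_of_same_limit hC
    (Eventually.of_forall fun n => posSemidef_perturbed_congruence hC.posSemidef _)
    (tendsto_perturbed_congruence (diagonal d)) hA hYm hY L 0 h0 (fun f => ?_) m
  · rw [diagonal_transpose, Matrix.mul_add, trace_add, ← Matrix.mul_assoc (A m) (R θ),
      ← Matrix.mul_assoc (A m) (diagonal d)] at key
    have e1 : (A m * diagonal d * R θ).trace = (A m * R θ * diagonal d).trace := by
      rw [← trace_transpose, transpose_mul, transpose_mul, diagonal_transpose, hA m,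
        PosSemidef.isSymm hC.posSemidef, trace_mul_comm, Matrix.mul_assoc, trace_mul_comm]
    have e2 : (A m * R θ * diagonal d).trace = (A m * R θ) j j := by
      simp [trace, mul_diagonal, hd, Pi.single_apply]
    rw [e1, e2] at key
    simp only [Pi.zero_apply] at key
    linarith
  · refine (h0 f).congr fun n => ?_
    set M : Matrix (Fin p) (Fin p) ℝ := 1 + (√(n : ℝ))⁻¹ • diagonal d with hM
    have hmp : MeasurePreserving (fun (x : Fin n → Fin p → ℝ) i => M *ᵥ x i)
        (gaussSample n (R θ)) (gaussSample n (M * R θ * Mᵀ)) :=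
      measurePreserving_pi _ _ fun _ => gaussVec_congruence hC.posSemidef M
    have hmeas : Measurable fun x => f (√(n : ℝ) • (est n x - θ) - 0) :=
      f.continuous.measurable.comp ((hYm n).sub_const 0)
    rw [← hmp.map_eq, integral_map hmp.measurable.aemeasurable hmeas.aestronglyMeasurable]
    refine integral_congr_ae (ae_of_all _ fun x => ?_)
    have hMx : ∀ (y : Fin p → ℝ) l, (M *ᵥ y) l = (1 + (√(n : ℝ))⁻¹ * d l) * y l := fun y l => by
      rw [hM, add_mulVec, one_mulVec, smul_mulVec, Pi.add_apply, Pi.smul_apply, mulVec_diagonal,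
        smul_eq_mul]
      ring
    have hpos : ∀ l, 0 < 1 + (√(n : ℝ))⁻¹ * d l := fun l => by
      have : 0 ≤ d l := by
        rw [hd, Pi.single_apply]; split_ifs <;> norm_num
      positivity
    have : est n (fun i => M *ᵥ x i) = est n x := hrank.eq_of_le_iff fun i l j' => by
      rw [hMx, hMx, mul_le_mul_iff_right₀ (hpos j')]
    simp only [this, sub_zero]

/-- The influence function of a regular estimator has unit inner products with the scores. -/
lemma IsRegularAt.half_trace_mul_partialR {Θ : Set (Fin k → ℝ)}
    (hR : IsCopulaParametrization Θ R) (hθ : θ ∈ Θ) (hF : ∀ j, IsProbabilityMeasure (F j))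
    (hFac : ∀ j, F j ≪ volume) (hrank : IsRankBased est)
    (hreg : IsRegularAt R est θ F) {A : Fin k → Matrix (Fin p) (Fin p) ℝ}
    (hA : ∀ m, (A m).IsSymm)
    (hlin : IsAsymptoticallyLinearAt R est θ F fun u m => quadInfluence (R θ) (A m) u)
    (m m' : Fin k) : 1 / 2 * (A m * partialR R θ m').trace = (1 : Matrix (Fin k) (Fin k) ℝ) m m' := by
  have hC := hR.posDef θ hθ
  obtain ⟨L, hL⟩ := hreg.exists_limit hF hFac hrank
  have hY := hlin.isLittleOP_centeredQuad hF hFac hrank hC.posSemidef hA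
    (fun m => EventuallyEq.rfl)
  have hYm : ∀ n : ℕ, Measurable fun x => √(n : ℝ) • (est n x - θ) := fun n =>
    hrank.measurable_smul_sub n _ _
  set α : Fin k → ℝ := Pi.single m' 1 with hα
  have h0 : ∀ f : BoundedContinuousFunction (Fin k → ℝ) ℝ,
      Tendsto (fun n => ∫ x, f (√(n : ℝ) • (est n x - θ)) ∂(gaussSample n (R θ))) atTop
        (𝓝 (∫ y, f y ∂(L : Measure (Fin k → ℝ)))) := fun f => by simpa using hL 0 f
  have hθn : Tendsto (fun n : ℕ => θ + (√(n : ℝ))⁻¹ • α) atTop (𝓝 θ) := by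
    have := ((tendsto_nhds_of_tendsto_nhdsWithin tendsto_inv_sqrt_natCast).smul_const α).const_add θ
    simpa using this
  have hPSD : ∀ᶠ n : ℕ in atTop, (R (θ + (√(n : ℝ))⁻¹ • α)).PosSemidef :=
    (hθn.eventually (hR.isOpen.mem_nhds hθ)).mono fun n hn => (hR.posDef _ hn).posSemidef
  have hlim : Tendsto (fun n : ℕ => √(n : ℝ) • (R (θ + (√(n : ℝ))⁻¹ • α) - R θ)) atTop
      (𝓝 (partialR R θ m')) := by
    refine tendsto_pi_nhds.2 fun i => tendsto_pi_nhds.2 fun j => ?_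
    have h := (hR.lineDifferentiableAt θ hθ m' i j).hasLineDerivAt
    have h' := (HasDerivAt.tendsto_slope_zero h).comp tendsto_inv_sqrt_natCast
    refine h'.congr fun n => ?_
    simp [hα]
  -- Moving `θ` in direction `e_{m'}` perturbs `C` by `Ṙ_{m'}/√n`, and regularity says that the
  -- estimator follows by exactly `e_{m'}`.
  have key := half_trace_eq_of_same_limit hC hPSD hlim hA hYm hY L α h0 (hL α) m
  rw [key, hα, Pi.single_apply, one_apply]

end

/-! ### Partial means of functions on the line -/

/-- The partial integral of a square-integrable centered function has moments of all orders. -/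
lemma integral_pow_mul_setIntegral_Iic {f : ℝ → ℝ} (hf : MemLp f 2 (gaussianReal 0 1))
    (hf0 : ∫ x, f x ∂(gaussianReal 0 1) = 0) (r : ℕ) :
    Integrable (fun s : ℝ => s ^ r * ∫ x in Set.Iic s, f x ∂(gaussianReal 0 1)) ∧
    ∫ s : ℝ, s ^ r * ∫ x in Set.Iic s, f x ∂(gaussianReal 0 1) =
      -(∫ x, x ^ (r + 1) * f x ∂(gaussianReal 0 1)) / (r + 1) := by
  have hfi : Integrable f (gaussianReal 0 1) := hf.integrable (by simp)
  -- For fixed `x`, `w x` is a signed indicator of the interval between `x` and `0`. It differs from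
  -- the indicator of `x ≤ s` by a term free of `x`, which integrates to zero against the centered
  -- `f`. Bounded support in `s` is what makes Fubini's theorem applicable.
  set w : ℝ → ℝ → ℝ := fun x s => (Set.Ico x 0).indicator 1 s - (Set.Ico 0 x).indicator 1 s with hw
  have hw_eq : ∀ x s, w x s = (Set.Iic s).indicator 1 x - (Set.Ici 0).indicator 1 s := by
    intro x s
    simp only [hw, Set.indicator, Set.mem_Ico, Set.mem_Iic, Set.mem_Ici, Pi.one_apply]
    rcases le_or_gt x s with h1 | h1 <;> rcases le_or_gt 0 s with h2 | h2 <;>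
      simp [h1, h2, not_le.2, not_lt.2]
  have hH : ∀ s, ∫ x in Set.Iic s, f x ∂(gaussianReal 0 1) =
      ∫ x, w x s * f x ∂(gaussianReal 0 1) := by
    intro s
    have e : ∀ x, w x s * f x = (Set.Iic s).indicator f x - (Set.Ici 0).indicator 1 s * f x := by
      intro x
      rw [hw_eq, sub_mul]
      congr 1
      by_cases hx : x ∈ Set.Iic s <;> simp [hx]
    simp_rw [e]
    rw [integral_sub (hfi.indicator measurableSet_Iic) (hfi.const_mul _), integral_const_mul, hf0,
      integral_indicator measurableSet_Iic]
    simp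
  have hwm : Measurable fun q : ℝ × ℝ => w q.2 q.1 := by
    have e : (fun q : ℝ × ℝ => w q.2 q.1) = fun q =>
        {q : ℝ × ℝ | q.2 ≤ q.1}.indicator 1 q - {q : ℝ × ℝ | 0 ≤ q.1}.indicator 1 q := by
      ext q; rw [hw_eq]; rfl
    rw [e]
    exact (measurable_one.indicator (measurableSet_le measurable_snd measurable_fst)).sub
      (measurable_one.indicator (measurableSet_le measurable_const measurable_fst))
  have hmeas : AEStronglyMeasurable (fun q : ℝ × ℝ => q.1 ^ r * (w q.2 q.1 * f q.2))
      (volume.prod (gaussianReal 0 1)) := by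
    have h2 : AEStronglyMeasurable (fun q : ℝ × ℝ => f q.2)
        ((volume : Measure ℝ).prod (gaussianReal 0 1)) := hf.1.comp_snd
    exact (measurable_fst.pow_const r).aestronglyMeasurable.mul
      (hwm.aestronglyMeasurable.mul h2)
  have hpow : ∀ a b : ℝ, IntegrableOn (fun s : ℝ => s ^ r) (Set.Ico a b) := fun a b =>
    ((continuous_pow r).continuousOn.integrableOn_Icc).mono_set Set.Ico_subset_Icc_self
  have hsplit : ∀ x s, s ^ r * (w x s * f x) =
      f x * ((Set.Ico x 0).indicator (fun s => s ^ r) s -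
        (Set.Ico 0 x).indicator (fun s => s ^ r) s) := by
    intro x s
    have : ∀ S : Set ℝ, S.indicator (fun s : ℝ => s ^ r) s = S.indicator 1 s * s ^ r := fun S => by
      by_cases hs : s ∈ S <;> simp [hs]
    rw [this, this]
    simp only [hw]
    ring
  have hind : ∀ a b : ℝ, Integrable ((Set.Ico a b).indicator fun s : ℝ => s ^ r) := fun a b =>
    (integrable_indicator_iff measurableSet_Ico).2 (hpow a b)
  have hint1 : ∀ x, Integrable fun s => s ^ r * (w x s * f x) := fun x => by
    simp_rw [hsplit]
    exact ((hind x 0).sub (hind 0 x)).const_mul _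
  have hval : ∀ x, ∫ s, s ^ r * (w x s * f x) = -(x ^ (r + 1) * f x) / (r + 1) := by
    intro x
    simp_rw [hsplit]
    rw [integral_const_mul, integral_sub (hind x 0) (hind 0 x), integral_indicator
      measurableSet_Ico, integral_indicator measurableSet_Ico]
    have key : ∀ a b : ℝ, a ≤ b → ∫ s in Set.Ico a b, s ^ r = (b ^ (r + 1) - a ^ (r + 1)) / (r + 1) :=
      fun a b hab => by
        rw [integral_Ico_eq_integral_Ioc, ← intervalIntegral.integral_of_le hab, integral_pow]
    rcases le_total x 0 with hx | hx
    · rw [key x 0 hx, Set.Ico_eq_empty (not_lt.2 hx)]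
      simp; ring
    · rw [key 0 x hx, Set.Ico_eq_empty (not_lt.2 hx)]
      simp; ring
  have hnorm : ∀ x, ∫ s, ‖s ^ r * (w x s * f x)‖ ≤ ‖x ^ (r + 1) * f x‖ := by
    intro x
    have hb : ∀ s, ‖s ^ r * (w x s * f x)‖ ≤
        (Set.Ico x 0 ∪ Set.Ico 0 x).indicator (fun _ => |x| ^ r * |f x|) s := by
      intro s
      rcases le_total x 0 with hx | hx
      · have he : Set.Ico 0 x = ∅ := Set.Ico_eq_empty (not_lt.2 hx)
        simp only [hw, he, Set.union_empty, Set.indicator_empty, sub_zero]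
        by_cases hs : s ∈ Set.Ico x 0
        · have : |s| ≤ |x| := by
            rw [abs_of_neg hs.2, abs_of_nonpos hx]; linarith [hs.1]
          simp only [hs, Set.indicator_of_mem, Pi.one_apply, one_mul, norm_mul, norm_pow,
            Real.norm_eq_abs]
          gcongr
        · simp [hs]
      · have he : Set.Ico x 0 = ∅ := Set.Ico_eq_empty (not_lt.2 hx)
        simp only [hw, he, Set.empty_union, Set.indicator_empty, zero_sub]
        by_cases hs : s ∈ Set.Ico 0 x
        · have : |s| ≤ |x| := by
            rw [abs_of_nonneg hs.1, abs_of_nonneg hx]; exact hs.2.le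
          simp only [hs, Set.indicator_of_mem, Pi.one_apply, neg_mul, one_mul, norm_mul, norm_pow,
            Real.norm_eq_abs, norm_neg]
          gcongr
        · simp [hs]
    have hS : MeasurableSet (Set.Ico x 0 ∪ Set.Ico 0 x) := measurableSet_Ico.union measurableSet_Ico
    have hvol : volume.real (Set.Ico x 0 ∪ Set.Ico 0 x) = |x| := by
      rcases le_total x 0 with hx | hx
      · rw [Set.Ico_eq_empty (not_lt.2 hx), Set.union_empty, Real.volume_real_Ico_of_le hx,
          abs_of_nonpos hx, zero_sub]
      · rw [Set.Ico_eq_empty (not_lt.2 hx), Set.empty_union, Real.volume_real_Ico_of_le hx,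
          abs_of_nonneg hx, sub_zero]
    have hfin : volume (Set.Ico x 0 ∪ Set.Ico 0 x) ≠ ⊤ :=
      (measure_union_lt_top measure_Ico_lt_top measure_Ico_lt_top).ne
    calc ∫ s, ‖s ^ r * (w x s * f x)‖
        ≤ ∫ s, (Set.Ico x 0 ∪ Set.Ico 0 x).indicator (fun _ => |x| ^ r * |f x|) s :=
          integral_mono (hint1 x).norm ((integrable_indicator_iff hS).2
            (integrableOn_const hfin)) hb
      _ = ‖x ^ (r + 1) * f x‖ := by
          rw [integral_indicator hS, setIntegral_const, hvol, smul_eq_mul, norm_mul, norm_pow,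
            Real.norm_eq_abs, Real.norm_eq_abs, pow_succ]
          ring
  have hpf : Integrable (fun x => x ^ (r + 1) * f x) (gaussianReal 0 1) :=
    (memLp_pow_gaussianReal (r + 1) 2 (by simp)).integrable_mul hf
  have hint : Integrable (fun q : ℝ × ℝ => q.1 ^ r * (w q.2 q.1 * f q.2))
      (volume.prod (gaussianReal 0 1)) := by
    rw [integrable_prod_iff' hmeas]
    refine ⟨ae_of_all _ hint1, ?_⟩
    refine hpf.norm.mono' hmeas.norm.prod_swap.integral_prod_right' (ae_of_all _ fun x => ?_)
    rw [Real.norm_of_nonneg (integral_nonneg fun s => norm_nonneg _)]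
    exact hnorm x
  have e1 : ∀ s : ℝ, ∫ x, s ^ r * (w x s * f x) ∂(gaussianReal 0 1) =
      s ^ r * ∫ x in Set.Iic s, f x ∂(gaussianReal 0 1) := fun s => by
    rw [integral_const_mul, hH]
  refine ⟨?_, ?_⟩
  · have := hint.integral_prod_left
    simpa only [e1] using this
  · have h1 := integral_prod _ hint
    have h2 := integral_prod_symm _ hint
    simp only [e1] at h1
    rw [← h1, h2]
    simp only [hval]
    rw [integral_div, integral_neg]

lemma intervalIntegral_eq_setIntegral_gaussianReal {h : ℝ → ℝ}
    (hh : AEStronglyMeasurable h (volume.restrict (Set.Icc 0 1))) (s : ℝ) :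
    ∫ t in (0 : ℝ)..(stdCdf s), h t = ∫ x in Set.Iic s, h (stdCdf x) ∂(gaussianReal 0 1) := by
  have hs := stdCdf_mem_Ioo s
  have hpre : stdCdf ⁻¹' Set.Ioc 0 (stdCdf s) = Set.Iic s := by
    ext x
    simp only [Set.mem_preimage, Set.mem_Ioc, Set.mem_Iic, strictMono_stdCdf.le_iff_le,
      (stdCdf_mem_Ioo x).1, true_and]
  have hsub : Set.Ioc 0 (stdCdf s) ∩ Set.Icc 0 1 = Set.Ioc 0 (stdCdf s) :=
    Set.inter_eq_left.2 fun x hx => ⟨hx.1.le, hx.2.trans hs.2.le⟩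
  rw [intervalIntegral.integral_of_le hs.1.le, ← hpre,
    ← setIntegral_map measurableSet_Ioc (by rwa [map_stdCdf])
      continuous_stdCdf.measurable.aemeasurable, map_stdCdf,
    Measure.restrict_restrict measurableSet_Ioc, hsub]

lemma memLp_comp_stdCdf {h : ℝ → ℝ} (hh : h ∈ L2Zero) :
    MemLp (fun x => h (stdCdf x)) 2 (gaussianReal 0 1) ∧
      ∫ x, h (stdCdf x) ∂(gaussianReal 0 1) = 0 := by
  have hmp : MeasurePreserving stdCdf (gaussianReal 0 1) (volume.restrict (Set.Icc 0 1)) :=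
    ⟨continuous_stdCdf.measurable, map_stdCdf⟩
  refine ⟨hh.1.comp_measurePreserving hmp, ?_⟩
  refine Eq.trans ?_ hh.2
  rw [← map_stdCdf, integral_map hmp.measurable.aemeasurable (by
    rw [map_stdCdf]; exact hh.1.1)]

/-- The infinitesimal transport of the standard normal margin generated by `h`. -/
def transport (h : ℝ → ℝ) (s : ℝ) : ℝ := -(∫ t in (0 : ℝ)..(stdCdf s), h t) / stdPdf s

/-- The factor `1/φ` in `transport` cancels the normal density, leaving integration by parts: `φ ·
transport h` has derivative `-(h ∘ Φ) φ`. The case `r = 1` produces the cancellation in the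
orthogonality proof. -/
lemma integral_pow_mul_transport {h : ℝ → ℝ} (hh : h ∈ L2Zero) (r : ℕ) :
    Integrable (fun s => s ^ r * transport h s) (gaussianReal 0 1) ∧
    ∫ s, s ^ r * transport h s ∂(gaussianReal 0 1) =
      (∫ x, x ^ (r + 1) * h (stdCdf x) ∂(gaussianReal 0 1)) / (r + 1) := by
  obtain ⟨h1, h2⟩ := memLp_comp_stdCdf hh
  obtain ⟨h3, h4⟩ := integral_pow_mul_setIntegral_Iic h1 h2 r
  have e : ∀ s, s ^ r * transport h s * stdPdf s =
      -(s ^ r * ∫ x in Set.Iic s, h (stdCdf x) ∂(gaussianReal 0 1)) := fun s => by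
    rw [transport, intervalIntegral_eq_setIntegral_gaussianReal hh.1.1]
    have := (stdPdf_pos s).ne'
    field_simp
  constructor
  · rw [integrable_gaussianReal_iff]
    simp_rw [e]
    exact h3.neg
  · rw [integral_gaussianReal_eq_integral_mul_stdPdf]
    simp_rw [e]
    rw [integral_neg, h4]
    ring

/-- The direction generating a change of scale of the margin. -/
def scaleDirection (d : ℝ) (u : ℝ) : ℝ := d * (quantile (gaussianReal 0 1) u ^ 2 - 1)

lemma scaleDirection_stdCdf (d s : ℝ) : scaleDirection d (stdCdf s) = d * (s ^ 2 - 1) := by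
  rw [scaleDirection, quantile_stdCdf]

lemma scaleDirection_mem_L2Zero (d : ℝ) : scaleDirection d ∈ L2Zero := by
  have hm : Measurable (scaleDirection d) :=
    (((measurable_quantile _).pow_const 2).sub_const 1).const_mul d
  have hL : MemLp (fun s : ℝ => d * (s ^ 2 - 1)) 2 (gaussianReal 0 1) :=
    ((memLp_pow_gaussianReal 2 2 (by simp)).sub (memLp_const 1)).const_mul d
  constructor
  · rw [← map_stdCdf, memLp_map_measure_iff hm.aestronglyMeasurable
      continuous_stdCdf.measurable.aemeasurable]
    have : scaleDirection d ∘ stdCdf = fun s => d * (s ^ 2 - 1) :=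
      funext fun s => scaleDirection_stdCdf d s
    rwa [this]
  · rw [← map_stdCdf, integral_map continuous_stdCdf.measurable.aemeasurable
      hm.aestronglyMeasurable]
    simp_rw [scaleDirection_stdCdf]
    rw [integral_const_mul, integral_sub (integrable_pow_gaussianReal 2) (integrable_const _),
      integral_sq_gaussianReal]
    simp

/-- `(x² - 1) φ` is the derivative of `-xφ`; the resulting linear vector field `d s` is indeed a
change of scale. -/
lemma transport_scaleDirection (d s : ℝ) : transport (scaleDirection d) s = d * s := by
  have hm : Measurable (scaleDirection d) :=
    (((measurable_quantile _).pow_const 2).sub_const 1).const_mul d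
  have hpow : ∀ n : ℕ, Integrable fun x : ℝ => x ^ n * stdPdf x := fun n =>
    (integrable_gaussianReal_iff _).1 (integrable_pow_gaussianReal n)
  have hder : ∀ x, HasDerivAt (fun x => -(x * stdPdf x)) ((x ^ 2 - 1) * stdPdf x) x := fun x => by
    have := ((hasDerivAt_id x).mul (hasDerivAt_stdPdf x)).neg
    refine this.congr_deriv ?_
    simp; ring
  have hi' : Integrable fun x => (x ^ 2 - 1) * stdPdf x :=
    ((hpow 2).sub (hpow 0)).congr (ae_of_all _ fun x => by simp; ring)
  have hi : Integrable fun x => -(x * stdPdf x) :=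
    (hpow 1).neg.congr (ae_of_all _ fun x => by simp)
  have hlim := tendsto_zero_of_hasDerivAt_of_integrableOn_Iic (a := s) (fun x _ => hder x)
    hi'.integrableOn hi.integrableOn
  have hint := integral_Iic_of_hasDerivAt_of_tendsto (a := s) (hder s).continuousAt.continuousWithinAt
    (fun x _ => hder x) hi'.integrableOn hlim
  rw [transport, intervalIntegral_eq_setIntegral_gaussianReal hm.aestronglyMeasurable]
  simp_rw [scaleDirection_stdCdf]
  rw [integral_const_mul, gaussianReal_of_var_ne_zero 0 one_ne_zero,
    setIntegral_withDensity_eq_setIntegral_toReal_smul (measurable_gaussianPDF 0 1)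
      (ae_of_all _ fun x => gaussianPDF_lt_top) _ measurableSet_Iic]
  have e : ∀ x : ℝ, (gaussianPDF 0 1 x).toReal • (x ^ 2 - 1) = (x ^ 2 - 1) * stdPdf x := fun x => by
    rw [toReal_gaussianPDF, smul_eq_mul, mul_comm]
  simp_rw [e]
  rw [hint]
  have := (stdPdf_pos s).ne'
  field_simp
  ring

/-! ### Derivatives of determinants, inverses and log densities -/

section

variable {p : ℕ}

lemma sum_det_updateCol (C N : Matrix (Fin p) (Fin p) ℝ) :
    ∑ i, (C.updateCol i (N.col i)).det = (C.adjugate * N).trace := by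
  rw [trace]
  refine Finset.sum_congr rfl fun i _ => ?_
  rw [← cramer_apply, cramer_eq_adjugate_mulVec, diag_apply, mul_apply]
  rfl

/-- Jacobi's formula: differentiating the Leibniz expansion replaces one column at a time, and
Cramer's rule collects these determinants into a trace. -/
lemma hasDerivAt_det {M : ℝ → Matrix (Fin p) (Fin p) ℝ} {N : Matrix (Fin p) (Fin p) ℝ} {t : ℝ}
    (h : ∀ i j, HasDerivAt (fun t => M t i j) (N i j) t) :
    HasDerivAt (fun t => (M t).det) ((M t).adjugate * N).trace t := by
  have h1 : HasDerivAt (fun t => ∑ σ : Equiv.Perm (Fin p), (σ.sign : ℤ) * ∏ i, M t (σ i) i)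
      (∑ σ : Equiv.Perm (Fin p), ((σ.sign : ℤ) : ℝ) *
        ∑ i, (∏ j ∈ Finset.univ.erase i, M t (σ j) j) • N (σ i) i) t :=
    HasDerivAt.fun_sum fun σ _ => (HasDerivAt.fun_finsetProd fun i _ => h (σ i) i).const_mul _
  have e : (fun t => (M t).det) =
      fun t => ∑ σ : Equiv.Perm (Fin p), (σ.sign : ℤ) * ∏ i, M t (σ i) i :=
    funext fun t => det_apply' (M t)
  rw [e]
  refine h1.congr_deriv ?_
  rw [← sum_det_updateCol]
  simp_rw [det_apply', Finset.mul_sum]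
  rw [Finset.sum_comm]
  refine Finset.sum_congr rfl fun i _ => Finset.sum_congr rfl fun σ _ => ?_
  congr 1
  rw [← Finset.mul_prod_erase Finset.univ _ (Finset.mem_univ i), smul_eq_mul, mul_comm]
  congr 1
  · simp
  · refine Finset.prod_congr rfl fun j hj => ?_
    rw [updateCol_ne (Finset.ne_of_mem_erase hj)]

lemma hasDerivAt_dotProduct_inv_mulVec {M : ℝ → Matrix (Fin p) (Fin p) ℝ}
    {N : Matrix (Fin p) (Fin p) ℝ} (h : ∀ i j, HasDerivAt (fun t => M t i j) (N i j) 0)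
    (hdet : (M 0).det ≠ 0) (z : Fin p → ℝ) :
    HasDerivAt (fun t => z ⬝ᵥ ((M t)⁻¹ *ᵥ z)) (-(z ⬝ᵥ (((M 0)⁻¹ * N * (M 0)⁻¹) *ᵥ z))) 0 := by
  have hM : Tendsto M (𝓝 0) (𝓝 (M 0)) :=
    tendsto_pi_nhds.2 fun i => tendsto_pi_nhds.2 fun j => (h i j).continuousAt
  have hdetc : Tendsto (fun t => (M t).det) (𝓝 0) (𝓝 (M 0).det) :=
    ((Continuous.matrix_det continuous_id).tendsto (M 0)).comp hM
  have hadj : Tendsto (fun t => (M t).adjugate) (𝓝 0) (𝓝 (M 0).adjugate) :=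
    ((Continuous.matrix_adjugate continuous_id).tendsto (M 0)).comp hM
  have hinv : Tendsto (fun t => (M t)⁻¹) (𝓝 0) (𝓝 (M 0)⁻¹) := by
    simp only [inv_def, Ring.inverse_eq_inv']
    exact (hdetc.inv₀ hdet).smul hadj
  have hslope : Tendsto (fun t => t⁻¹ • (M t - M 0)) (𝓝[≠] 0) (𝓝 N) :=
    tendsto_pi_nhds.2 fun i => tendsto_pi_nhds.2 fun j => by
      have := (h i j).tendsto_slope_zero
      simpa using this
  rw [hasDerivAt_iff_tendsto_slope_zero]
  have hc : Continuous fun X : Matrix (Fin p) (Fin p) ℝ × Matrix (Fin p) (Fin p) ℝ =>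
      -(z ⬝ᵥ ((X.1 * X.2 * (M 0)⁻¹) *ᵥ z)) := by fun_prop
  have hlim := (hc.tendsto ((M 0)⁻¹, N)).comp
    ((hinv.mono_left nhdsWithin_le_nhds).prodMk_nhds hslope)
  refine hlim.congr' ?_
  have hev : ∀ᶠ t in 𝓝[≠] (0 : ℝ), (M t).det ≠ 0 :=
    (hdetc.mono_left nhdsWithin_le_nhds).eventually_ne hdet
  filter_upwards [hev] with t ht
  -- The resolvent identity turns the difference quotient of the inverse into one of `M`, so
  -- continuity of the inverse is all that is needed.
  have h1 : (M t)⁻¹ * (M t - M 0) * (M 0)⁻¹ = (M 0)⁻¹ - (M t)⁻¹ := by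
    rw [Matrix.mul_sub, nonsing_inv_mul _ (isUnit_iff_ne_zero.2 ht), Matrix.sub_mul,
      Matrix.one_mul, Matrix.mul_assoc, mul_nonsing_inv _ (isUnit_iff_ne_zero.2 hdet),
      Matrix.mul_one]
  simp only [Function.comp]
  rw [Matrix.mul_smul, Matrix.smul_mul, h1, smul_mulVec, sub_mulVec, dotProduct_smul,
    dotProduct_sub, zero_add, ← smul_neg, neg_sub]

lemma adjugate_mul_trace {C N : Matrix (Fin p) (Fin p) ℝ} (hdet : C.det ≠ 0) :
    (C.adjugate * N).trace / C.det = (C⁻¹ * N).trace := by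
  rw [inv_def, Ring.inverse_eq_inv', Matrix.smul_mul, trace_smul, smul_eq_mul]
  field_simp

variable {k : ℕ} {R : (Fin k → ℝ) → Matrix (Fin p) (Fin p) ℝ} {θ : Fin k → ℝ}

/-- The parametric score is a centered quadratic form in the Gaussian scores. -/
lemma score_eq_centeredQuad {Θ : Set (Fin k → ℝ)} (hR : IsCopulaParametrization Θ R)
    (hθ : θ ∈ Θ) (m : Fin k) (u : Fin p → ℝ) :
    score R θ m u =
      centeredQuad (R θ) ((R θ)⁻¹ * partialR R θ m * (R θ)⁻¹) (gaussianize u) := by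
  set z := gaussianize u with hz
  set M : ℝ → Matrix (Fin p) (Fin p) ℝ := fun t => R (θ + t • Pi.single m 1) with hM
  have hM0 : M 0 = R θ := by simp [hM]
  have hder : ∀ i j, HasDerivAt (fun t => M t i j) (partialR R θ m i j) 0 := fun i j =>
    (hR.lineDifferentiableAt θ hθ m i j).hasLineDerivAt
  have hpos := (hR.posDef θ hθ).det_pos
  have hdet : (M 0).det ≠ 0 := by rw [hM0]; exact hpos.ne'
  have h1 := (hasDerivAt_det hder).log hdet
  have h2 := hasDerivAt_dotProduct_inv_mulVec hder hdet z
  have h3 : HasDerivAt (fun t => -(1 / 2) * Real.log (M t).det - 1 / 2 *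
      (z ⬝ᵥ ((M t)⁻¹ *ᵥ z) - z ⬝ᵥ z)) _ 0 :=
    (h1.const_mul (-(1 / 2))).sub ((h2.sub_const (z ⬝ᵥ z)).const_mul (1 / 2))
  have h4 : (fun t : ℝ => logDensity (R (θ + t • Pi.single m 1)) u) = fun t =>
      -(1 / 2) * Real.log (M t).det - 1 / 2 * (z ⬝ᵥ ((M t)⁻¹ *ᵥ z) - z ⬝ᵥ z) := by
    ext t
    rw [logDensity, sub_mulVec, one_mulVec, dotProduct_sub]
  rw [score, lineDeriv, h4, h3.deriv, adjugate_mul_trace hdet, hM0, centeredQuad]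
  have h5 : (R θ)⁻¹ * partialR R θ m * (R θ)⁻¹ * R θ = (R θ)⁻¹ * partialR R θ m := by
    rw [Matrix.mul_assoc _ _ (R θ), nonsing_inv_mul _ (isUnit_iff_ne_zero.2 hpos.ne'),
      Matrix.mul_one]
  rw [h5]
  ring

/-- The score in the argument of the copula density. -/
lemma coordScore_uniformize {C : Matrix (Fin p) (Fin p) ℝ} (hC : C.IsSymm) (j : Fin p)
    (z : Fin p → ℝ) :
    coordScore C j (uniformize z) = -((C⁻¹ - 1) *ᵥ z) j / stdPdf (z j) := by
  set Q := C⁻¹ - 1 with hQ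
  have hQs : Q.IsSymm := by
    rw [hQ, IsSymm, transpose_sub, transpose_nonsing_inv, hC, transpose_one]
  have hg : ∀ i, HasDerivAt (fun t : ℝ => gaussianize (uniformize z + t • Pi.single j 1) i)
      ((stdPdf (z i))⁻¹ * (Pi.single j 1 : Fin p → ℝ) i) 0 := fun i => by
    have h1 : HasDerivAt (fun t : ℝ => uniformize z i + t * (Pi.single j 1 : Fin p → ℝ) i)
        ((Pi.single j 1 : Fin p → ℝ) i) 0 := by
      have := ((hasDerivAt_id (0 : ℝ)).mul_const ((Pi.single j 1 : Fin p → ℝ) i)).const_add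
        (uniformize z i)
      simpa using this
    have h2 := hasDerivAt_quantile (stdCdf_mem_Ioo (z i))
    rw [quantile_stdCdf] at h2
    have h3 : HasDerivAt (quantile (gaussianReal 0 1)) (stdPdf (z i))⁻¹
        (uniformize z i + (0 : ℝ) * (Pi.single j 1 : Fin p → ℝ) i) := by
      rw [zero_mul, add_zero]; exact h2
    exact h3.comp (0 : ℝ) h1
  have h0 : ∀ i, gaussianize (uniformize z + (0 : ℝ) • Pi.single j 1) i = z i := fun i => by
    rw [zero_smul, add_zero, gaussianize_uniformize]
  have hq : HasDerivAt (fun t : ℝ => ∑ i, ∑ l,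
      gaussianize (uniformize z + t • Pi.single j 1) i *
        (Q i l * gaussianize (uniformize z + t • Pi.single j 1) l)) _ 0 :=
    HasDerivAt.fun_sum fun i _ => HasDerivAt.fun_sum fun l _ =>
      (hg i).fun_mul ((hg l).const_mul (Q i l))
  have hl := (hq.const_mul (1 / 2)).const_sub (-(1 / 2) * Real.log C.det)
  have e : (fun t : ℝ => logDensity C (uniformize z + t • Pi.single j 1)) = fun t =>
      -(1 / 2) * Real.log C.det - 1 / 2 * ∑ i, ∑ l,
      gaussianize (uniformize z + t • Pi.single j 1) i *
        (Q i l * gaussianize (uniformize z + t • Pi.single j 1) l) := by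
    ext t
    rw [logDensity]
    simp only [dotProduct, mulVec, Finset.mul_sum, ← hQ]
  rw [coordScore, lineDeriv, e, hl.deriv]
  simp only [h0, Finset.sum_add_distrib]
  have s1 : ∑ i, ∑ l, (stdPdf (z i))⁻¹ * (Pi.single j 1 : Fin p → ℝ) i * (Q i l * z l) =
      (stdPdf (z j))⁻¹ * (Q *ᵥ z) j := by
    rw [Finset.sum_eq_single j (fun b _ hb => by simp [hb]) (by simp)]
    simp [mulVec, dotProduct, Finset.mul_sum]
  have s2 : ∑ i, ∑ l, z i * (Q i l * ((stdPdf (z l))⁻¹ * (Pi.single j 1 : Fin p → ℝ) l)) =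
      (stdPdf (z j))⁻¹ * (Q *ᵥ z) j := by
    rw [Finset.sum_comm, Finset.sum_eq_single j (fun b _ hb => by simp [hb]) (by simp)]
    simp only [mulVec, dotProduct, Finset.mul_sum, Pi.single_eq_same, mul_one]
    refine Finset.sum_congr rfl fun i _ => ?_
    rw [hQs.apply j i]; ring
  rw [s1, s2]
  ring

/-- The score operator in terms of the Gaussian scores. -/
lemma scoreOperator_uniformize {C : Matrix (Fin p) (Fin p) ℝ} (hC : C.IsSymm)
    (h : Fin p → ℝ → ℝ) (z : Fin p → ℝ) :
    scoreOperator C h (uniformize z) =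
      ∑ j, (h j (stdCdf (z j)) + ((C⁻¹ - 1) *ᵥ z) j * transport (h j) (z j)) := by
  rw [scoreOperator]
  refine Finset.sum_congr rfl fun j _ => ?_
  rw [coordScore_uniformize hC, transport, uniformize]
  ring

end

/-! ### Orthogonality of quadratic forms to the nonparametric tangent space -/

section

variable {p : ℕ} {C : Matrix (Fin p) (Fin p) ℝ}

/-- A standard vector with one extra coordinate, mapped by the block matrix `(c | B)`. For `c` the
`j`-th column of `C` this is the regression of the vector on its `j`-th coordinate. -/
lemma measurePreserving_smul_add_mulVec {c : Fin p → ℝ} {B : Matrix (Fin p) (Fin p) ℝ}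
    (h : C = vecMulVec c c + B * Bᵀ) :
    MeasurePreserving (fun y : ℝ × (Fin p → ℝ) => y.1 • c + B *ᵥ y.2)
      ((gaussianReal 0 1).prod (stdVec (Fin p))) (gaussVec C) := by
  set M : Matrix (Fin p) (Fin (p + 1)) ℝ := Matrix.of fun i => Fin.cons (c i) (B i) with hM
  have hMC : C = M * Mᵀ := by
    rw [h]
    ext i l
    simp [hM, mul_apply, vecMulVec_apply, Fin.sum_univ_succ]
  have h1 := measurePreserving_mulVec_gaussVec hMC
  have h2 := (measurePreserving_piFinSuccAbove (fun _ : Fin (p + 1) => gaussianReal 0 1) 0).symm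
  have h3 := h1.comp h2
  convert h3 using 1
  ext y i
  simp [hM, mulVec, dotProduct, Fin.sum_univ_succ, mul_comm]

lemma memLp_dotProduct_stdVec (l : Fin p → ℝ) :
    MemLp (fun g : Fin p → ℝ => l ⬝ᵥ g) 2 (stdVec (Fin p)) := by
  simp only [dotProduct]
  refine memLp_finsetSum _ fun i _ => MemLp.const_mul ?_ _
  exact (memLp_id_gaussianReal' (μ := 0) (v := 1) 2 (by simp)).comp_measurePreserving
    (measurePreserving_eval (fun _ : Fin p => gaussianReal 0 1) i)

lemma integral_eq_zero_of_odd {f : (Fin p → ℝ) → ℝ} (hf : ∀ g, f (-g) = -f g) :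
    ∫ g, f g ∂(stdVec (Fin p)) = 0 := by
  have hmap : (stdVec (Fin p)).map (fun g => -g) = stdVec (Fin p) := by
    have := map_mulVec_stdVec_of_orthogonal (U := -(1 : Matrix (Fin p) (Fin p) ℝ)) (by simp)
    simpa [neg_mulVec] using this
  have h1 : ∫ g, f g ∂(stdVec (Fin p)) = ∫ g, f (-g) ∂(stdVec (Fin p)) := by
    conv_lhs => rw [← hmap]
    exact integral_map_equiv (MeasurableEquiv.neg (Fin p → ℝ)) f
  simp_rw [hf, integral_neg] at h1
  linarith

/-- The product is half the quadratic form of `m l' + l m'`, whose mean is the trace of that matrix.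
-/
lemma integral_dotProduct_mul_dotProduct (l m : Fin p → ℝ) :
    ∫ g, (m ⬝ᵥ g) * (l ⬝ᵥ g) ∂(stdVec (Fin p)) = m ⬝ᵥ l := by
  have hH : (vecMulVec m l + vecMulVec l m).IsSymm := by
    rw [IsSymm, transpose_add, transpose_vecMulVec, transpose_vecMulVec, add_comm]
  have h := (quadraticForm_stdVec hH).2.1
  have e : ∀ g : Fin p → ℝ, g ⬝ᵥ ((vecMulVec m l + vecMulVec l m) *ᵥ g) =
      2 * ((m ⬝ᵥ g) * (l ⬝ᵥ g)) := fun g => by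
    rw [add_mulVec, dotProduct_add, vecMulVec_mulVec, vecMulVec_mulVec]
    simp only [op_smul_eq_smul, dotProduct_smul, smul_eq_mul]
    rw [dotProduct_comm g m, dotProduct_comm g l]
    ring
  simp_rw [e] at h
  rw [integral_const_mul, trace_add, trace_vecMulVec, trace_vecMulVec, dotProduct_comm l m] at h
  linarith

lemma measurePreserving_eval_gaussVec (hC : C.PosSemidef) {j : Fin p} (hj : C j j = 1) :
    MeasurePreserving (fun z : Fin p → ℝ => z j) (gaussVec C) (gaussianReal 0 1) := by
  have h := measurePreserving_eval_multivariateGaussian (μ := 0) hC (i := j)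
  refine ⟨measurable_pi_apply j, ?_⟩
  rw [gaussVec, Measure.map_map (measurable_pi_apply j) (by fun_prop)]
  have h2 := h.map_eq
  rw [hj] at h2
  exact h2.trans (by simp)

/-- A quadratic form with vanishing `j`-th scale derivative is orthogonal to the scores of the
`j`-th margin. -/
lemma integral_centeredQuad_mul_marginScore (hC : C.PosDef) {A : Matrix (Fin p) (Fin p) ℝ}
    (hA : A.IsSymm) {j : Fin p} (hj : C j j = 1) (hAj : (A * C) j j = 0) {h : ℝ → ℝ}
    (hh : h ∈ L2Zero) :
    Integrable (fun z => centeredQuad C A z *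
      (h (stdCdf (z j)) + ((C⁻¹ - 1) *ᵥ z) j * transport h (z j))) (gaussVec C) ∧
    ∫ z, centeredQuad C A z *
      (h (stdCdf (z j)) + ((C⁻¹ - 1) *ᵥ z) j * transport h (z j)) ∂(gaussVec C) = 0 := by
  have hCs := PosSemidef.isSymm hC.posSemidef
  have hdet : IsUnit C.det := isUnit_iff_ne_zero.2 hC.det_pos.ne'
  obtain ⟨G, hG⟩ := exists_eq_mul_transpose hC.posSemidef
  set c : Fin p → ℝ := C.col j with hc
  -- Regress on `z_j`: since `C_jj = 1`, `z = s c + B g` with `s = z_j` and `g` independent of `s`.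
  -- Here `B Bᵀ = C - c c'` is the conditional covariance and the `j`-th row of `B` vanishes.
  set N : Matrix (Fin p) (Fin p) ℝ := 1 - vecMulVec c (Pi.single j 1) with hN
  set B := N * G with hB
  have hcj : c j = 1 := hj
  have hcC : C *ᵥ Pi.single j 1 = c := by rw [mulVec_single_one]
  have hcC' : (Pi.single j 1 : Fin p → ℝ) ᵥ* C = c := by
    rw [← hcC, ← vecMul_transpose, hCs]
  have hBB : B * Bᵀ = C - vecMulVec c c := by
    have e1 : B * Bᵀ = N * C * Nᵀ := by
      rw [hB, transpose_mul, hG]; simp only [Matrix.mul_assoc]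
    have e2 : N * C = C - vecMulVec c c := by
      rw [hN, Matrix.sub_mul, Matrix.one_mul, vecMulVec_mul, hcC']
    rw [e1, e2, hN, transpose_sub, transpose_one, transpose_vecMulVec, Matrix.mul_sub,
      Matrix.mul_one, mul_vecMulVec, sub_mulVec, hcC, vecMulVec_mulVec]
    simp [hcj]
  have hdec : C = vecMulVec c c + B * Bᵀ := by rw [hBB]; abel
  have hBj : ∀ g : Fin p → ℝ, (B *ᵥ g) j = 0 := fun g => by
    rw [hB, ← mulVec_mulVec, hN, sub_mulVec, one_mulVec, vecMulVec_mulVec]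
    simp [hcj]
  have hCinvc : C⁻¹ *ᵥ c = Pi.single j 1 := by
    rw [← hcC, mulVec_mulVec, nonsing_inv_mul _ hdet, one_mulVec]
  have hmp := measurePreserving_smul_add_mulVec hdec
  set l : Fin p → ℝ := (C⁻¹ * B).row j with hl
  set m : Fin p → ℝ := (A *ᵥ c) ᵥ* B with hm
  set κ : ℝ := c ⬝ᵥ (A *ᵥ c) with hκ
  set H := Bᵀ * A * B with hH
  set τ := (A * C).trace with hτ
  have hHs : H.IsSymm := isSymm_transpose_mul_mul hA B
  -- Since `C⁻¹ c = e_j` and `c_j = 1`, the contribution of `s` cancels and this factor is linear in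
  -- `g` alone.
  have hlin : ∀ (s : ℝ) (g : Fin p → ℝ), ((C⁻¹ - 1) *ᵥ (s • c + B *ᵥ g)) j = l ⬝ᵥ g := by
    intro s g
    rw [sub_mulVec, one_mulVec, Pi.sub_apply, mulVec_add, mulVec_smul, hCinvc, mulVec_mulVec]
    simp only [Pi.add_apply, Pi.smul_apply, hBj, hcj, Pi.single_eq_same, smul_eq_mul, mul_one,
      add_zero]
    rw [add_sub_cancel_left]
    rfl
  have hzj : ∀ (s : ℝ) (g : Fin p → ℝ), (s • c + B *ᵥ g) j = s := fun s g => by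
    simp [hBj, hcj]
  have hquad : ∀ (s : ℝ) (g : Fin p → ℝ), centeredQuad C A (s • c + B *ᵥ g) =
      1 / 2 * (s ^ 2 * κ + 2 * (s * (m ⬝ᵥ g)) + (g ⬝ᵥ (H *ᵥ g) - τ)) := by
    intro s g
    have e1 : (B *ᵥ g) ⬝ᵥ (A *ᵥ c) = m ⬝ᵥ g := by
      rw [hm, ← dotProduct_mulVec, dotProduct_comm]
    have e2 : c ⬝ᵥ (A *ᵥ (B *ᵥ g)) = m ⬝ᵥ g := by
      rw [← e1, dotProduct_mulVec, ← mulVec_transpose, hA, dotProduct_comm]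
    rw [centeredQuad, mulVec_add, mulVec_smul, add_dotProduct, dotProduct_add, dotProduct_add,
      dotProduct_smul, smul_dotProduct, smul_dotProduct, dotProduct_smul,
      dotProduct_mulVec_mulVec, e1, e2, ← hH, ← hκ, ← hτ]
    simp only [smul_eq_mul]
    ring
  -- `m · l = (Ac)'(C - cc')C⁻¹e_j = (Ac)'(e_j - c) = (A C)_{jj} - κ`. This is where the vanishing
  -- diagonal enters.
  have hml : m ⬝ᵥ l = -κ := by
    have e1 : l = Bᵀ *ᵥ (C⁻¹.row j) := by
      ext i; simp [hl, mul_apply, mulVec, dotProduct, mul_comm]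
    have e2 : C⁻¹.row j = C⁻¹ *ᵥ Pi.single j 1 := by
      rw [mulVec_single_one]
      ext i
      have : (C⁻¹).IsSymm := by rw [IsSymm, transpose_nonsing_inv, hCs]
      exact this.apply i j
    have e3 : (C - vecMulVec c c) *ᵥ (C⁻¹ *ᵥ Pi.single j 1) = Pi.single j 1 - c := by
      rw [sub_mulVec, mulVec_mulVec, mul_nonsing_inv _ hdet, one_mulVec, vecMulVec_mulVec]
      have : c ⬝ᵥ (C⁻¹ *ᵥ Pi.single j 1) = 1 := by
        rw [dotProduct_mulVec, ← mulVec_transpose, transpose_nonsing_inv, hCs, hCinvc]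
        simp
      rw [this]; simp
    rw [e1, hm, ← dotProduct_mulVec, mulVec_mulVec, hBB, e2, e3, dotProduct_sub,
      dotProduct_comm _ c, ← hκ]
    have e4 : (A *ᵥ c) ⬝ᵥ Pi.single j 1 = 0 := by
      rw [← hcC, mulVec_mulVec, dotProduct_comm]
      simpa using hAj
    rw [e4]; ring
  obtain ⟨hk2, hk0⟩ := memLp_comp_stdCdf hh
  set f : ℝ → ℝ := fun s => h (stdCdf s) with hf
  have hfi : ∀ r : ℕ, Integrable (fun s => s ^ r * f s) (gaussianReal 0 1) := fun r =>
    (memLp_pow_gaussianReal r 2 (by simp)).integrable_mul hk2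
  have ha : ∀ r : ℕ, Integrable (fun s => s ^ r * transport h s) (gaussianReal 0 1) := fun r =>
    (integral_pow_mul_transport hh r).1
  have ha1 : ∫ s, s ^ 1 * transport h s ∂(gaussianReal 0 1) =
      1 / 2 * ∫ s, s ^ 2 * f s ∂(gaussianReal 0 1) := by
    rw [(integral_pow_mul_transport hh 1).2]; push_cast; ring
  have hone : Integrable (fun _ : Fin p → ℝ => (1 : ℝ)) (stdVec (Fin p)) := integrable_const _
  have hLm := memLp_dotProduct_stdVec m
  have hLl := memLp_dotProduct_stdVec l
  have hq1 := (quadraticForm_stdVec hHs).1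
  have hqL : MemLp (fun g : Fin p → ℝ => g ⬝ᵥ (H *ᵥ g) - τ) 2 (stdVec (Fin p)) :=
    hq1.sub (memLp_const _)
  have i1 := (hfi 2).mul_prod hone
  have i2 := (hfi 1).mul_prod (hLm.integrable (by simp))
  have i3 := (hfi 0).mul_prod (hqL.integrable (by simp))
  have i4 := (ha 2).mul_prod (hLl.integrable (by simp))
  have hml' : Integrable (fun g : Fin p → ℝ => (m ⬝ᵥ g) * (l ⬝ᵥ g)) (stdVec (Fin p)) :=
    hLm.integrable_mul hLl
  have hql' : Integrable (fun g : Fin p → ℝ => (g ⬝ᵥ (H *ᵥ g) - τ) * (l ⬝ᵥ g))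
      (stdVec (Fin p)) := hqL.integrable_mul hLl
  have i5 := (ha 1).mul_prod hml'
  have i6 := (ha 0).mul_prod hql'
  have v1 := integral_prod_mul (μ := gaussianReal 0 1) (ν := stdVec (Fin p))
    (fun s => s ^ 2 * f s) (fun _ => (1 : ℝ))
  have v2 := integral_prod_mul (μ := gaussianReal 0 1) (ν := stdVec (Fin p))
    (fun s => s ^ 1 * f s) (fun g => m ⬝ᵥ g)
  have v3 := integral_prod_mul (μ := gaussianReal 0 1) (ν := stdVec (Fin p))
    (fun s => s ^ 0 * f s) (fun g => g ⬝ᵥ (H *ᵥ g) - τ)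
  have v4 := integral_prod_mul (μ := gaussianReal 0 1) (ν := stdVec (Fin p))
    (fun s => s ^ 2 * transport h s) (fun g => l ⬝ᵥ g)
  have v5 := integral_prod_mul (μ := gaussianReal 0 1) (ν := stdVec (Fin p))
    (fun s => s ^ 1 * transport h s) (fun g => (m ⬝ᵥ g) * (l ⬝ᵥ g))
  have v6 := integral_prod_mul (μ := gaussianReal 0 1) (ν := stdVec (Fin p))
    (fun s => s ^ 0 * transport h s) (fun g => (g ⬝ᵥ (H *ᵥ g) - τ) * (l ⬝ᵥ g))
  rw [integral_eq_zero_of_odd (fun g => by simp), mul_zero] at v2 v4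
  rw [integral_eq_zero_of_odd (fun g => by simp [mulVec_neg]), mul_zero] at v6
  rw [integral_dotProduct_mul_dotProduct, hml, ha1] at v5
  have hf0 : ∫ s, s ^ 0 * f s ∂(gaussianReal 0 1) = 0 := by simpa using hk0
  rw [hf0, zero_mul] at v3
  rw [integral_const, probReal_univ, one_smul, mul_one] at v1
  set Φ : (Fin p → ℝ) → ℝ := fun z => centeredQuad C A z *
      (h (stdCdf (z j)) + ((C⁻¹ - 1) *ᵥ z) j * transport h (z j)) with hΦ
  -- Six products of a function of `s` with a function of `g`. Those odd in `g` integrate to zero,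
  -- and so does the one carrying `E h = 0`. What remains is `κ/2 · E[s² h] - κ · E[s · transport
  -- h]`, which vanishes because `E[s · transport h] = ½ E[s² h]`.
  have hexp : (fun y : ℝ × (Fin p → ℝ) => Φ (y.1 • c + B *ᵥ y.2)) = fun y =>
      κ / 2 * (y.1 ^ 2 * f y.1 * 1) + y.1 ^ 1 * f y.1 * (m ⬝ᵥ y.2) +
      1 / 2 * (y.1 ^ 0 * f y.1 * (y.2 ⬝ᵥ (H *ᵥ y.2) - τ)) +
      κ / 2 * (y.1 ^ 2 * transport h y.1 * (l ⬝ᵥ y.2)) +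
      y.1 ^ 1 * transport h y.1 * ((m ⬝ᵥ y.2) * (l ⬝ᵥ y.2)) +
      1 / 2 * (y.1 ^ 0 * transport h y.1 * ((y.2 ⬝ᵥ (H *ᵥ y.2) - τ) * (l ⬝ᵥ y.2))) := by
    ext ⟨s, g⟩
    simp only [hΦ, hlin, hzj, hquad, hf]
    ring
  have j12 := (i1.const_mul (κ / 2)).add i2
  have j3 := j12.add (i3.const_mul (1 / 2))
  have j4 := j3.add (i4.const_mul (κ / 2))
  have j5 := j4.add i5
  have j6 := j5.add (i6.const_mul (1 / 2))
  have hev := measurePreserving_eval_gaussVec hC.posSemidef hj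
  have hΦm : AEStronglyMeasurable Φ (gaussVec C) := by
    have t1 : AEStronglyMeasurable (fun z : Fin p → ℝ => h (stdCdf (z j))) (gaussVec C) :=
      hk2.1.comp_measurePreserving hev
    have t2 : AEStronglyMeasurable (transport h) (gaussianReal 0 1) := by
      simpa using (ha 0).1
    have t3 : AEStronglyMeasurable (fun z : Fin p → ℝ => transport h (z j)) (gaussVec C) :=
      t2.comp_measurePreserving hev
    have t4 : AEStronglyMeasurable (fun z : Fin p → ℝ => ((C⁻¹ - 1) *ᵥ z) j) (gaussVec C) :=
      ((measurable_pi_apply j).comp (measurable_mulVec_left _)).aestronglyMeasurable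
    exact (continuous_centeredQuad C A).aestronglyMeasurable.mul (t1.add (t4.mul t3))
  have hcomp : Integrable (fun y : ℝ × (Fin p → ℝ) => Φ (y.1 • c + B *ᵥ y.2))
      ((gaussianReal 0 1).prod (stdVec (Fin p))) := by
    rw [hexp]; exact j6
  constructor
  · rw [← hmp.map_eq, integrable_map_measure (by rwa [hmp.map_eq]) hmp.measurable.aemeasurable]
    exact hcomp
  · rw [← hmp.map_eq, integral_map hmp.measurable.aemeasurable (by rwa [hmp.map_eq]), hexp]
    have hsum := integral_add' j5 (i6.const_mul (1 / 2))
    rw [integral_add' j4 i5, integral_add' j3 (i4.const_mul (κ / 2)),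
      integral_add' j12 (i3.const_mul (1 / 2)), integral_add' (i1.const_mul (κ / 2)) i2,
      integral_const_mul, integral_const_mul, integral_const_mul, integral_const_mul,
      v1, v2, v3, v4, v5, v6] at hsum
    exact hsum.trans (by ring)

end

/-! ### The efficient score -/

section

variable {p : ℕ} {C : Matrix (Fin p) (Fin p) ℝ}

/-- Pairing the equations with `d` gives `|d|² + tr(D C⁻¹ D C) = 0`, and the trace is nonnegative
because `C⁻¹` is positive definite. -/
lemma diagonal_scale_eq_zero (hC : C.PosDef) {d : Fin p → ℝ}
    (h : ∀ j, d j + (C⁻¹ * diagonal d * C) j j = 0) : d = 0 := by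
  obtain ⟨G, hG⟩ := exists_eq_mul_transpose hC.posSemidef
  have h1 : 0 ≤ (diagonal d * C⁻¹ * diagonal d * C).trace := by
    have e : (diagonal d * C⁻¹ * diagonal d * C).trace =
        ((diagonal d * G)ᵀ * C⁻¹ * (diagonal d * G)).trace := by
      rw [trace_transpose_mul_mul, transpose_mul, diagonal_transpose]
      have : diagonal d * G * (Gᵀ * diagonal d) = diagonal d * C * diagonal d := by
        rw [hG]; simp only [Matrix.mul_assoc]
      rw [this, Matrix.mul_assoc (diagonal d), Matrix.mul_assoc (diagonal d), trace_mul_comm]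
      simp only [Matrix.mul_assoc]
    rw [e]
    have h2 := hC.inv.posSemidef.conjTranspose_mul_mul_same (diagonal d * G)
    rw [conjTranspose_eq_transpose_of_trivial] at h2
    exact h2.trace_nonneg
  have h3 : ∑ j, d j * (d j + (C⁻¹ * diagonal d * C) j j) = 0 := by simp [h]
  have h4 : (diagonal d * C⁻¹ * diagonal d * C).trace = ∑ j, d j * (C⁻¹ * diagonal d * C) j j := by
    simp only [trace, diag_apply, Matrix.mul_assoc (diagonal d), diagonal_mul]
  have h5 : ∑ j, d j ^ 2 = 0 := by
    simp only [mul_add, Finset.sum_add_distrib, ← h4] at h3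
    have h6 : 0 ≤ ∑ j, d j * d j := Finset.sum_nonneg fun j _ => mul_self_nonneg _
    simp only [sq]
    linarith
  ext j
  have := (Finset.sum_eq_zero_iff_of_nonneg fun j _ => sq_nonneg (d j)).1 h5 j (Finset.mem_univ j)
  simpa using this

/-- The matrix of the quadratic form generated by rescaling the margins with weights `d`. -/
def scaleMatrix (C : Matrix (Fin p) (Fin p) ℝ) (d : Fin p → ℝ) : Matrix (Fin p) (Fin p) ℝ :=
  diagonal d * C⁻¹ + C⁻¹ * diagonal d

lemma isSymm_scaleMatrix (hC : C.IsSymm) (d : Fin p → ℝ) : (scaleMatrix C d).IsSymm := by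
  rw [scaleMatrix, IsSymm, transpose_add, transpose_mul, transpose_mul, diagonal_transpose,
    transpose_nonsing_inv, hC, add_comm]

lemma scaleMatrix_mul_apply (hC : C.PosDef) (d : Fin p → ℝ) (j : Fin p) :
    (scaleMatrix C d * C) j j = d j + (C⁻¹ * diagonal d * C) j j := by
  rw [scaleMatrix, Matrix.add_mul, Matrix.mul_assoc (diagonal d),
    nonsing_inv_mul _ (isUnit_iff_ne_zero.2 hC.det_pos.ne'), Matrix.mul_one, Matrix.add_apply,
    diagonal_apply_eq]

/-- These are the normal equations for projecting a quadratic form on the scale forms. They are a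
square system, so injectivity from `diagonal_scale_eq_zero` gives solvability. -/
lemma exists_scaleMatrix_diag_eq (hC : C.PosDef) (v : Fin p → ℝ) :
    ∃ d, ∀ j, (scaleMatrix C d * C) j j = v j := by
  let T : (Fin p → ℝ) →ₗ[ℝ] (Fin p → ℝ) :=
    { toFun := fun d j => (scaleMatrix C d * C) j j
      map_add' := fun d d' => by
        ext j
        have : diagonal (d + d') = diagonal d + diagonal d' := (diagonal_add d d').symm
        simp only [scaleMatrix, this, Matrix.add_mul, Matrix.mul_add, Matrix.add_apply,
          Pi.add_apply]
        ring
      map_smul' := fun a d => by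
        ext j
        simp only [scaleMatrix, diagonal_smul, Matrix.add_mul, Matrix.mul_smul, Matrix.smul_mul,
          Matrix.add_apply, Matrix.smul_apply, Pi.smul_apply, RingHom.id_apply, smul_eq_mul]
        ring }
  have hinj : Function.Injective T := by
    rw [← LinearMap.ker_eq_bot, LinearMap.ker_eq_bot']
    intro d hd
    refine diagonal_scale_eq_zero hC fun j => ?_
    rw [← scaleMatrix_mul_apply hC]
    exact congrFun hd j
  obtain ⟨d, hd⟩ := (LinearMap.injective_iff_surjective.1 hinj) v
  exact ⟨d, fun j => congrFun hd j⟩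

lemma mul_scaleMatrix_mul (hC : C.PosDef) (d : Fin p → ℝ) :
    C * scaleMatrix C d * C = C * diagonal d + diagonal d * C := by
  have hu : IsUnit C.det := isUnit_iff_ne_zero.2 hC.det_pos.ne'
  rw [scaleMatrix, Matrix.mul_add, Matrix.add_mul, ← Matrix.mul_assoc C, ← Matrix.mul_assoc C C⁻¹,
    mul_nonsing_inv _ hu, Matrix.one_mul, Matrix.mul_assoc (C * diagonal d),
    nonsing_inv_mul _ hu, Matrix.mul_one]

/-- The trace equals `2 Σ d_j (A C)_{jj}`: a vanishing diagonal of `A C` is orthogonality to the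
scale forms. -/
lemma trace_mul_scaleMatrix {A : Matrix (Fin p) (Fin p) ℝ} (hC : C.PosDef)
    (hA : A.IsSymm) (hAC : ∀ j, (A * C) j j = 0) (d : Fin p → ℝ) :
    (A * C * (scaleMatrix C d * C)).trace = 0 := by
  have hCs := PosSemidef.isSymm hC.posSemidef
  have e : A * C * (scaleMatrix C d * C) = A * (C * scaleMatrix C d * C) := by
    simp only [Matrix.mul_assoc]
  have h1 : (A * (C * diagonal d)).trace = 0 := by
    rw [← Matrix.mul_assoc]
    simp [trace, mul_diagonal, hAC]
  have h2 : (A * (diagonal d * C)).trace = (A * (C * diagonal d)).trace := by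
    rw [← trace_transpose, transpose_mul, transpose_mul, diagonal_transpose, hA, hCs,
      trace_mul_comm]
  rw [e, mul_scaleMatrix_mul hC, Matrix.mul_add, trace_add, h2, h1, add_zero]

/-- The copula law is carried by the open cube, where `Φ` and `Φ⁻¹` invert each other; outside it
the quantile function has default values. -/
lemma ae_uniformize_gaussianize (C : Matrix (Fin p) (Fin p) ℝ) :
    ∀ᵐ u ∂(copulaLaw C), uniformize (gaussianize u) = u := by
  have hs : MeasurableSet {u : Fin p → ℝ | uniformize (gaussianize u) = u} :=
    measurableSet_eq_fun (measurable_uniformize.comp measurable_gaussianize) measurable_id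
  rw [copulaLaw_eq_map, ae_map_iff measurable_uniformize.aemeasurable hs]
  exact ae_of_all _ fun z => by rw [gaussianize_uniformize]

lemma memLp_copulaLaw_iff {f : (Fin p → ℝ) → ℝ} (hf : AEStronglyMeasurable f (copulaLaw C)) :
    MemLp f 2 (copulaLaw C) ↔ MemLp (fun z => f (uniformize z)) 2 (gaussVec C) := by
  rw [← (measurePreserving_uniformize C).map_eq, memLp_map_measure_iff
    (by rwa [(measurePreserving_uniformize C).map_eq]) measurable_uniformize.aemeasurable]
  rfl

lemma memLp_centeredQuad_gaussianize (hC : C.PosSemidef) {A : Matrix (Fin p) (Fin p) ℝ}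
    (hA : A.IsSymm) : MemLp (fun u => centeredQuad C A (gaussianize u)) 2 (copulaLaw C) := by
  have hm : Measurable fun u : Fin p → ℝ => centeredQuad C A (gaussianize u) :=
    (continuous_centeredQuad C A).measurable.comp measurable_gaussianize
  rw [memLp_copulaLaw_iff hm.aestronglyMeasurable]
  simp_rw [gaussianize_uniformize]
  exact memLp_centeredQuad hC hA

/-- For `h_j = d_j (z_j² - 1)` the transport is `d_j z_j`, so the terms `d_j z_j²` cancel and `Σ d_j
(z_j (C⁻¹z)_j - 1)` remains. -/
lemma centeredQuad_scaleMatrix (hC : C.PosDef) (d : Fin p → ℝ) (z : Fin p → ℝ) :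
    centeredQuad C (scaleMatrix C d) z =
      scoreOperator C (fun j => scaleDirection (d j)) (uniformize z) := by
  have hCs := PosSemidef.isSymm hC.posSemidef
  have hu : IsUnit C.det := isUnit_iff_ne_zero.2 hC.det_pos.ne'
  rw [scoreOperator_uniformize hCs]
  simp only [scaleDirection_stdCdf, transport_scaleDirection]
  have h1 : z ⬝ᵥ (scaleMatrix C d *ᵥ z) = 2 * ∑ j, d j * z j * (C⁻¹ *ᵥ z) j := by
    have hi : (C⁻¹).IsSymm := by rw [IsSymm, transpose_nonsing_inv, hCs]
    rw [scaleMatrix, add_mulVec, dotProduct_add, ← mulVec_mulVec, ← mulVec_mulVec,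
      dotProduct_mulVec z C⁻¹, ← mulVec_transpose, hi]
    simp only [dotProduct, mulVec_diagonal]
    rw [two_mul]
    congr 1 <;> exact Finset.sum_congr rfl fun j _ => by ring
  have h2 : (scaleMatrix C d * C).trace = 2 * ∑ j, d j := by
    rw [scaleMatrix, Matrix.add_mul, trace_add, Matrix.mul_assoc, nonsing_inv_mul _ hu,
      Matrix.mul_one, trace_mul_comm (C⁻¹ * diagonal d), ← Matrix.mul_assoc,
      mul_nonsing_inv _ hu, Matrix.one_mul, trace_diagonal, two_mul]
  rw [centeredQuad, h1, h2, ← mul_sub, ← mul_assoc, ← Finset.sum_sub_distrib, Finset.mul_sum]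
  refine Finset.sum_congr rfl fun j _ => ?_
  rw [sub_mulVec, one_mulVec, Pi.sub_apply]
  ring

lemma centeredQuad_scaleMatrix_mem_tangentSpace (hC : C.PosDef) (d : Fin p → ℝ) :
    (fun u => centeredQuad C (scaleMatrix C d) (gaussianize u)) ∈ tangentSpace C := by
  refine ⟨memLp_centeredQuad_gaussianize hC.posSemidef
    (isSymm_scaleMatrix (PosSemidef.isSymm hC.posSemidef) d),
    fun j => scaleDirection (d j), fun j => scaleDirection_mem_L2Zero _, ?_⟩
  filter_upwards [ae_uniformize_gaussianize C] with u hu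
  rw [centeredQuad_scaleMatrix hC, hu]

lemma integral_centeredQuad_mul_tangent (hC : C.PosDef) (hC1 : ∀ j, C j j = 1)
    {A : Matrix (Fin p) (Fin p) ℝ} (hA : A.IsSymm) (hAC : ∀ j, (A * C) j j = 0)
    {f : (Fin p → ℝ) → ℝ} (hf : f ∈ tangentSpace C) :
    ∫ u, centeredQuad C A (gaussianize u) * f u ∂(copulaLaw C) = 0 := by
  obtain ⟨hfL, h, hh, hfh⟩ := hf
  have hmp := measurePreserving_uniformize C
  have hm : AEStronglyMeasurable (fun u => centeredQuad C A (gaussianize u) * f u)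
      (copulaLaw C) :=
    (memLp_centeredQuad_gaussianize hC.posSemidef hA).1.mul hfL.1
  rw [← hmp.map_eq, integral_map hmp.measurable.aemeasurable (by rwa [hmp.map_eq])]
  have e : (fun z => centeredQuad C A (gaussianize (uniformize z)) * f (uniformize z))
      =ᵐ[gaussVec C] fun z => ∑ j, centeredQuad C A z *
        (h j (stdCdf (z j)) + ((C⁻¹ - 1) *ᵥ z) j * transport (h j) (z j)) := by
    filter_upwards [hmp.quasiMeasurePreserving.ae hfh] with z hz
    rw [hz, gaussianize_uniformize, scoreOperator_uniformize
      (PosSemidef.isSymm hC.posSemidef), Finset.mul_sum]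
  rw [integral_congr_ae e, integral_finsetSum _ fun j _ =>
    (integral_centeredQuad_mul_marginScore hC hA (hC1 j) (hAC j) (hh j)).1]
  exact Finset.sum_eq_zero fun j _ =>
    (integral_centeredQuad_mul_marginScore hC hA (hC1 j) (hAC j) (hh j)).2

lemma L2Zero.sub {h h' : ℝ → ℝ} (hh : h ∈ L2Zero) (hh' : h' ∈ L2Zero) :
    (fun x => h x - h' x) ∈ L2Zero := by
  refine ⟨hh.1.sub hh'.1, ?_⟩
  rw [integral_sub (hh.1.integrable (by simp)) (hh'.1.integrable (by simp)), hh.2, hh'.2, sub_zero]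

lemma tangentSpace.sub {f f' : (Fin p → ℝ) → ℝ} (hf : f ∈ tangentSpace C)
    (hf' : f' ∈ tangentSpace C) : (fun u => f u - f' u) ∈ tangentSpace C := by
  obtain ⟨hfL, h, hh, hfh⟩ := hf
  obtain ⟨hfL', h', hh', hfh'⟩ := hf'
  refine ⟨hfL.sub hfL', fun j x => h j x - h' j x, fun j => L2Zero.sub (hh j) (hh' j), ?_⟩
  filter_upwards [hfh, hfh', ae_uniformize_gaussianize C] with u hu hu' huu
  rw [hu, hu', scoreOperator, scoreOperator, scoreOperator, ← Finset.sum_sub_distrib]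
  refine Finset.sum_congr rfl fun j _ => ?_
  have huj : u j ∈ Set.Ioo (0 : ℝ) 1 := by rw [← huu]; exact stdCdf_mem_Ioo _
  have hint : ∀ {g : ℝ → ℝ}, g ∈ L2Zero → IntervalIntegrable g volume 0 (u j) := fun {g} hg => by
    rw [intervalIntegrable_iff_integrableOn_Ioc_of_le huj.1.le]
    have : IntegrableOn g (Set.Icc 0 1) := hg.1.integrable (by simp)
    exact this.mono_set fun x hx => ⟨hx.1.le, hx.2.trans huj.2.le⟩
  rw [intervalIntegral.integral_sub (hint (hh j)) (hint (hh' j))]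
  ring

variable {k : ℕ} {R : (Fin k → ℝ) → Matrix (Fin p) (Fin p) ℝ} {θ : Fin k → ℝ}

/-- The efficient score is unique up to null sets. -/
lemma IsEfficientScore.ae_eq {m : Fin k} {e e' : (Fin p → ℝ) → ℝ}
    (he : IsEfficientScore R θ m e) (he' : IsEfficientScore R θ m e') :
    e =ᵐ[copulaLaw (R θ)] e' := by
  -- The difference of two versions lies in the tangent space and is orthogonal to it.
  have hsub : (fun u => e u - e' u) ∈ tangentSpace (R θ) := by
    have := tangentSpace.sub he'.sub_mem he.sub_mem
    simpa using this
  have h1 := he.orthogonal _ hsub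
  have h2 := he'.orthogonal _ hsub
  have hL : MemLp (fun u => e u - e' u) 2 (copulaLaw (R θ)) := he.memLp.sub he'.memLp
  have h3 : ∫ u, (e u - e' u) ^ 2 ∂(copulaLaw (R θ)) = 0 := by
    have e1 : ∀ u, (e u - e' u) ^ 2 = e u * (e u - e' u) - e' u * (e u - e' u) := fun u => by ring
    simp_rw [e1]
    have i1 : Integrable (fun u => e u * (e u - e' u)) (copulaLaw (R θ)) :=
      he.memLp.integrable_mul hL
    have i2 : Integrable (fun u => e' u * (e u - e' u)) (copulaLaw (R θ)) :=
      he'.memLp.integrable_mul hL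
    rw [integral_sub i1 i2, h1, h2, sub_zero]
  rw [integral_eq_zero_iff_of_nonneg (fun u => sq_nonneg _) hL.integrable_sq] at h3
  filter_upwards [h3] with u hu
  have : e u - e' u = 0 := by simpa using hu
  linarith

/-- The score minus this form is a scale form, hence tangent, and the form itself is orthogonal to
the tangent space. The projection is thus exhibited explicitly and no closedness of the tangent
space is needed. -/
lemma isEfficientScore_quadInfluence {Θ : Set (Fin k → ℝ)} (hR : IsCopulaParametrization Θ R)
    (hθ : θ ∈ Θ) {m : Fin k} {d : Fin p → ℝ} {A : Matrix (Fin p) (Fin p) ℝ}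
    (hAd : A = (R θ)⁻¹ * partialR R θ m * (R θ)⁻¹ - scaleMatrix (R θ) d) (hA : A.IsSymm)
    (hAC : ∀ j, (A * R θ) j j = 0) :
    IsEfficientScore R θ m (quadInfluence (R θ) A) := by
  have hC := hR.posDef θ hθ
  have hq : quadInfluence (R θ) A = fun u => centeredQuad (R θ) A (gaussianize u) :=
    funext fun u => quadInfluence_eq_centeredQuad hC.posSemidef hA u
  rw [hq]
  refine ⟨memLp_centeredQuad_gaussianize hC.posSemidef hA, ?_, fun f hf =>
    integral_centeredQuad_mul_tangent hC (hR.diag_eq_one θ hθ) hA hAC hf⟩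
  have e : (fun u => score R θ m u - centeredQuad (R θ) A (gaussianize u)) =
      fun u => centeredQuad (R θ) (scaleMatrix (R θ) d) (gaussianize u) := by
    ext u
    rw [score_eq_centeredQuad hR hθ, sub_eq_iff_eq_add, ← centeredQuad_add, hAd]
    congr 1
    abel
  rw [e]
  exact centeredQuad_scaleMatrix_mem_tangentSpace hC d

lemma informationMatrix_quadInfluence (hC : C.PosSemidef)
    {A : Fin k → Matrix (Fin p) (Fin p) ℝ} (hA : ∀ m, (A m).IsSymm) (m m' : Fin k) :
    informationMatrix C (fun m => quadInfluence C (A m)) m m' =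
      1 / 2 * (A m * C * (A m' * C)).trace := by
  have hm : ∀ m, Measurable fun u : Fin p → ℝ => centeredQuad C (A m) (gaussianize u) := fun m =>
    (continuous_centeredQuad C (A m)).measurable.comp measurable_gaussianize
  have hmm : Measurable fun u : Fin p → ℝ =>
      centeredQuad C (A m) (gaussianize u) * centeredQuad C (A m') (gaussianize u) :=
    (hm m).mul (hm m')
  rw [informationMatrix, of_apply, ← integral_centeredQuad_mul hC (hA m) (hA m')]
  simp_rw [quadInfluence_eq_centeredQuad hC (hA _)]
  rw [copulaLaw_eq_map, integral_map measurable_uniformize.aemeasurable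
    hmm.aestronglyMeasurable]
  simp_rw [gaussianize_uniformize]

lemma isSymm_partialR {Θ : Set (Fin k → ℝ)} (hR : IsCopulaParametrization Θ R)
    (hθ : θ ∈ Θ) (m : Fin k) : (partialR R θ m).IsSymm := by
  refine IsSymm.ext fun i j => ?_
  simp only [partialR, of_apply]
  refine Filter.EventuallyEq.lineDeriv_eq ?_
  filter_upwards [hR.isOpen.mem_nhds hθ] with t ht
  exact (PosSemidef.isSymm (hR.posDef t ht).posSemidef).apply i j

lemma partialR_diag {Θ : Set (Fin k → ℝ)} (hR : IsCopulaParametrization Θ R)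
    (hθ : θ ∈ Θ) (m : Fin k) (j : Fin p) : partialR R θ m j j = 0 := by
  simp only [partialR, of_apply]
  have h : (fun t => R t j j) =ᶠ[𝓝 θ] fun _ => 1 := by
    filter_upwards [hR.isOpen.mem_nhds hθ] with t ht using hR.diag_eq_one t ht j
  rw [h.lineDeriv_eq]
  simp [lineDeriv]

end

/-! ### Efficiency in terms of matrix spans -/

section

variable {p k : ℕ} {C : Matrix (Fin p) (Fin p) ℝ}

lemma centeredQuad_sum {ι : Type*} (s : Finset ι) (x : ι → ℝ) (A : ι → Matrix (Fin p) (Fin p) ℝ)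
    (z : Fin p → ℝ) :
    centeredQuad C (∑ i ∈ s, x i • A i) z = ∑ i ∈ s, x i * centeredQuad C (A i) z := by
  classical
  induction s using Finset.induction_on with
  | empty => simpa using centeredQuad_smul (C := C) 0 0 z
  | insert i s hi ih => rw [Finset.sum_insert hi, Finset.sum_insert hi, centeredQuad_add, ih,
      centeredQuad_smul]

/-- The map sending the matrix of a quadratic influence function to the corresponding tangent
vector of the manifold of correlation matrices. -/
def correlationTangent (C : Matrix (Fin p) (Fin p) ℝ) :
    Matrix (Fin p) (Fin p) ℝ →ₗ[ℝ] Matrix (Fin p) (Fin p) ℝ where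
  toFun X := C * X * C - (1 / 2 : ℝ) • (diagPart (C * X * C) * C + C * diagPart (C * X * C))
  map_add' X Y := by
    have e : ∀ M N : Matrix (Fin p) (Fin p) ℝ, diagPart (M + N) = diagPart M + diagPart N :=
      fun M N => (diagonal_add M.diag N.diag).symm
    simp only [Matrix.mul_add, Matrix.add_mul, e, smul_add]
    abel
  map_smul' a X := by
    have e : ∀ M : Matrix (Fin p) (Fin p) ℝ, diagPart (a • M) = a • diagPart M :=
      fun M => diagonal_smul a M.diag
    simp only [Matrix.mul_smul, Matrix.smul_mul, e, RingHom.id_apply, smul_sub, smul_add,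
      smul_comm a (1 / 2 : ℝ)]

lemma correlationTangent_apply (C X : Matrix (Fin p) (Fin p) ℝ) : correlationTangent C X =
    C * X * C - (1 / 2 : ℝ) • (diagPart (C * X * C) * C + C * diagPart (C * X * C)) := rfl

/-- Conjugation by `C` gives `S - (CD + DC)`. As `S` has zero and `C` unit diagonal, its diagonal
part is `-2D`, and the correction in `correlationTangent` restores exactly `CD + DC`. -/
lemma correlationTangent_sub_scaleMatrix (hC : C.PosDef) (hC1 : ∀ j, C j j = 1)
    {S : Matrix (Fin p) (Fin p) ℝ} (hS : ∀ j, S j j = 0) (d : Fin p → ℝ) :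
    correlationTangent C (C⁻¹ * S * C⁻¹ - scaleMatrix C d) = S := by
  have hu : IsUnit C.det := isUnit_iff_ne_zero.2 hC.det_pos.ne'
  have h1 : C * (C⁻¹ * S * C⁻¹ - scaleMatrix C d) * C = S - (C * diagonal d + diagonal d * C) := by
    rw [Matrix.mul_sub, Matrix.sub_mul, mul_scaleMatrix_mul hC, ← Matrix.mul_assoc,
      ← Matrix.mul_assoc, mul_nonsing_inv _ hu, Matrix.one_mul, Matrix.mul_assoc S,
      nonsing_inv_mul _ hu, Matrix.mul_one]
  have h2 : diagPart (S - (C * diagonal d + diagonal d * C)) = (-2 : ℝ) • diagonal d := by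
    rw [diagPart, ← diagonal_smul]
    congr 1
    ext j
    simp only [diag_apply, Matrix.sub_apply, Matrix.add_apply, mul_diagonal, diagonal_mul, hS, hC1,
      Pi.smul_apply, smul_eq_mul]
    ring
  rw [correlationTangent_apply, h1, h2, Matrix.smul_mul, Matrix.mul_smul, ← smul_add, smul_smul]
  norm_num
  abel

/-- Vanishing tangent forces `X` to be the scale matrix with `d = ½ diag(CXC)`, and a scale matrix
with `diag(X C) = 0` is zero. -/
lemma eq_zero_of_correlationTangent_eq_zero (hC : C.PosDef) {X : Matrix (Fin p) (Fin p) ℝ}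
    (hX : ∀ j, (X * C) j j = 0) (h : correlationTangent C X = 0) : X = 0 := by
  have hu : IsUnit C.det := isUnit_iff_ne_zero.2 hC.det_pos.ne'
  set d : Fin p → ℝ := (1 / 2 : ℝ) • (C * X * C).diag with hd
  have h1 : C * X * C = C * scaleMatrix C d * C := by
    rw [correlationTangent_apply, sub_eq_zero] at h
    rw [mul_scaleMatrix_mul hC, h, hd, diagonal_smul, Matrix.mul_smul, Matrix.smul_mul, ← smul_add,
      add_comm]
    rfl
  have h2 : X = scaleMatrix C d := by
    have h3 := congrArg (fun M => C⁻¹ * M * C⁻¹) h1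
    simpa only [← Matrix.mul_assoc, nonsing_inv_mul _ hu, Matrix.one_mul,
      mul_nonsing_inv_cancel_right _ _ hu] using h3
  have h3 : d = 0 := diagonal_scale_eq_zero hC fun j => by
    rw [← scaleMatrix_mul_apply hC, ← h2, hX]
  rw [h2, h3, scaleMatrix, diagonal_zero', Matrix.zero_mul, Matrix.mul_zero, add_zero]

/-- A form orthogonal to the scale forms has the same inner product with the efficient score as with
the full score. -/
lemma trace_mul_sub_scaleMatrix (hC : C.PosDef) {X S : Matrix (Fin p) (Fin p) ℝ} (hX : X.IsSymm)
    (hXC : ∀ j, (X * C) j j = 0) (d : Fin p → ℝ) :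
    (X * C * ((C⁻¹ * S * C⁻¹ - scaleMatrix C d) * C)).trace = (X * S).trace := by
  have hu : IsUnit C.det := isUnit_iff_ne_zero.2 hC.det_pos.ne'
  rw [Matrix.sub_mul, Matrix.mul_sub, trace_sub, trace_mul_scaleMatrix hC hX hXC, sub_zero,
    Matrix.mul_assoc (C⁻¹ * S), nonsing_inv_mul _ hu, Matrix.mul_one, ← Matrix.mul_assoc,
    Matrix.mul_assoc X, mul_nonsing_inv _ hu, Matrix.mul_one]

lemma isSymm_of_mem_span {B : Fin k → Matrix (Fin p) (Fin p) ℝ} (hB : ∀ m, (B m).IsSymm)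
    {X : Matrix (Fin p) (Fin p) ℝ} (hX : X ∈ Submodule.span ℝ (Set.range B)) : X.IsSymm := by
  induction hX using Submodule.span_induction with
  | mem x hx => obtain ⟨m, rfl⟩ := hx; exact hB m
  | zero => exact isSymm_zero
  | add x y _ _ hx hy => exact hx.add hy
  | smul a x _ hx => exact hx.smul a

variable {R : (Fin k → ℝ) → Matrix (Fin p) (Fin p) ℝ} {θ : Fin k → ℝ} {F : Fin p → Measure ℝ}
  {est : ∀ n, (Fin n → Fin p → ℝ) → Fin k → ℝ}

/-- The efficient scores are quadratic. -/
lemma exists_efficientMatrix {Θ : Set (Fin k → ℝ)} (hR : IsCopulaParametrization Θ R)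
    (hθ : θ ∈ Θ) (m : Fin k) : ∃ d : Fin p → ℝ,
      ((R θ)⁻¹ * partialR R θ m * (R θ)⁻¹ - scaleMatrix (R θ) d).IsSymm ∧
      ∀ j, (((R θ)⁻¹ * partialR R θ m * (R θ)⁻¹ - scaleMatrix (R θ) d) * R θ) j j = 0 := by
  have hC := hR.posDef θ hθ
  have hCs := PosSemidef.isSymm hC.posSemidef
  have hi : ((R θ)⁻¹).IsSymm := by rw [IsSymm, transpose_nonsing_inv, hCs]
  obtain ⟨d, hd⟩ := exists_scaleMatrix_diag_eq hC
    fun j => ((R θ)⁻¹ * partialR R θ m * (R θ)⁻¹ * R θ) j j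
  refine ⟨d, IsSymm.sub ?_ (isSymm_scaleMatrix hCs d), fun j => ?_⟩
  · rw [IsSymm, transpose_mul, transpose_mul, hi, isSymm_partialR hR hθ m, Matrix.mul_assoc]
  · rw [Matrix.sub_mul, Matrix.sub_apply, hd, sub_self]

/-- Subtracting the two expansions leaves a normalized sum of centered forms that is `o_P(1)`, which
is possible only for zero matrices. -/
lemma IsAsymptoticallyLinearAt.matrix_eq (hF : ∀ j, IsProbabilityMeasure (F j))
    (hFac : ∀ j, F j ≪ volume) (hrank : IsRankBased est) (hC : (R θ).PosDef)
    {A A' : Fin k → Matrix (Fin p) (Fin p) ℝ} (hA : ∀ m, (A m).IsSymm) (hA' : ∀ m, (A' m).IsSymm)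
    {ψ ψ' : (Fin p → ℝ) → Fin k → ℝ}
    (hψ : ∀ m, (fun u => ψ u m) =ᵐ[copulaLaw (R θ)] quadInfluence (R θ) (A m))
    (hψ' : ∀ m, (fun u => ψ' u m) =ᵐ[copulaLaw (R θ)] quadInfluence (R θ) (A' m))
    (h : IsAsymptoticallyLinearAt R est θ F ψ) (h' : IsAsymptoticallyLinearAt R est θ F ψ')
    (m : Fin k) : A m = A' m := by
  have h1 := (h'.isLittleOP_centeredQuad hF hFac hrank hC.posSemidef hA' hψ').sub
    (h.isLittleOP_centeredQuad hF hFac hrank hC.posSemidef hA hψ)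
  have h2 := eq_zero_of_isLittleOP_sum hC (K := fun m => A m - A' m)
    (fun m => (hA m).sub (hA' m)) (h1.congr fun n => ae_of_all _ fun x => ?_) m
  · exact sub_eq_zero.1 h2
  · have e : ∀ (m : Fin k) (z : Fin p → ℝ), centeredQuad (R θ) (A m - A' m) z =
        centeredQuad (R θ) (A m) z - centeredQuad (R θ) (A' m) z := fun m z => by
      rw [eq_sub_iff_add_eq, ← centeredQuad_add, sub_add_cancel]
    ext m
    simp only [e, Pi.sub_apply, Pi.smul_apply, Finset.sum_apply, Finset.sum_sub_distrib,
      smul_eq_mul]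
    ring

/-- A rank-based regular estimator sequence with quadratic influence functions is efficient if and
only if its matrices lie in the span of those of the efficient scores. -/
lemma isEfficientAt_iff {Θ : Set (Fin k → ℝ)} (hR : IsCopulaParametrization Θ R)
    (hθ : θ ∈ Θ) (hF : ∀ j, IsProbabilityMeasure (F j)) (hFac : ∀ j, F j ≪ volume)
    (hrank : IsRankBased est) (hreg : IsRegularAt R est θ F)
    {A : Fin k → Matrix (Fin p) (Fin p) ℝ} (hA : ∀ m, (A m).IsSymm)
    (hlin : IsAsymptoticallyLinearAt R est θ F fun u m => quadInfluence (R θ) (A m) u) :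
    IsEfficientAt R est θ F ↔ ∀ m, correlationTangent (R θ) (A m) ∈
      Submodule.span ℝ (Set.range (partialR R θ)) := by
  have hC := hR.posDef θ hθ
  choose d hsymm hdiag using exists_efficientMatrix hR hθ
  let E : Fin k → Matrix (Fin p) (Fin p) ℝ := fun m =>
    (R θ)⁻¹ * partialR R θ m * (R θ)⁻¹ - scaleMatrix (R θ) (d m)
  have hEs : ∀ m, (E m).IsSymm := hsymm
  have hEd : ∀ m j, (E m * R θ) j j = 0 := hdiag
  have hEt : ∀ m, correlationTangent (R θ) (E m) = partialR R θ m := fun m =>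
    correlationTangent_sub_scaleMatrix hC (hR.diag_eq_one θ hθ) (partialR_diag hR hθ m) (d m)
  have hEe : ∀ m, IsEfficientScore R θ m (quadInfluence (R θ) (E m)) := fun m =>
    isEfficientScore_quadInfluence hR hθ rfl (hsymm m) (hdiag m)
  have hsum : ∀ x : Fin k → ℝ, (∑ i, x i • E i).IsSymm := fun x =>
    isSymm_of_mem_span hEs (Submodule.sum_mem _ fun i _ =>
      Submodule.smul_mem _ _ (Submodule.subset_span ⟨i, rfl⟩))
  have hquad : ∀ (x : Fin k → ℝ) (u : Fin p → ℝ), quadInfluence (R θ) (∑ i, x i • E i) u =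
      ∑ i, x i * quadInfluence (R θ) (E i) u := fun x u => by
    rw [quadInfluence_eq_centeredQuad hC.posSemidef (hsum x), centeredQuad_sum]
    exact Finset.sum_congr rfl fun i _ => by
      rw [quadInfluence_eq_centeredQuad hC.posSemidef (hEs i)]
  constructor
  · rintro ⟨e, he, heff⟩ m
    set J := (informationMatrix (R θ) e)⁻¹
    -- Uniqueness of the efficient score lets `e` be replaced by the quadratic version; both
    -- expansions then have quadratic influence functions, so their matrices agree.
    have hAE : A m = ∑ i, J m i • E i := by
      refine hlin.matrix_eq hF hFac hrank hC hA (A' := fun m => ∑ i, J m i • E i)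
        (fun m => hsum (J m)) (fun m => ae_eq_rfl) (fun m => ?_) heff m
      filter_upwards [ae_all_iff.2 fun i => (he i).ae_eq (hEe i)] with u hu
      simp only [mulVec, dotProduct, hu, hquad]
    rw [hAE, map_sum]
    refine Submodule.sum_mem _ fun i _ => ?_
    rw [map_smul, hEt]
    exact Submodule.smul_mem _ _ (Submodule.subset_span ⟨i, rfl⟩)
  · intro h
    have hx : ∀ m, ∃ x : Fin k → ℝ, A m = ∑ i, x i • E i := fun m => by
      obtain ⟨x, hx⟩ := (Submodule.mem_span_range_iff_exists_fun ℝ).1 (h m)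
      -- The difference `A m - ∑ x i • E i` is killed by `correlationTangent` and has vanishing
      -- scale derivatives on both sides, so injectivity applies.
      refine ⟨x, sub_eq_zero.1 (eq_zero_of_correlationTangent_eq_zero hC (fun j => ?_) ?_)⟩
      · simp only [Matrix.sub_mul, Matrix.sub_apply, Matrix.sum_mul, Matrix.sum_apply,
          Matrix.smul_mul, Matrix.smul_apply, hEd,
          hrank.diag_mul_eq_zero hF hFac hC hreg hA hlin, smul_zero, Finset.sum_const_zero,
          sub_zero]
      · simp only [map_sub, map_sum, map_smul, hEt, hx, sub_self]
    choose X hX using hx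
    -- The entry of `X I*` at `(m, m')` is `Σ_i X_{mi} ½ tr(E_i Ṙ_{m'}) = ½ tr(A_m Ṙ_{m'}) = δ`.
    -- Invertibility of the information matrix comes out here rather than going in.
    have hinv : (informationMatrix (R θ) fun m => quadInfluence (R θ) (E m))⁻¹ = of X := by
      refine inv_eq_left_inv ?_
      ext m m'
      rw [← hreg.half_trace_mul_partialR hR hθ hF hFac hrank hA hlin m m', Matrix.mul_apply]
      simp only [informationMatrix_quadInfluence hC.posSemidef hEs, of_apply]
      rw [hX m, Matrix.sum_mul, trace_sum, Finset.mul_sum]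
      refine Finset.sum_congr rfl fun i _ => ?_
      rw [Matrix.smul_mul, trace_smul, smul_eq_mul,
        ← trace_mul_sub_scaleMatrix hC (hEs i) (hdiag i) (d m')]
      ring
    refine ⟨fun m => quadInfluence (R θ) (E m), hEe, ?_⟩
    rw [hinv]
    convert hlin using 3 with u m
    rw [hX m, hquad]
    rfl

/-- The matrices of a regular rank-based estimator sequence are linearly independent. -/
lemma IsRegularAt.linearIndependent {Θ : Set (Fin k → ℝ)} (hR : IsCopulaParametrization Θ R)
    (hθ : θ ∈ Θ) (hF : ∀ j, IsProbabilityMeasure (F j)) (hFac : ∀ j, F j ≪ volume)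
    (hrank : IsRankBased est) (hreg : IsRegularAt R est θ F)
    {A : Fin k → Matrix (Fin p) (Fin p) ℝ} (hA : ∀ m, (A m).IsSymm)
    (hlin : IsAsymptoticallyLinearAt R est θ F fun u m => quadInfluence (R θ) (A m) u) :
    LinearIndependent ℝ A := by
  rw [Fintype.linearIndependent_iff]
  intro g hg m'
  -- Pair the linear relation with each `Ṙ_{m'}`: the `A m` and the partial derivatives are
  -- biorthogonal up to the factor `½`.
  have h1 := congrArg (fun M => 1 / 2 * (M * partialR R θ m').trace) hg
  simp only [Matrix.sum_mul, Matrix.smul_mul, trace_sum, trace_smul, smul_eq_mul, Finset.mul_sum,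
    Matrix.zero_mul, trace_zero, mul_zero] at h1
  simp_rw [mul_left_comm (1 / 2 : ℝ),
    hreg.half_trace_mul_partialR hR hθ hF hFac hrank hA hlin _ m'] at h1
  simpa [Matrix.one_apply] using h1

/-- The `k` independent vectors already fill a span generated by `k` vectors. -/
lemma span_eq_of_linearIndependent {V : Type*} [AddCommGroup V] [Module ℝ V] {A B : Fin k → V}
    (hA : LinearIndependent ℝ A) (hAB : ∀ m, A m ∈ Submodule.span ℝ (Set.range B)) :
    Submodule.span ℝ (Set.range A) = Submodule.span ℝ (Set.range B) := by
  have : FiniteDimensional ℝ (Submodule.span ℝ (Set.range B)) :=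
    FiniteDimensional.span_of_finite ℝ (Set.finite_range B)
  refine Submodule.eq_of_le_of_finrank_le (Submodule.span_le.2 ?_) ?_
  · rintro _ ⟨m, rfl⟩
    exact hAB m
  · rw [finrank_span_eq_card hA]
    exact finrank_range_le_card B

end

end GaussianCopula

end

theorem proposition4p3 {p k : ℕ} (Θ : Set (Fin k → ℝ))
    (R : (Fin k → ℝ) → Matrix (Fin p) (Fin p) ℝ)
    (hR : GaussianCopula.IsCopulaParametrization Θ R)
    (θ : Fin k → ℝ) (hθ : θ ∈ Θ)
    (F : Fin p → Measure ℝ) (hF : ∀ j, IsProbabilityMeasure (F j)) (hFac : ∀ j, F j ≪ volume)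
    (est : ∀ n, (Fin n → Fin p → ℝ) → Fin k → ℝ)
    (hrank : GaussianCopula.IsRankBased est)
    (hreg : GaussianCopula.IsRegularAt R est θ F)
    (B : Fin k → Matrix (Fin p) (Fin p) ℝ) (hB : ∀ m, (B m).IsSymm)
    (A : Fin k → Matrix (Fin p) (Fin p) ℝ)
    (hA : ∀ m, A m ∈ Submodule.span ℝ (Set.range B))
    (hlin : GaussianCopula.IsAsymptoticallyLinearAt R est θ F
      fun u m => GaussianCopula.quadInfluence (R θ) (A m) u)
    (BR : Fin k → Matrix (Fin p) (Fin p) ℝ) (hBR : ∀ m, BR m = R θ * B m * R θ) :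
    GaussianCopula.IsEfficientAt R est θ F ↔
      ∀ m, BR m - (1 / 2 : ℝ) • (GaussianCopula.diagPart (BR m) * R θ +
          R θ * GaussianCopula.diagPart (BR m)) ∈
        Submodule.span ℝ (Set.range (GaussianCopula.partialR R θ)) := by
  have hAs : ∀ m, (A m).IsSymm := fun m => GaussianCopula.isSymm_of_mem_span hB (hA m)
  have hspan := GaussianCopula.span_eq_of_linearIndependent
    (hreg.linearIndependent hR hθ hF hFac hrank hAs hlin) hA
  -- Linearity of `correlationTangent` makes the criterion depend only on the span of the matrices,
  -- so `A` can be exchanged for `B`.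
  have hiff : ∀ G : Fin k → Matrix (Fin p) (Fin p) ℝ,
      (∀ m, GaussianCopula.correlationTangent (R θ) (G m) ∈
        Submodule.span ℝ (Set.range (GaussianCopula.partialR R θ))) ↔
      Submodule.span ℝ (Set.range G) ≤ (Submodule.span ℝ
        (Set.range (GaussianCopula.partialR R θ))).comap
          (GaussianCopula.correlationTangent (R θ)) := fun G => by
    rw [Submodule.span_le, Set.range_subset_iff]
    rfl
  rw [GaussianCopula.isEfficientAt_iff hR hθ hF hFac hrank hreg hAs hlin, hiff, hspan, ← hiff]
  simp only [GaussianCopula.correlationTangent_apply, hBR]
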